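/- A generic rectangulation is a partition of a rectangle into finitely many interior-disjoint axis-aligned rectangles, no four of which have a common point. Rectangle $r$ is left of $s$ if the right side of $r$ meets the left side of $s$ in a segment, and $r$ is below $s$ if the top side of $r$ meets the bottom side of $s$ in a segment. Let $\mathcal R_n$ be the set of generic rectangulations with $n$ rectangles, up to bijections of the rectangles that preserve both relations, and let $\square$ be the single element of $\mathcal R_1$. Deletion. For $R\in\mathcal R_n$, $n\ge 2$, let $r$ be its bottom-right rectangle. If the top-left vertex of $r$ is a T-joint of shape $\vdash$, the top side of $r$ is slid down to the bottom boundary; if it is of shape $\top$, the left side of $r$ is slid to the right boundary. The result is $p(R)\in\mathcal R_{n-1}$. The rectangles of $R$ are denoted $r_n,\dots,r_1$ in the order in which they disappear under repeated deletion. Insertion. For $R\in\mathcal R_n$, choose one interior point (a vertical insertion point) of each edge on the left side of each rectangle touching the bottom boundary, and one interior point (a horizontal insertion point) of each edge on the top side of each rectangle touching the right boundary; edges are segments between consecutive vertices. Let $q_1,\dots,q_\nu$, $\nu=\nu(R)$, be the vertical insertion points sorted lexicographically by $(x,y)$, followed by the horizontal ones sorted lexicographically by $(y,x)$. Then $c_i(R)\in\mathcal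 R_{n+1}$ is obtained by inserting a new rectangle in the bottom-right corner with top-left corner at $q_i$: if $q_i$ is vertical, it has above it exactly the rectangles of $R$ right of $q_i$ touching the bottom boundary, and to its left exactly those which touch the vertical line through $q_i$ from the left below $q_i$; if $q_i$ is horizontal, it has to its left exactly the rectangles of $R$ below $q_i$ touching the right boundary, and above it exactly those which touch the horizontal line through $q_i$ from above to the right of $q_i$. Zigzag sets. $\mathcal C_n\subseteq\mathcal R_n$ is zigzag if either $n=1$ and $\mathcal C_1=\{\square\}$, or $n\ge 2$, the set $\mathcal C_{n-1}:=\{p(R)\mid R\in\mathcal C_n\}$ is zigzag, and $c_1(R),c_{\nu(R)}(R)\in\mathcal C_n$ for every $R\in\mathcal C_{n-1}$. It is symmetric if it is closed under reflection at the main diagonal (from the top-left to the bottom-right corner). Jumps. Call $R$ bottom-based (right-based) if a side of one rectangle is the entire bottom (right) boundary. For $2\le j\le n$ and $d>0$, $R'\in\mathcal R_n$ differs from $R\in\mathcal R_n$ by a right jump of $r_j$ by $d$ steps that is minimal with respect to $\mathcal C_n$ if either $j=n$, $p(R)=p(R')=P$, $R=c_k(P)$ and $R'=c_{k+d}(P)$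 for some $k>0$, and $c_\ell(P)\notin\mathcal C_n$ whenever $k<\ell<k+d$; or $j<n$, $R$ and $R'$ are both bottom-based or both right-based, and $p(R')$ differs from $p(R)$ by a right jump of $r_j$ by $d$ steps that is minimal with respect to $\{p(Q)\mid Q\in\mathcal C_n\}$. Minimal left jumps are the inverses of minimal right jumps. Algorithm J (input: $\mathcal C_n$ and an initial rectangulation $R_0\in\mathcal C_n$): visit $R_0$; then repeatedly, among all minimal jumps from the most recently visited rectangulation to an unvisited element of $\mathcal C_n$, perform one whose rectangle $r_j$ has maximum index $j$; terminate if there is none, or if for this $j$ jumps in both directions are possible. Theorem. Let $n\ge 1$, let $\mathcal C_n\subseteq\mathcal R_n$ be a zigzag set, and let $R_0$ be the rectangulation consisting of $n$ rectangles stacked side by side, or the one consisting of $n$ rectangles stacked on top of each other. Then Algorithm J, started with $R_0$, visits every rectangulation in $\mathcal C_n$ exactly once. Moreover, if $n\ge 2$ and $\mathcal C_n$ is symmetric, then the listing is cyclic: the first and the last visited rectangulation differ in a minimal jump. -/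

import Mathlib

/-! ### Rectangulations as geometric objects -/

/-- A nondegenerate closed axis-aligned rectangle in the plane. -/
structure Rect where
  left : ℝ
  right : ℝ
  bottom : ℝ
  top : ℝ
  left_lt_right : left < right
  bottom_lt_top : bottom < top

/-- The closed region of a rectangle. -/
def Rect.region (r : Rect) : Set (ℝ × ℝ) :=
  Set.Icc r.left r.right ×ˢ Set.Icc r.bottom r.top

/-- The open region of a rectangle. -/
def Rect.inner (r : Rect) : Set (ℝ × ℝ) :=
  Set.Ioo r.left r.right ×ˢ Set.Ioo r.bottom r.top

/-- A drawing of a generic rectangulation with `n` rectangles: a partition of the rectangle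
`outer` into the interior-disjoint rectangles `rect i`, no four of which have a common point.
The labels `i` carry no meaning; they are forgotten in `GenRect`. -/
structure Rectangulation (n : ℕ) where
  outer : Rect
  rect : Fin n → Rect
  cover : ⋃ i, (rect i).region = outer.region
  disjoint : ∀ i j, i ≠ j → Disjoint (rect i).inner (rect j).inner
  generic : ∀ p : ℝ × ℝ, {i | p ∈ (rect i).region}.ncard ≤ 3

namespace Rectangulation

variable {n : ℕ}

/-- Rectangle `i` is left of rectangle `j`: the right side of `i` meets the left side of `j`
in a line segment. -/
def IsLeftOf (R : Rectangulation n) (i j : Fin n) : Prop :=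
  (R.rect i).right = (R.rect j).left ∧
    (R.rect i).bottom < (R.rect j).top ∧ (R.rect j).bottom < (R.rect i).top

/-- Rectangle `i` is below rectangle `j`: the top side of `i` meets the bottom side of `j`
in a line segment. -/
def IsBelow (R : Rectangulation n) (i j : Fin n) : Prop :=
  (R.rect i).top = (R.rect j).bottom ∧
    (R.rect i).left < (R.rect j).right ∧ (R.rect j).left < (R.rect i).right

/-- Equivalence of drawings: a bijection between the rectangles that preserves the left/right
and the below/above relations. -/
def Equivalent (R S : Rectangulation n) : Prop :=
  ∃ σ : Equiv.Perm (Fin n), ∀ i j,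
    (R.IsLeftOf i j ↔ S.IsLeftOf (σ i) (σ j)) ∧ (R.IsBelow i j ↔ S.IsBelow (σ i) (σ j))

instance setoid (n : ℕ) : Setoid (Rectangulation n) where
  r := Equivalent
  iseqv :=
    { refl := fun _ => ⟨1, fun _ _ => ⟨Iff.rfl, Iff.rfl⟩⟩
      symm := by
        rintro R S ⟨σ, h⟩
        refine ⟨σ.symm, fun i j => ?_⟩
        have := h (σ.symm i) (σ.symm j)
        simp only [Equiv.apply_symm_apply] at this
        exact ⟨this.1.symm, this.2.symm⟩
      trans := by
        rintro R S T ⟨σ, h⟩ ⟨τ, h'⟩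
        exact ⟨τ * σ, fun i j => ⟨(h i j).1.trans (h' _ _).1, (h i j).2.trans (h' _ _).2⟩⟩ }

/-! ### Vertices and edges -/

/-- A vertex is a corner of some rectangle. -/
def IsVertex (R : Rectangulation n) (v : ℝ × ℝ) : Prop :=
  ∃ i, (v.1 = (R.rect i).left ∨ v.1 = (R.rect i).right) ∧
    (v.2 = (R.rect i).bottom ∨ v.2 = (R.rect i).top)

/-- Some side of a rectangle continues from the point `v` upwards. -/
def HasEdgeUp (R : Rectangulation n) (v : ℝ × ℝ) : Prop :=
  ∃ i, (v.1 = (R.rect i).left ∨ v.1 = (R.rect i).right) ∧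
    (R.rect i).bottom ≤ v.2 ∧ v.2 < (R.rect i).top

/-- Some side of a rectangle continues from the point `v` downwards. -/
def HasEdgeDown (R : Rectangulation n) (v : ℝ × ℝ) : Prop :=
  ∃ i, (v.1 = (R.rect i).left ∨ v.1 = (R.rect i).right) ∧
    (R.rect i).bottom < v.2 ∧ v.2 ≤ (R.rect i).top

/-- Some side of a rectangle continues from the point `v` to the right. -/
def HasEdgeRight (R : Rectangulation n) (v : ℝ × ℝ) : Prop :=
  ∃ i, (v.2 = (R.rect i).bottom ∨ v.2 = (R.rect i).top) ∧
    (R.rect i).left ≤ v.1 ∧ v.1 < (R.rect i).right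

/-- Some side of a rectangle continues from the point `v` to the left. -/
def HasEdgeLeft (R : Rectangulation n) (v : ℝ × ℝ) : Prop :=
  ∃ i, (v.2 = (R.rect i).bottom ∨ v.2 = (R.rect i).top) ∧
    (R.rect i).left < v.1 ∧ v.1 ≤ (R.rect i).right

/-- The vertex `v` is a T-joint of shape `⊢`. -/
def IsRightT (R : Rectangulation n) (v : ℝ × ℝ) : Prop :=
  R.HasEdgeUp v ∧ R.HasEdgeDown v ∧ R.HasEdgeRight v ∧ ¬ R.HasEdgeLeft v

/-- The vertex `v` is a T-joint of shape `⊤`. -/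
def IsBottomT (R : Rectangulation n) (v : ℝ × ℝ) : Prop :=
  R.HasEdgeLeft v ∧ R.HasEdgeRight v ∧ R.HasEdgeDown v ∧ ¬ R.HasEdgeUp v

/-- Rectangle `i` touches the bottom boundary. -/
def TouchesBottom (R : Rectangulation n) (i : Fin n) : Prop :=
  (R.rect i).bottom = R.outer.bottom

/-- Rectangle `i` touches the right boundary. -/
def TouchesRight (R : Rectangulation n) (i : Fin n) : Prop :=
  (R.rect i).right = R.outer.right

/-- The bottom side of some rectangle is the entire bottom boundary. -/
def IsBottomBased (R : Rectangulation n) : Prop :=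
  ∃ i, R.TouchesBottom i ∧ (R.rect i).left = R.outer.left ∧ (R.rect i).right = R.outer.right

/-- The right side of some rectangle is the entire right boundary. -/
def IsRightBased (R : Rectangulation n) : Prop :=
  ∃ i, R.TouchesRight i ∧ (R.rect i).bottom = R.outer.bottom ∧ (R.rect i).top = R.outer.top

/-! ### Deletion of the bottom-right rectangle -/

/-- The drawing `S` arises from the drawing `R` by deleting the bottom-right rectangle `r`
(which carries the last label).  If the top-left vertex of `r` has type `⊢`, the top side of `r`
slides down to the bottom boundary, i.e. exactly the rectangles above `r` are extended downwards.
If it has type `⊤`, the left side of `r` slides to the right boundary, i.e. exactly the rectangles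
left of `r` are extended to the right. -/
def IsDeletion (R : Rectangulation (n + 1)) (S : Rectangulation n) : Prop :=
  R.TouchesBottom (Fin.last n) ∧ R.TouchesRight (Fin.last n) ∧ S.outer = R.outer ∧
  ((R.IsRightT ((R.rect (Fin.last n)).left, (R.rect (Fin.last n)).top) ∧
      ∀ i : Fin n,
        (S.rect i).left = (R.rect i.castSucc).left ∧
        (S.rect i).right = (R.rect i.castSucc).right ∧
        (S.rect i).top = (R.rect i.castSucc).top ∧
        (R.IsBelow (Fin.last n) i.castSucc → (S.rect i).bottom = R.outer.bottom) ∧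
        (¬ R.IsBelow (Fin.last n) i.castSucc → (S.rect i).bottom = (R.rect i.castSucc).bottom)) ∨
   (R.IsBottomT ((R.rect (Fin.last n)).left, (R.rect (Fin.last n)).top) ∧
      ∀ i : Fin n,
        (S.rect i).left = (R.rect i.castSucc).left ∧
        (S.rect i).bottom = (R.rect i.castSucc).bottom ∧
        (S.rect i).top = (R.rect i.castSucc).top ∧
        (R.IsLeftOf i.castSucc (Fin.last n) → (S.rect i).right = R.outer.right) ∧
        (¬ R.IsLeftOf i.castSucc (Fin.last n) → (S.rect i).right = (R.rect i.castSucc).right)))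

end Rectangulation

/-! ### Insertion of a rectangle -/

/-- A point of the plane, marked as a vertical or as a horizontal insertion point. -/
inductive InsPoint where
  | vert (x y : ℝ) : InsPoint
  | horiz (x y : ℝ) : InsPoint

/-- The linear order of insertion points: the vertical ones, lexicographically by `(x, y)`,
come before the horizontal ones, which are ordered lexicographically by `(y, x)`. -/
def InsPoint.Before : InsPoint → InsPoint → Prop
  | .vert x y, .vert x' y' => x < x' ∨ (x = x' ∧ y < y')
  | .vert _ _, .horiz _ _ => True
  | .horiz _ _, .vert _ _ => False
  | .horiz x y, .horiz x' y' => y < y' ∨ (y = y' ∧ x < x')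

/-- A vertical or horizontal line segment: `vert x a b` is `{x} × [a, b]` and `horiz y a b` is
`[a, b] × {y}`. -/
inductive InsEdge where
  | vert (x a b : ℝ) : InsEdge
  | horiz (y a b : ℝ) : InsEdge

/-- The point lies in the relative interior of the segment of the same direction. -/
def InsPoint.InteriorTo : InsPoint → InsEdge → Prop
  | .vert x y, .vert x' a b => x = x' ∧ a < y ∧ y < b
  | .horiz x y, .horiz y' a b => y = y' ∧ a < x ∧ x < b
  | _, _ => False

namespace Rectangulation

variable {n : ℕ}

/-- The edges that carry an insertion point: the edges forming the left side of a rectangle that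
touches the bottom boundary, and the edges forming the top side of a rectangle that touches the
right boundary.  (An edge is a segment between two vertices with no vertex in between.) -/
def IsInsertionEdge (R : Rectangulation n) : InsEdge → Prop
  | .vert x a b => R.IsVertex (x, a) ∧ R.IsVertex (x, b) ∧ a < b ∧
      (∀ c, a < c → c < b → ¬ R.IsVertex (x, c)) ∧
      ∃ i, R.TouchesBottom i ∧ x = (R.rect i).left ∧ (R.rect i).bottom ≤ a ∧ b ≤ (R.rect i).top
  | .horiz y a b => R.IsVertex (a, y) ∧ R.IsVertex (b, y) ∧ a < b ∧
      (∀ c, a < c → c < b → ¬ R.IsVertex (c, y)) ∧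
      ∃ i, R.TouchesRight i ∧ y = (R.rect i).top ∧ (R.rect i).left ≤ a ∧ b ≤ (R.rect i).right

/-- `qs` is a sequence of insertion points of the drawing `R`: one interior point of each
insertion edge, listed in increasing order. -/
def IsInsertionSequence (R : Rectangulation n) (qs : List InsPoint) : Prop :=
  qs.Pairwise InsPoint.Before ∧
  (∀ q ∈ qs, ∃ e, R.IsInsertionEdge e ∧ q.InteriorTo e) ∧
  (∀ e, R.IsInsertionEdge e → ∃! q, q ∈ qs ∧ q.InteriorTo e)

/-- The drawing `S` arises from the drawing `R` by inserting a new rectangle (with the last label)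
into the bottom-right corner, with top-left corner `q`.  For a vertical insertion point, the
rectangles that touch the bottom boundary and lie to the right of `q` are cut off at the top side
of the new rectangle, and so lie above it; for a horizontal one, the rectangles that touch the right
boundary and lie below `q` are cut off at the left side of the new rectangle. -/
def IsInsertionAt (R : Rectangulation n) (S : Rectangulation (n + 1)) : InsPoint → Prop
  | .vert x y =>
      S.outer = R.outer ∧
      (S.rect (Fin.last n)).left = x ∧ (S.rect (Fin.last n)).top = y ∧
      S.TouchesBottom (Fin.last n) ∧ S.TouchesRight (Fin.last n) ∧
      ∀ i : Fin n,
        (S.rect i.castSucc).left = (R.rect i).left ∧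
        (S.rect i.castSucc).right = (R.rect i).right ∧
        (S.rect i.castSucc).top = (R.rect i).top ∧
        (R.TouchesBottom i ∧ x ≤ (R.rect i).left → (S.rect i.castSucc).bottom = y) ∧
        (¬ (R.TouchesBottom i ∧ x ≤ (R.rect i).left) →
          (S.rect i.castSucc).bottom = (R.rect i).bottom)
  | .horiz x y =>
      S.outer = R.outer ∧
      (S.rect (Fin.last n)).left = x ∧ (S.rect (Fin.last n)).top = y ∧
      S.TouchesBottom (Fin.last n) ∧ S.TouchesRight (Fin.last n) ∧
      ∀ i : Fin n,
        (S.rect i.castSucc).left = (R.rect i).left ∧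
        (S.rect i.castSucc).bottom = (R.rect i).bottom ∧
        (S.rect i.castSucc).top = (R.rect i).top ∧
        (R.TouchesRight i ∧ (R.rect i).top ≤ y → (S.rect i.castSucc).right = x) ∧
        (¬ (R.TouchesRight i ∧ (R.rect i).top ≤ y) →
          (S.rect i.castSucc).right = (R.rect i).right)

/-- The drawing `S` is the mirror image of `R` under `(x, y) ↦ (-y, -x)`.  Up to equivalence of
drawings, this is the reflection at the main diagonal, which runs from the top-left to the
bottom-right corner. -/
def IsReflection (R S : Rectangulation n) : Prop :=
  (S.outer.left = -R.outer.top ∧ S.outer.right = -R.outer.bottom ∧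
    S.outer.bottom = -R.outer.right ∧ S.outer.top = -R.outer.left) ∧
  ∀ i, (S.rect i).left = -(R.rect i).top ∧ (S.rect i).right = -(R.rect i).bottom ∧
    (S.rect i).bottom = -(R.rect i).right ∧ (S.rect i).top = -(R.rect i).left

/-- `n` unit squares side by side, from left to right. -/
def sideBySide (n : ℕ) (hn : 1 ≤ n) : Rectangulation n where
  outer := ⟨0, n, 0, 1, by exact_mod_cast hn, one_pos⟩
  rect i := ⟨(i : ℕ), (i : ℕ) + 1, 0, 1, by linarith, one_pos⟩
  cover := by
    ext ⟨x, y⟩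
    simp only [Rect.region, Set.mem_iUnion, Set.mem_prod, Set.mem_Icc]
    constructor
    · rintro ⟨i, ⟨h1, h2⟩, h3⟩
      have : ((i : ℕ) : ℝ) + 1 ≤ n := by exact_mod_cast i.2
      exact ⟨⟨le_trans (Nat.cast_nonneg _) h1, h2.trans this⟩, h3⟩
    · rintro ⟨⟨h1, h2⟩, h3⟩
      rcases h2.lt_or_eq with h | h
      · exact ⟨⟨⌊x⌋₊, (Nat.floor_lt h1).2 h⟩, ⟨Nat.floor_le h1, (Nat.lt_floor_add_one x).le⟩, h3⟩
      · refine ⟨⟨n - 1, by omega⟩, ⟨?_, ?_⟩, h3⟩ <;> simp [h, Nat.cast_sub hn]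
  disjoint := by
    intro i j hij
    rw [Set.disjoint_left]
    rintro ⟨x, y⟩ ⟨⟨h1, h2⟩, -⟩ ⟨⟨h3, h4⟩, -⟩
    dsimp only at h1 h2 h3 h4
    have a : (i : ℕ) < (j : ℕ) + 1 := by exact_mod_cast h1.trans h4
    have b : (j : ℕ) < (i : ℕ) + 1 := by exact_mod_cast h3.trans h2
    exact hij (Fin.ext (by omega))
  generic := by
    rintro ⟨x, y⟩
    refine (Set.ncard_le_ncard_of_injOn (t := ({⌊x⌋₊ - 1, ⌊x⌋₊} : Set ℕ)) Fin.val ?_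
      Fin.val_injective.injOn (Set.toFinite _)).trans ((Set.ncard_insert_le _ _).trans (by simp))
    rintro i ⟨⟨h1, h2⟩, -⟩
    dsimp only at h1 h2
    have a : (i : ℕ) ≤ ⌊x⌋₊ := Nat.le_floor h1
    have b : ⌊x⌋₊ ≤ (i : ℕ) + 1 := Nat.floor_le_of_le (by exact_mod_cast h2)
    simp only [Set.mem_insert_iff, Set.mem_singleton_iff]
    omega

/-- `n` unit squares on top of each other, from bottom to top. -/
def onTop (n : ℕ) (hn : 1 ≤ n) : Rectangulation n where
  outer := ⟨0, 1, 0, n, one_pos, by exact_mod_cast hn⟩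
  rect i := ⟨0, 1, (i : ℕ), (i : ℕ) + 1, one_pos, by linarith⟩
  cover := by
    have h := congrArg (fun s : Set (ℝ × ℝ) => Prod.swap ⁻¹' s) (sideBySide n hn).cover
    simpa only [Rect.region, sideBySide, Set.preimage_iUnion, Set.preimage_swap_prod] using h
  disjoint i j hij := by
    have h := ((sideBySide n hn).disjoint i j hij).preimage Prod.swap
    simpa only [Rect.inner, sideBySide, Set.preimage_swap_prod] using h
  generic p := by
    have h := (sideBySide n hn).generic p.swap
    simpa only [Rect.region, sideBySide, Set.mem_prod, Prod.fst_swap, Prod.snd_swap,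
      and_comm] using h

end Rectangulation

/-! ### Rectangulations up to equivalence -/

/-- The set of generic rectangulations with `n` rectangles, up to equivalence. -/
def GenRect (n : ℕ) : Type := Quotient (Rectangulation.setoid n)

namespace GenRect

variable {n : ℕ}

/-- The drawing `D` represents the rectangulation `R`. -/
def IsDrawing (D : Rectangulation n) (R : GenRect n) : Prop :=
  (Quotient.mk (Rectangulation.setoid n) D : GenRect n) = R

/-- `P = p(R)`: the rectangulation `P` is obtained from `R` by deletion. -/
def IsParent (R : GenRect (n + 1)) (P : GenRect n) : Prop :=
  ∃ D E, IsDrawing D R ∧ IsDrawing E P ∧ D.IsDeletion E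

/-- `ν = ν(P)` is the number of insertion points of `P`. -/
def IsInsertionCount (P : GenRect n) (ν : ℕ) : Prop :=
  ∃ E qs, IsDrawing E P ∧ E.IsInsertionSequence qs ∧ qs.length = ν

/-- `R = c_k(P)`: the rectangulation `R` is obtained from `P` by insertion at the `k`th insertion
point, where `k` counts from `1`. -/
def IsChild (P : GenRect n) (k : ℕ) (R : GenRect (n + 1)) : Prop :=
  ∃ E D qs q, IsDrawing E P ∧ IsDrawing D R ∧ E.IsInsertionSequence qs ∧
    1 ≤ k ∧ qs[k - 1]? = some q ∧ E.IsInsertionAt D q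

/-- Some drawing of `R`, equivalently every drawing, is bottom-based. -/
def IsBottomBased (R : GenRect n) : Prop := ∃ D, IsDrawing D R ∧ D.IsBottomBased

/-- Some drawing of `R`, equivalently every drawing, is right-based. -/
def IsRightBased (R : GenRect n) : Prop := ∃ D, IsDrawing D R ∧ D.IsRightBased

/-- `R'` is the reflection of `R` at the main diagonal. -/
def IsReflection (R R' : GenRect n) : Prop :=
  ∃ D E, IsDrawing D R ∧ IsDrawing E R' ∧ D.IsReflection E

/-- The rectangulation that consists of `n` rectangles side by side. -/
def sideBySide (n : ℕ) (hn : 1 ≤ n) : GenRect n :=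
  Quotient.mk (Rectangulation.setoid n) (Rectangulation.sideBySide n hn)

/-- The rectangulation that consists of `n` rectangles on top of each other. -/
def onTop (n : ℕ) (hn : 1 ≤ n) : GenRect n :=
  Quotient.mk (Rectangulation.setoid n) (Rectangulation.onTop n hn)

/-- The rectangulation that consists of a single rectangle. -/
def square : GenRect 1 := sideBySide 1 le_rfl

/-- The set `{p(R) | R ∈ C}`. -/
def parents (C : Set (GenRect (n + 1))) : Set (GenRect n) :=
  {P | ∃ R ∈ C, IsParent R P}

/-- Zigzag sets of rectangulations. -/
def IsZigzag : (n : ℕ) → Set (GenRect n) → Prop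
  | 0, _ => False
  | 1, C => C = {square}
  | n + 2, C => IsZigzag (n + 1) (parents C) ∧
      ∀ P ∈ parents C, ∀ ν, IsInsertionCount P ν →
        ∀ R, (IsChild P 1 R ∨ IsChild P ν R) → R ∈ C

/-- Closure under reflection at the main diagonal. -/
def IsSymmetric (C : Set (GenRect n)) : Prop :=
  ∀ R ∈ C, ∀ R', IsReflection R R' → R' ∈ C

/-! ### Jumps -/

/-- `R'` differs from `R` by a right jump of rectangle `r_j` by `d` steps which is minimal with
respect to the set `C`.  (For `C = ∅` these are all right jumps.)  If `r_j` is not the last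
rectangle, minimality refers to the rectangulations obtained from those in `C` by deleting
`r_n, …, r_{j+1}`. -/
def IsMinRightJump : (n : ℕ) → Set (GenRect n) → (R R' : GenRect n) → (j d : ℕ) → Prop
  | 0, _, _, _, _, _ => False
  | 1, _, _, _, _, _ => False
  | n + 2, C, R, R', j, d =>
      2 ≤ j ∧ 0 < d ∧
      ((j = n + 2 ∧ ∃ P k, 0 < k ∧ IsParent R P ∧ IsParent R' P ∧
          IsChild P k R ∧ IsChild P (k + d) R' ∧
          ¬ ∃ l, k < l ∧ l < k + d ∧ ∃ Q ∈ C, IsChild P l Q) ∨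
       (j < n + 2 ∧
          ((IsBottomBased R ∧ IsBottomBased R') ∨ (IsRightBased R ∧ IsRightBased R')) ∧
          ∃ P P', IsParent R P ∧ IsParent R' P' ∧ IsMinRightJump (n + 1) (parents C) P P' j d))

/-- The two directions of a jump. -/
inductive Direction where
  | left
  | right

/-- `R'` differs from `R` by a jump of `r_j` by `d` steps in the given direction which is minimal
with respect to `C`.  Left jumps are the inverses of right jumps. -/
def IsMinJump (C : Set (GenRect n)) (R R' : GenRect n) (j d : ℕ) : Direction → Prop
  | .right => IsMinRightJump n C R R' j d
  | .left => IsMinRightJump n C R' R j d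

/-- `R` and `R'` differ in a minimal jump. -/
def DifferInMinJump (C : Set (GenRect n)) (R R' : GenRect n) : Prop :=
  ∃ j d dir, IsMinJump C R R' j d dir

/-! ### The greedy algorithm -/

/-- A minimal jump of `r_j` in direction `dir` leads from `cur` to `nxt`, which belongs to `C` and
has not been visited. -/
def IsCandidate (C : Set (GenRect n)) (visited : List (GenRect n)) (cur : GenRect n)
    (j : ℕ) (dir : Direction) (nxt : GenRect n) : Prop :=
  nxt ∈ C ∧ nxt ∉ visited ∧ ∃ d, IsMinJump C cur nxt j d dir

/-- One step of the algorithm: among all jumps that lead to an unvisited rectangulation, one of the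
rectangle with maximum index `j` is performed, provided that its direction is not ambiguous. -/
def IsStep (C : Set (GenRect n)) (visited : List (GenRect n)) (cur nxt : GenRect n) : Prop :=
  ∃ j dir, IsCandidate C visited cur j dir nxt ∧
    (∀ j' dir' R, IsCandidate C visited cur j' dir' R → j' ≤ j) ∧
    (∀ dir' R, IsCandidate C visited cur j dir' R → dir' = dir)

/-- The lists of rectangulations that have been visited, in the order of the visits, at some stage
of the algorithm with initial rectangulation `R₀`. -/
inductive Visits (C : Set (GenRect n)) (R₀ : GenRect n) : List (GenRect n) → Prop
  | init : Visits C R₀ [R₀]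
  | step (visited : List (GenRect n)) (cur nxt : GenRect n) :
      Visits C R₀ (visited ++ [cur]) → IsStep C (visited ++ [cur]) cur nxt →
      Visits C R₀ (visited ++ [cur] ++ [nxt])

/-- `L` is the list of all rectangulations visited by the algorithm until it terminates. -/
def IsOutput (C : Set (GenRect n)) (R₀ : GenRect n) (L : List (GenRect n)) : Prop :=
  Visits C R₀ L ∧
    ∀ visited cur, L = visited ++ [cur] → ¬ ∃ nxt, IsStep C L cur nxt

end GenRect

/-! ### Reflection of rectangles and elementary geometry of drawings -/

/-! Deletion turns the rectangulations into a tree: each one with at least two rectangles is the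
k-th child of its parent for exactly one k with 1 ≤ k ≤ ν, where k = 1 means bottom-based and k = ν
means right-based. Given this, the listing of a zigzag set C is described recursively. In the
listing P_1, P_2, ... of the set of parents, each P_i is replaced by its children in C, sorted by k,
in alternating directions (`weave`). The zigzag condition puts both extreme children of every P_i
into C, so consecutive blocks meet at children of the same extreme type, and the jump from P_i to
P_{i+1} lifts to these children.

The algorithm is forced to follow this listing. Inside a block, the last rectangle has the greatest
index and can jump to an unvisited sibling; the visited siblings are those behind the current one,
so one direction and one target remain (`isStep_iff_of_siblings`). At the end of a block no sibling
is left, and the possible steps are exactly the lifts of the steps one level below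
(`isStep_iff_parent`). `Run.weave` combines both cases, and `Run.isOutput_iff` turns such a forced
run into uniqueness of the output. The side-by-side rectangulation is right-based and so are all its
ancestors with at least two rectangles, hence it begins its block; the stacked one is its mirror
image.

For cyclicity, reflection is an involution without fixed points on rectangulations with at least two
rectangles, because it exchanges the two kinds of insertion. So a symmetric set of such parents has
an even number of elements, the last block runs opposite to the first, and the first and the last
rectangulation are of the same extreme type; the cyclic jump between their parents therefore lifts.
For two rectangles there is a single block with two elements.

Most of the work is to establish the tree modulo equivalence. An insertion point is encoded by a
flag and the pair of rectangles whose contact contains it, and the encodings and their order can be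
read off from the two relations (`SameRel.isCodeList`). The relations after an insertion are
determined by those before and the encoding (`Insert.sameRel`), and conversely determine both
(`Insert.parent_sameRel`); so parent and position do not depend on the drawing. Parents exist by
`exists_isDeletion`. Children exist by `IsCode.exists_insert`, where the drawing may have to be
deformed first, since rectangles right of the insertion point can be too low to be cut. Horizontal
insertions are reduced to vertical ones by reflection. -/

theorem Rect.ext_coords {r s : Rect} (h1 : r.left = s.left) (h2 : r.right = s.right)
    (h3 : r.bottom = s.bottom) (h4 : r.top = s.top) : r = s := by
  cases r; cases s; simp_all

/-- The image of a rectangle under `(x, y) ↦ (-y, -x)`. -/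
def Rect.reflect (r : Rect) : Rect :=
  ⟨-r.top, -r.bottom, -r.right, -r.left, neg_lt_neg r.bottom_lt_top, neg_lt_neg r.left_lt_right⟩

theorem Rect.reflect_reflect (r : Rect) : r.reflect.reflect = r := by
  apply Rect.ext_coords <;> simp [Rect.reflect]

theorem Rect.mem_region {r : Rect} {p : ℝ × ℝ} :
    p ∈ r.region ↔ (r.left ≤ p.1 ∧ p.1 ≤ r.right) ∧ r.bottom ≤ p.2 ∧ p.2 ≤ r.top := Iff.rfl

/-- Two rectangles have a common interior point. -/
def Rect.Overlap (r s : Rect) : Prop :=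
  (r.left < s.right ∧ s.left < r.right) ∧ r.bottom < s.top ∧ s.bottom < r.top

/-- Turns interior-disjointness into strict inequalities, so that later geometric arguments become
linear arithmetic on coordinates. -/
theorem Rect.not_disjoint_inner_iff {r s : Rect} :
    ¬ Disjoint r.inner s.inner ↔ r.Overlap s := by
  rw [Set.not_disjoint_iff]
  constructor
  · rintro ⟨p, ⟨⟨h1, h2⟩, h3, h4⟩, ⟨h5, h6⟩, h7, h8⟩
    exact ⟨⟨h1.trans h6, h5.trans h2⟩, h3.trans h8, h7.trans h4⟩
  · rintro ⟨⟨h1, h2⟩, h3, h4⟩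
    obtain ⟨x, hx1, hx2⟩ := exists_between (max_lt (lt_min r.left_lt_right h1)
      (lt_min h2 s.left_lt_right))
    obtain ⟨y, hy1, hy2⟩ := exists_between (max_lt (lt_min r.bottom_lt_top h3)
      (lt_min h4 s.bottom_lt_top))
    simp only [max_lt_iff, lt_min_iff] at hx1 hx2 hy1 hy2
    exact ⟨(x, y), ⟨⟨hx1.1, hx2.1⟩, hy1.1, hy2.1⟩, ⟨hx1.2, hx2.2⟩, hy1.2, hy2.2⟩

/-- Applied to the finite set of coordinates of a drawing: a move by this distance away from `x`
meets no further coordinate line. -/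
theorem exists_pos_gap (s : Set ℝ) (hs : s.Finite) (x : ℝ) :
    ∃ ε > 0, ∀ c ∈ s, (x < c → x + ε < c) ∧ (c < x → c < x - ε) := by
  induction s, hs using Set.Finite.induction_on with
  | empty => exact ⟨1, one_pos, by simp⟩
  | @insert a s _ _ ih =>
    obtain ⟨ε, hε, h⟩ := ih
    rcases eq_or_ne a x with rfl | hne
    · refine ⟨ε, hε, ?_⟩
      rintro c (rfl | hc)
      · simp
      · exact h c hc
    · have hpos : 0 < |a - x| := abs_pos.2 (sub_ne_zero.2 hne)
      refine ⟨min ε (|a - x| / 2), lt_min hε (by linarith), ?_⟩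
      have h1 := min_le_left ε (|a - x| / 2)
      have h2 := min_le_right ε (|a - x| / 2)
      rintro c (rfl | hc)
      · refine ⟨fun hlt => ?_, fun hlt => ?_⟩
        · rw [abs_of_pos (by linarith)] at *; linarith
        · rw [abs_of_neg (by linarith)] at *; linarith
      · exact ⟨fun hlt => by linarith [(h c hc).1 hlt], fun hlt => by linarith [(h c hc).2 hlt]⟩

namespace Rectangulation

variable {n : ℕ}

/-! ### Basic properties of drawings -/

theorem ext_rects {R S : Rectangulation n} (h : R.outer = S.outer) (h' : ∀ i, R.rect i = S.rect i) :
    R = S := by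
  cases R; cases S
  obtain rfl : _ = _ := h
  obtain rfl : _ = _ := funext h'
  rfl

theorem eq_of_overlap (R : Rectangulation n) {i j : Fin n} (h : (R.rect i).Overlap (R.rect j)) :
    i = j := by
  by_contra hij
  exact Rect.not_disjoint_inner_iff.2 h (R.disjoint i j hij)

/-- The standard way of identifying or separating rectangles below: a common interior point forces
equality of labels. -/
theorem eq_of_lt (R : Rectangulation n) {i j : Fin n} (h1 : (R.rect i).left < (R.rect j).right)
    (h2 : (R.rect j).left < (R.rect i).right) (h3 : (R.rect i).bottom < (R.rect j).top)
    (h4 : (R.rect j).bottom < (R.rect i).top) : i = j :=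
  R.eq_of_overlap ⟨⟨h1, h2⟩, h3, h4⟩

theorem region_subset (R : Rectangulation n) (i : Fin n) :
    (R.rect i).region ⊆ R.outer.region := by
  rw [← R.cover]
  exact Set.subset_iUnion (fun i => (R.rect i).region) i

theorem bounds (R : Rectangulation n) (i : Fin n) :
    (R.outer.left ≤ (R.rect i).left ∧ (R.rect i).right ≤ R.outer.right) ∧
      R.outer.bottom ≤ (R.rect i).bottom ∧ (R.rect i).top ≤ R.outer.top := by
  have h1 := R.region_subset i
    (show ((R.rect i).left, (R.rect i).bottom) ∈ _ from
      ⟨⟨le_rfl, (R.rect i).left_lt_right.le⟩, le_rfl, (R.rect i).bottom_lt_top.le⟩)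
  have h2 := R.region_subset i
    (show ((R.rect i).right, (R.rect i).top) ∈ _ from
      ⟨⟨(R.rect i).left_lt_right.le, le_rfl⟩, (R.rect i).bottom_lt_top.le, le_rfl⟩)
  exact ⟨⟨h1.1.1, h2.1.2⟩, h1.2.1, h2.2.2⟩

theorem outer_left_le (R : Rectangulation n) (i : Fin n) : R.outer.left ≤ (R.rect i).left :=
  (R.bounds i).1.1

theorem right_le_outer (R : Rectangulation n) (i : Fin n) : (R.rect i).right ≤ R.outer.right :=
  (R.bounds i).1.2

theorem outer_bottom_le (R : Rectangulation n) (i : Fin n) : R.outer.bottom ≤ (R.rect i).bottom :=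
  (R.bounds i).2.1

theorem top_le_outer (R : Rectangulation n) (i : Fin n) : (R.rect i).top ≤ R.outer.top :=
  (R.bounds i).2.2

theorem left_lt_right (R : Rectangulation n) (i : Fin n) : (R.rect i).left < (R.rect i).right :=
  (R.rect i).left_lt_right

theorem bottom_lt_top (R : Rectangulation n) (i : Fin n) : (R.rect i).bottom < (R.rect i).top :=
  (R.rect i).bottom_lt_top

theorem exists_mem_region (R : Rectangulation n) {x y : ℝ} (h1 : R.outer.left ≤ x)
    (h2 : x ≤ R.outer.right) (h3 : R.outer.bottom ≤ y) (h4 : y ≤ R.outer.top) :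
    ∃ i, ((R.rect i).left ≤ x ∧ x ≤ (R.rect i).right) ∧
      (R.rect i).bottom ≤ y ∧ y ≤ (R.rect i).top := by
  have : (x, y) ∈ R.outer.region := ⟨⟨h1, h2⟩, h3, h4⟩
  rw [← R.cover, Set.mem_iUnion] at this
  exact this

/-- All coordinates of a drawing. -/
def coords (R : Rectangulation n) : Set ℝ :=
  insert R.outer.left (insert R.outer.right (insert R.outer.bottom (insert R.outer.top
    (Set.range (fun i => (R.rect i).left) ∪ Set.range (fun i => (R.rect i).right) ∪
      Set.range (fun i => (R.rect i).bottom) ∪ Set.range (fun i => (R.rect i).top)))))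

theorem finite_coords (R : Rectangulation n) : R.coords.Finite := by
  unfold coords
  exact ((((((Set.finite_range _).union (Set.finite_range _)).union (Set.finite_range _)).union
    (Set.finite_range _)).insert _).insert _).insert _ |>.insert _

theorem left_mem_coords (R : Rectangulation n) (i) : (R.rect i).left ∈ R.coords := by
  simp [coords]
theorem right_mem_coords (R : Rectangulation n) (i) : (R.rect i).right ∈ R.coords := by
  simp [coords]
theorem bottom_mem_coords (R : Rectangulation n) (i) : (R.rect i).bottom ∈ R.coords := by
  simp [coords]
theorem top_mem_coords (R : Rectangulation n) (i) : (R.rect i).top ∈ R.coords := by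
  simp [coords]

/-! ### Rectangles in the four quadrants at a point -/

/-- Some rectangle contains all points immediately above and to the right of `(x, y)`. -/
theorem exists_northeast (R : Rectangulation n) {x y : ℝ} (h1 : R.outer.left ≤ x)
    (h2 : x < R.outer.right) (h3 : R.outer.bottom ≤ y) (h4 : y < R.outer.top) :
    ∃ i, ((R.rect i).left ≤ x ∧ x < (R.rect i).right) ∧
      (R.rect i).bottom ≤ y ∧ y < (R.rect i).top := by
  obtain ⟨ε, hε, hx⟩ := exists_pos_gap _ R.finite_coords x
  obtain ⟨δ, hδ, hy⟩ := exists_pos_gap _ R.finite_coords y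
  have a1 := (hx R.outer.right (by simp [coords])).1 h2
  have a2 := (hy R.outer.top (by simp [coords])).1 h4
  -- The shifted point has passed no coordinate line, so a rectangle that contains it also reaches
  -- back to `(x, y)`.
  obtain ⟨i, ⟨b1, b2⟩, b3, b4⟩ := R.exists_mem_region (x := x + ε) (y := y + δ)
    (by linarith) a1.le (by linarith) a2.le
  refine ⟨i, ⟨?_, by linarith⟩, ?_, by linarith⟩
  · by_contra! h; linarith [(hx _ (R.left_mem_coords i)).1 h]
  · by_contra! h; linarith [(hy _ (R.bottom_mem_coords i)).1 h]

/-- Some rectangle contains all points immediately above and to the left of `(x, y)`. -/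
theorem exists_northwest (R : Rectangulation n) {x y : ℝ} (h1 : R.outer.left < x)
    (h2 : x ≤ R.outer.right) (h3 : R.outer.bottom ≤ y) (h4 : y < R.outer.top) :
    ∃ i, ((R.rect i).left < x ∧ x ≤ (R.rect i).right) ∧
      (R.rect i).bottom ≤ y ∧ y < (R.rect i).top := by
  obtain ⟨ε, hε, hx⟩ := exists_pos_gap _ R.finite_coords x
  obtain ⟨δ, hδ, hy⟩ := exists_pos_gap _ R.finite_coords y
  have a1 := (hx R.outer.left (by simp [coords])).2 h1
  have a2 := (hy R.outer.top (by simp [coords])).1 h4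
  obtain ⟨i, ⟨b1, b2⟩, b3, b4⟩ := R.exists_mem_region (x := x - ε) (y := y + δ)
    a1.le (by linarith) (by linarith) a2.le
  refine ⟨i, ⟨by linarith, ?_⟩, ?_, by linarith⟩
  · by_contra! h; linarith [(hx _ (R.right_mem_coords i)).2 h]
  · by_contra! h; linarith [(hy _ (R.bottom_mem_coords i)).1 h]

/-- Some rectangle contains all points immediately below and to the left of `(x, y)`. -/
theorem exists_southwest (R : Rectangulation n) {x y : ℝ} (h1 : R.outer.left < x)
    (h2 : x ≤ R.outer.right) (h3 : R.outer.bottom < y) (h4 : y ≤ R.outer.top) :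
    ∃ i, ((R.rect i).left < x ∧ x ≤ (R.rect i).right) ∧
      (R.rect i).bottom < y ∧ y ≤ (R.rect i).top := by
  obtain ⟨ε, hε, hx⟩ := exists_pos_gap _ R.finite_coords x
  obtain ⟨δ, hδ, hy⟩ := exists_pos_gap _ R.finite_coords y
  have a1 := (hx R.outer.left (by simp [coords])).2 h1
  have a2 := (hy R.outer.bottom (by simp [coords])).2 h3
  obtain ⟨i, ⟨b1, b2⟩, b3, b4⟩ := R.exists_mem_region (x := x - ε) (y := y - δ)
    a1.le (by linarith) a2.le (by linarith)
  refine ⟨i, ⟨by linarith, ?_⟩, by linarith, ?_⟩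
  · by_contra! h; linarith [(hx _ (R.right_mem_coords i)).2 h]
  · by_contra! h; linarith [(hy _ (R.top_mem_coords i)).2 h]

/-- Some rectangle contains all points immediately below and to the right of `(x, y)`. -/
theorem exists_southeast (R : Rectangulation n) {x y : ℝ} (h1 : R.outer.left ≤ x)
    (h2 : x < R.outer.right) (h3 : R.outer.bottom < y) (h4 : y ≤ R.outer.top) :
    ∃ i, ((R.rect i).left ≤ x ∧ x < (R.rect i).right) ∧
      (R.rect i).bottom < y ∧ y ≤ (R.rect i).top := by
  obtain ⟨ε, hε, hx⟩ := exists_pos_gap _ R.finite_coords x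
  obtain ⟨δ, hδ, hy⟩ := exists_pos_gap _ R.finite_coords y
  have a1 := (hx R.outer.right (by simp [coords])).1 h2
  have a2 := (hy R.outer.bottom (by simp [coords])).2 h3
  obtain ⟨i, ⟨b1, b2⟩, b3, b4⟩ := R.exists_mem_region (x := x + ε) (y := y - δ)
    (by linarith) a1.le a2.le (by linarith)
  refine ⟨i, ⟨?_, by linarith⟩, by linarith, ?_⟩
  · by_contra! h; linarith [(hx _ (R.left_mem_coords i)).1 h]
  · by_contra! h; linarith [(hy _ (R.top_mem_coords i)).2 h]

/-! ### Genericity as the absence of crosses -/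

/-- Four rectangles meet with their corners at the point `p`. -/
def IsCross (r : Fin n → Rect) (p : ℝ × ℝ) : Prop :=
  (∃ i, (r i).right = p.1 ∧ (r i).top = p.2) ∧ (∃ i, (r i).left = p.1 ∧ (r i).top = p.2) ∧
    (∃ i, (r i).right = p.1 ∧ (r i).bottom = p.2) ∧ (∃ i, (r i).left = p.1 ∧ (r i).bottom = p.2)

theorem not_isCross (R : Rectangulation n) (p : ℝ × ℝ) : ¬ IsCross R.rect p := by
  rintro ⟨⟨a, a1, a2⟩, ⟨b, b1, b2⟩, ⟨c, c1, c2⟩, ⟨d, d1, d2⟩⟩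
  have la := R.left_lt_right a
  have lb := R.left_lt_right b
  have lc := R.left_lt_right c
  have ld := R.left_lt_right d
  have ba := R.bottom_lt_top a
  have bb := R.bottom_lt_top b
  have bc := R.bottom_lt_top c
  have bd := R.bottom_lt_top d
  have hab : a ≠ b := by rintro rfl; linarith
  have hac : a ≠ c := by rintro rfl; linarith
  have had : a ≠ d := by rintro rfl; linarith
  have hbc : b ≠ c := by rintro rfl; linarith
  have hbd : b ≠ d := by rintro rfl; linarith
  have hcd : c ≠ d := by rintro rfl; linarith
  have hsub : ((({a, b, c, d} : Finset (Fin n)) : Set (Fin n))) ⊆ {i | p ∈ (R.rect i).region} := by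
    intro i hi
    simp only [Finset.coe_insert, Finset.coe_singleton, Set.mem_insert_iff,
      Set.mem_singleton_iff] at hi
    rcases hi with rfl | rfl | rfl | rfl <;>
      exact ⟨⟨by linarith, by linarith⟩, by linarith, by linarith⟩
  have h := Set.ncard_le_ncard hsub (Set.toFinite _)
  rw [Set.ncard_coe_finset, Finset.card_insert_of_notMem (by simp [*]),
    Finset.card_insert_of_notMem (by simp [*]), Finset.card_pair hcd] at h
  have := R.generic p
  omega

/-- Each rectangle containing `p` gets two bits: whether it extends to the right of `p`, and whether
it extends above `p`. Disjoint interiors make the bits distinct, so four rectangles realise all four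
patterns. Comparing neighbouring patterns then shows that each of the four has a corner at `p`. -/
theorem generic_of_not_isCross {r : Fin n → Rect}
    (disj : ∀ i j, i ≠ j → ¬ (r i).Overlap (r j)) {p : ℝ × ℝ} (hp : ¬ IsCross r p) :
    {i | p ∈ (r i).region}.ncard ≤ 3 := by
  classical
  by_contra! hlt
  apply hp
  let f : Fin n → Bool × Bool := fun i => (decide (p.1 < (r i).right), decide (p.2 < (r i).top))
  have key : ∀ i ∈ {i | p ∈ (r i).region}, ∀ j ∈ {i | p ∈ (r i).region},
      (p.1 < (r i).right ∧ p.1 < (r j).right ∨ (r i).left < p.1 ∧ (r j).left < p.1) →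
      (p.2 < (r i).top ∧ p.2 < (r j).top ∨ (r i).bottom < p.2 ∧ (r j).bottom < p.2) → i = j := by
    rintro i ⟨⟨hi1, hi2⟩, hi3, hi4⟩ j ⟨⟨hj1, hj2⟩, hj3, hj4⟩ h h'
    by_contra hij
    refine disj i j hij ⟨⟨?_, ?_⟩, ?_, ?_⟩
    · rcases h with h | h <;> linarith
    · rcases h with h | h <;> linarith
    · rcases h' with h' | h' <;> linarith
    · rcases h' with h' | h' <;> linarith
  have hl := fun i => (r i).left_lt_right
  have hb := fun i => (r i).bottom_lt_top
  have hinj : Set.InjOn f {i | p ∈ (r i).region} := by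
    intro i hi j hj hij
    simp only [f, Prod.mk.injEq, decide_eq_decide] at hij
    apply key i hi j hj
    · by_cases h : p.1 < (r i).right
      · exact Or.inl ⟨h, hij.1.1 h⟩
      · have h' : ¬ p.1 < (r j).right := fun h' => h (hij.1.2 h')
        exact Or.inr ⟨by linarith [hl i], by linarith [hl j]⟩
    · by_cases h : p.2 < (r i).top
      · exact Or.inl ⟨h, hij.2.1 h⟩
      · have h' : ¬ p.2 < (r j).top := fun h' => h (hij.2.2 h')
        exact Or.inr ⟨by linarith [hb i], by linarith [hb j]⟩
  have himg : f '' {i | p ∈ (r i).region} = Set.univ := by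
    apply Set.eq_of_subset_of_ncard_le (Set.subset_univ _) _ (Set.toFinite _)
    rw [hinj.ncard_image, Set.ncard_univ, Nat.card_eq_fintype_card]
    exact hlt
  have hsurj : ∀ b, ∃ i ∈ {i | p ∈ (r i).region}, f i = b := fun b => by
    have : b ∈ f '' {i | p ∈ (r i).region} := by rw [himg]; trivial
    exact this
  obtain ⟨a, ha, fa⟩ := hsurj (false, false)
  obtain ⟨b, hb', fb⟩ := hsurj (true, false)
  obtain ⟨c, hc, fc⟩ := hsurj (false, true)
  obtain ⟨d, hd, fd⟩ := hsurj (true, true)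
  simp only [f, Prod.mk.injEq, decide_eq_true_eq, decide_eq_false_iff_not, not_lt] at fa fb fc fd
  have ha' := ha; have hb'' := hb'; have hc' := hc; have hd' := hd
  obtain ⟨⟨a1, a2⟩, a3, a4⟩ := ha'
  obtain ⟨⟨b1, b2⟩, b3, b4⟩ := hb''
  obtain ⟨⟨c1, c2⟩, c3, c4⟩ := hc'
  obtain ⟨⟨d1, d2⟩, d3, d4⟩ := hd'
  have ea1 : (r a).right = p.1 := le_antisymm fa.1 a2
  have ea2 : (r a).top = p.2 := le_antisymm fa.2 a4
  have eb2 : (r b).top = p.2 := le_antisymm fb.2 b4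
  have ec1 : (r c).right = p.1 := le_antisymm fc.1 c2
  have eb1 : (r b).left = p.1 := by
    by_contra h
    have hlt := lt_of_le_of_ne b1 h
    have : a = b := key a ha b hb' (Or.inr ⟨by linarith [hl a], hlt⟩)
      (Or.inr ⟨by linarith [hb a], by linarith [hb b]⟩)
    subst this; linarith
  have ec2 : (r c).bottom = p.2 := by
    by_contra h
    have hlt := lt_of_le_of_ne c3 h
    have : a = c := key a ha c hc (Or.inr ⟨by linarith [hl a], by linarith [hl c]⟩)
      (Or.inr ⟨by linarith [hb a], hlt⟩)
    subst this; linarith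
  have ed1 : (r d).left = p.1 := by
    by_contra h
    have hlt := lt_of_le_of_ne d1 h
    have : c = d := key c hc d hd (Or.inr ⟨by linarith [hl c], hlt⟩)
      (Or.inl ⟨fc.2, fd.2⟩)
    subst this; linarith
  have ed2 : (r d).bottom = p.2 := by
    by_contra h
    have hlt := lt_of_le_of_ne d3 h
    have : b = d := key b hb' d hd (Or.inl ⟨fb.1, fd.1⟩)
      (Or.inr ⟨by linarith [hb b], hlt⟩)
    subst this; linarith
  exact ⟨⟨a, ea1, ea2⟩, ⟨b, eb1, eb2⟩, ⟨c, ec1, ec2⟩, ⟨d, ed1, ed2⟩⟩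

/-- A drawing from pointwise conditions. -/
def ofRects (outer : Rect) (r : Fin n → Rect)
    (sub : ∀ i, (outer.left ≤ (r i).left ∧ (r i).right ≤ outer.right) ∧
      outer.bottom ≤ (r i).bottom ∧ (r i).top ≤ outer.top)
    (cov : ∀ p ∈ outer.region, ∃ i, p ∈ (r i).region)
    (disj : ∀ i j, i ≠ j → ¬ (r i).Overlap (r j)) (cross : ∀ p, ¬ IsCross r p) :
    Rectangulation n where
  outer := outer
  rect := r
  cover := by
    apply Set.Subset.antisymm
    · refine Set.iUnion_subset fun i p hp => ?_
      exact ⟨⟨(sub i).1.1.trans hp.1.1, hp.1.2.trans (sub i).1.2⟩,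
        (sub i).2.1.trans hp.2.1, hp.2.2.trans (sub i).2.2⟩
    · intro p hp
      exact Set.mem_iUnion.2 (cov p hp)
  disjoint i j hij := by
    by_contra h
    exact disj i j hij (Rect.not_disjoint_inner_iff.1 h)
  generic p := generic_of_not_isCross disj (cross p)

/-- The mirror image of a drawing under `(x, y) ↦ (-y, -x)`. -/
def reflect (R : Rectangulation n) : Rectangulation n :=
  ofRects R.outer.reflect (fun i => (R.rect i).reflect)
    (fun i => by
      obtain ⟨⟨h1, h2⟩, h3, h4⟩ := R.bounds i
      simp only [Rect.reflect]
      exact ⟨⟨by linarith, by linarith⟩, by linarith, by linarith⟩)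
    (fun p hp => by
      obtain ⟨⟨h1, h2⟩, h3, h4⟩ := hp
      simp only [Rect.reflect] at h1 h2 h3 h4
      obtain ⟨i, ⟨a1, a2⟩, a3, a4⟩ := R.exists_mem_region (x := -p.2) (y := -p.1)
        (by linarith) (by linarith) (by linarith) (by linarith)
      refine ⟨i, ⟨?_, ?_⟩, ?_, ?_⟩ <;> simp only [Rect.reflect] <;> linarith)
    (fun i j hij h => by
      obtain ⟨⟨h1, h2⟩, h3, h4⟩ := h
      simp only [Rect.reflect] at h1 h2 h3 h4
      exact hij (R.eq_of_lt (by linarith) (by linarith) (by linarith) (by linarith)))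
    (fun p h => by
      obtain ⟨⟨a, a1, a2⟩, ⟨b, b1, b2⟩, ⟨c, c1, c2⟩, ⟨d, d1, d2⟩⟩ := h
      simp only [Rect.reflect] at *
      -- The reflection exchanges the south-west and north-east quadrants and keeps the other two.
      exact R.not_isCross (-p.2, -p.1) ⟨⟨d, by simp only; linarith, by simp only; linarith⟩,
        ⟨b, by simp only; linarith, by simp only; linarith⟩,
        ⟨c, by simp only; linarith, by simp only; linarith⟩,
        ⟨a, by simp only; linarith, by simp only; linarith⟩⟩)

@[simp] theorem reflect_left (R : Rectangulation n) (i) :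
    (R.reflect.rect i).left = -(R.rect i).top := rfl
@[simp] theorem reflect_right (R : Rectangulation n) (i) :
    (R.reflect.rect i).right = -(R.rect i).bottom := rfl
@[simp] theorem reflect_bottom (R : Rectangulation n) (i) :
    (R.reflect.rect i).bottom = -(R.rect i).right := rfl
@[simp] theorem reflect_top (R : Rectangulation n) (i) :
    (R.reflect.rect i).top = -(R.rect i).left := rfl
@[simp] theorem reflect_outer_left (R : Rectangulation n) :
    R.reflect.outer.left = -R.outer.top := rfl
@[simp] theorem reflect_outer_right (R : Rectangulation n) :
    R.reflect.outer.right = -R.outer.bottom := rfl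
@[simp] theorem reflect_outer_bottom (R : Rectangulation n) :
    R.reflect.outer.bottom = -R.outer.right := rfl
@[simp] theorem reflect_outer_top (R : Rectangulation n) :
    R.reflect.outer.top = -R.outer.left := rfl

@[simp] theorem reflect_reflect (R : Rectangulation n) : R.reflect.reflect = R :=
  ext_rects (Rect.reflect_reflect _) fun _ => Rect.reflect_reflect _

theorem isReflection_iff {R S : Rectangulation n} : R.IsReflection S ↔ S = R.reflect := by
  constructor
  · rintro ⟨⟨h1, h2, h3, h4⟩, h⟩
    exact ext_rects (Rect.ext_coords h1 h2 h3 h4)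
      fun i => Rect.ext_coords (h i).1 (h i).2.1 (h i).2.2.1 (h i).2.2.2
  · rintro rfl
    exact ⟨⟨rfl, rfl, rfl, rfl⟩, fun i => ⟨rfl, rfl, rfl, rfl⟩⟩

-- This duality yields every statement on horizontal insertion points from its vertical counterpart.
@[simp] theorem reflect_isLeftOf {R : Rectangulation n} {i j : Fin n} :
    R.reflect.IsLeftOf i j ↔ R.IsBelow j i := by
  simp only [IsLeftOf, IsBelow, reflect_left, reflect_right, reflect_bottom, reflect_top,
    neg_inj, neg_lt_neg_iff]
  constructor
  · rintro ⟨h1, h2, h3⟩; exact ⟨h1.symm, h2, h3⟩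
  · rintro ⟨h1, h2, h3⟩; exact ⟨h1.symm, h2, h3⟩

@[simp] theorem reflect_isBelow {R : Rectangulation n} {i j : Fin n} :
    R.reflect.IsBelow i j ↔ R.IsLeftOf j i := by
  rw [← reflect_isLeftOf, reflect_reflect]

@[simp] theorem reflect_touchesBottom {R : Rectangulation n} {i : Fin n} :
    R.reflect.TouchesBottom i ↔ R.TouchesRight i := by
  simp [TouchesBottom, TouchesRight]

@[simp] theorem reflect_touchesRight {R : Rectangulation n} {i : Fin n} :
    R.reflect.TouchesRight i ↔ R.TouchesBottom i := by
  simp [TouchesBottom, TouchesRight]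

theorem reflect_isVertex {R : Rectangulation n} {x y : ℝ} :
    R.reflect.IsVertex (-y, -x) ↔ R.IsVertex (x, y) := by
  simp only [IsVertex, reflect_left, reflect_right, reflect_bottom, reflect_top, neg_inj]
  exact exists_congr fun i => by tauto

@[simp] theorem reflect_isBottomBased {R : Rectangulation n} :
    R.reflect.IsBottomBased ↔ R.IsRightBased := by
  simp only [IsBottomBased, IsRightBased, reflect_touchesBottom, reflect_left, reflect_right,
    reflect_outer_left, reflect_outer_right, neg_inj]
  exact exists_congr fun i => by tauto

/-! ### Relabelling -/

/-- The drawing with permuted labels. -/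
def relabel (R : Rectangulation n) (σ : Equiv.Perm (Fin n)) : Rectangulation n :=
  ofRects R.outer (fun i => R.rect (σ i)) (fun i => R.bounds (σ i))
    (fun p hp => by
      obtain ⟨i, hi⟩ := R.exists_mem_region hp.1.1 hp.1.2 hp.2.1 hp.2.2
      exact ⟨σ.symm i, by simpa [Rect.mem_region] using hi⟩)
    (fun i j hij h => hij (σ.injective (R.eq_of_overlap h)))
    (fun p h => by
      obtain ⟨⟨a, ha⟩, ⟨b, hb⟩, ⟨c, hc⟩, ⟨d, hd⟩⟩ := h
      exact R.not_isCross p ⟨⟨_, ha⟩, ⟨_, hb⟩, ⟨_, hc⟩, ⟨_, hd⟩⟩)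

/-- Two drawings have the same relations between their labels. -/
def SameRel (R S : Rectangulation n) : Prop :=
  R.IsLeftOf = S.IsLeftOf ∧ R.IsBelow = S.IsBelow

theorem SameRel.symm {R S : Rectangulation n} (h : R.SameRel S) : S.SameRel R :=
  ⟨h.1.symm, h.2.symm⟩

theorem SameRel.trans {R S T : Rectangulation n} (h : R.SameRel S) (h' : S.SameRel T) :
    R.SameRel T :=
  ⟨h.1.trans h'.1, h.2.trans h'.2⟩

theorem SameRel.reflect {R S : Rectangulation n} (h : R.SameRel S) :
    R.reflect.SameRel S.reflect := by
  constructor <;> funext i j <;> apply propext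
  · simp [h.2]
  · simp [h.1]

/-- Splits an equivalence into a relabelling and an equality of relations; invariance is checked for
each of them separately. -/
theorem equivalent_iff {R S : Rectangulation n} :
    R.Equivalent S ↔ ∃ σ, R.SameRel (S.relabel σ) := by
  refine exists_congr fun σ => ?_
  constructor
  · intro h
    exact ⟨funext₂ fun i j => propext (h i j).1, funext₂ fun i j => propext (h i j).2⟩
  · intro h i j
    exact ⟨iff_of_eq (congrFun₂ h.1 i j), iff_of_eq (congrFun₂ h.2 i j)⟩

theorem SameRel.equivalent {R S : Rectangulation n} (h : R.SameRel S) : R.Equivalent S :=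
  ⟨1, fun i j => ⟨iff_of_eq (congrFun₂ h.1 i j), iff_of_eq (congrFun₂ h.2 i j)⟩⟩

theorem relabel_equivalent (R : Rectangulation n) (σ : Equiv.Perm (Fin n)) :
    (R.relabel σ).Equivalent R :=
  equivalent_iff.2 ⟨σ, rfl, rfl⟩

theorem Equivalent.reflect {R S : Rectangulation n} (h : R.Equivalent S) :
    R.reflect.Equivalent S.reflect := by
  obtain ⟨σ, h⟩ := h
  refine ⟨σ, fun i j => ?_⟩
  simp only [reflect_isLeftOf, reflect_isBelow]
  exact ⟨(h j i).2, (h j i).1⟩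

/-! ### Boundary contacts in terms of the relations -/

/-- If the bottom side were not on the boundary, the rectangle just below its left end would be
below `i`. Boundary contact is thus visible in the relations and invariant under equivalence. -/
theorem touchesBottom_iff {R : Rectangulation n} {i : Fin n} :
    R.TouchesBottom i ↔ ∀ k, ¬ R.IsBelow k i := by
  constructor
  · rintro h k ⟨h1, h2, h3⟩
    have := R.outer_bottom_le k
    have := R.bottom_lt_top k
    unfold TouchesBottom at h
    linarith
  · intro h
    by_contra hne
    have hlt := lt_of_le_of_ne (R.outer_bottom_le i) (Ne.symm hne)
    have hi := R.left_lt_right i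
    have hi' := R.bottom_lt_top i
    obtain ⟨k, ⟨k1, k2⟩, k3, k4⟩ := R.exists_southeast (R.outer_left_le i)
      (hi.trans_le (R.right_le_outer i)) hlt (hi'.le.trans (R.top_le_outer i))
    refine h k ⟨?_, by linarith, by linarith⟩
    rcases k4.eq_or_lt with e | e
    · exact e.symm
    · have := R.eq_of_lt (i := k) (j := i) (by linarith) (by linarith) (by linarith) (by linarith)
      subst this; linarith

theorem touchesLeft_iff {R : Rectangulation n} {i : Fin n} :
    (R.rect i).left = R.outer.left ↔ ∀ k, ¬ R.IsLeftOf k i := by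
  constructor
  · rintro h k ⟨h1, h2, h3⟩
    have := R.outer_left_le k
    have := R.left_lt_right k
    linarith
  · intro h
    by_contra hne
    have hlt := lt_of_le_of_ne (R.outer_left_le i) (Ne.symm hne)
    have hi := R.left_lt_right i
    have hi' := R.bottom_lt_top i
    obtain ⟨k, ⟨k1, k2⟩, k3, k4⟩ := R.exists_northwest hlt
      (hi.le.trans (R.right_le_outer i)) (R.outer_bottom_le i) (hi'.trans_le (R.top_le_outer i))
    refine h k ⟨?_, by linarith, by linarith⟩
    rcases k2.eq_or_lt with e | e
    · exact e.symm
    · have := R.eq_of_lt (i := k) (j := i) (by linarith) (by linarith) (by linarith) (by linarith)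
      subst this; linarith

theorem touchesRight_iff {R : Rectangulation n} {i : Fin n} :
    R.TouchesRight i ↔ ∀ k, ¬ R.IsLeftOf i k := by
  rw [← reflect_touchesBottom, touchesBottom_iff]
  simp

theorem SameRel.touchesBottom {R S : Rectangulation n} (h : R.SameRel S) {i : Fin n} :
    R.TouchesBottom i ↔ S.TouchesBottom i := by
  rw [touchesBottom_iff, touchesBottom_iff, h.2]

theorem SameRel.touchesRight {R S : Rectangulation n} (h : R.SameRel S) {i : Fin n} :
    R.TouchesRight i ↔ S.TouchesRight i := by
  rw [touchesRight_iff, touchesRight_iff, h.1]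

theorem SameRel.touchesLeft {R S : Rectangulation n} (h : R.SameRel S) {i : Fin n} :
    (R.rect i).left = R.outer.left ↔ (S.rect i).left = S.outer.left := by
  rw [touchesLeft_iff, touchesLeft_iff, h.1]

theorem SameRel.isBottomBased {R S : Rectangulation n} (h : R.SameRel S) :
    R.IsBottomBased ↔ S.IsBottomBased := by
  refine exists_congr fun i => ?_
  exact and_congr h.touchesBottom (and_congr h.touchesLeft h.touchesRight)

theorem relabel_isBottomBased {R : Rectangulation n} {σ : Equiv.Perm (Fin n)} :
    (R.relabel σ).IsBottomBased ↔ R.IsBottomBased :=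
  (σ.surjective.exists (p := fun i => R.TouchesBottom i ∧
    (R.rect i).left = R.outer.left ∧ (R.rect i).right = R.outer.right)).symm

theorem Equivalent.isBottomBased {R S : Rectangulation n} (h : R.Equivalent S) :
    R.IsBottomBased ↔ S.IsBottomBased := by
  obtain ⟨σ, h⟩ := equivalent_iff.1 h
  rw [h.isBottomBased, relabel_isBottomBased]

theorem Equivalent.isRightBased {R S : Rectangulation n} (h : R.Equivalent S) :
    R.IsRightBased ↔ S.IsRightBased := by
  rw [← reflect_isBottomBased, h.reflect.isBottomBased, reflect_isBottomBased]

end Rectangulation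

/-! ### Insertion points in terms of pairs of rectangles -/

/-- The image of an insertion point under `(x, y) ↦ (-y, -x)`. -/
def InsPoint.reflect : InsPoint → InsPoint
  | .vert x y => .horiz (-y) (-x)
  | .horiz x y => .vert (-y) (-x)

@[simp] theorem InsPoint.reflect_reflect (q : InsPoint) : q.reflect.reflect = q := by
  cases q <;> simp [InsPoint.reflect]

/-- The order is reversed, so the first insertion point of a drawing corresponds to the last one of
its mirror image. -/
theorem InsPoint.before_reflect {q q' : InsPoint} :
    q.reflect.Before q'.reflect ↔ q'.Before q := by
  cases q <;> cases q' <;> simp [InsPoint.reflect, InsPoint.Before, eq_comm]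

theorem InsPoint.before_irrefl (q : InsPoint) : ¬ q.Before q := by
  cases q <;> simp [InsPoint.Before]

theorem InsPoint.Before.trans {p q r : InsPoint} (h : p.Before q) (h' : q.Before r) :
    p.Before r := by
  cases p <;> cases q <;> cases r <;> simp only [InsPoint.Before] at * <;> grind

theorem InsPoint.before_total (p q : InsPoint) : p.Before q ∨ p = q ∨ q.Before p := by
  cases p <;> cases q <;> simp only [InsPoint.Before, InsPoint.vert.injEq,
    InsPoint.horiz.injEq, reduceCtorEq] <;> grind

/-- The image of a segment under `(x, y) ↦ (-y, -x)`. -/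
def InsEdge.reflect : InsEdge → InsEdge
  | .vert x a b => .horiz (-x) (-b) (-a)
  | .horiz y a b => .vert (-y) (-b) (-a)

@[simp] theorem InsEdge.reflect_reflect (e : InsEdge) : e.reflect.reflect = e := by
  cases e <;> simp [InsEdge.reflect]

theorem InsPoint.interiorTo_reflect {q : InsPoint} {e : InsEdge} :
    q.reflect.InteriorTo e.reflect ↔ q.InteriorTo e := by
  cases q <;> cases e <;>
    simp only [InsPoint.reflect, InsEdge.reflect, InsPoint.InteriorTo, neg_inj, neg_lt_neg_iff] <;>
    tauto

namespace Rectangulation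

variable {n : ℕ}

theorem isInsertionEdge_reflect_horiz {R : Rectangulation n} {y a b : ℝ} :
    R.reflect.IsInsertionEdge (.vert (-y) (-b) (-a)) ↔ R.IsInsertionEdge (.horiz y a b) := by
  simp only [IsInsertionEdge, reflect_isVertex, reflect_touchesBottom, reflect_left,
    reflect_bottom, reflect_top, neg_inj, neg_le_neg_iff, neg_lt_neg_iff]
  constructor
  · rintro ⟨h1, h2, h3, h4, i, h5, h6, h7, h8⟩
    refine ⟨h2, h1, h3, fun c hc hc' hv => ?_, i, h5, h6, h8, h7⟩
    exact h4 (-c) (by linarith) (by linarith) (reflect_isVertex.2 hv)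
  · rintro ⟨h1, h2, h3, h4, i, h5, h6, h7, h8⟩
    refine ⟨h2, h1, h3, fun c hc hc' hv => ?_, i, h5, h6, h8, h7⟩
    refine h4 (-c) (by linarith) (by linarith) (reflect_isVertex.1 ?_)
    simpa using hv

theorem isInsertionEdge_reflect {R : Rectangulation n} {e : InsEdge} :
    R.reflect.IsInsertionEdge e.reflect ↔ R.IsInsertionEdge e := by
  cases e with
  | horiz y a b => exact isInsertionEdge_reflect_horiz
  | vert x a b =>
    have := isInsertionEdge_reflect_horiz (R := R.reflect) (y := -x) (a := -b) (b := -a)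
    simp only [neg_neg, reflect_reflect] at this
    exact this.symm

/-! ### Contacts that carry vertical insertion points -/

/-- The point `(x, y)` lies in the interior of a contact between the left side of the rectangle
`i`, which touches the bottom boundary, and either the right side of `j` or the outer boundary. -/
def VertAt (R : Rectangulation n) (x y : ℝ) (i j : Fin n) : Prop :=
  R.TouchesBottom i ∧ (R.rect i).left = x ∧ ((R.rect i).bottom < y ∧ y < (R.rect i).top) ∧
    ((R.rect j).bottom < y ∧ y < (R.rect j).top) ∧
    ((R.rect j).right = x ∨ (j = i ∧ x = R.outer.left))

/-- The pairs of rectangles that correspond to vertical insertion points. -/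
def VertCode (R : Rectangulation n) (i j : Fin n) : Prop :=
  R.TouchesBottom i ∧ (R.IsLeftOf j i ∨ (j = i ∧ (R.rect i).left = R.outer.left))

theorem VertAt.vertCode {R : Rectangulation n} {x y : ℝ} {i j : Fin n} (h : R.VertAt x y i j) :
    R.VertCode i j := by
  obtain ⟨h1, rfl, ⟨h3, h4⟩, ⟨h5, h6⟩, h7⟩ := h
  refine ⟨h1, h7.imp (fun h => ⟨h, by linarith, by linarith⟩) id⟩

theorem VertCode.vertAt_iff {R : Rectangulation n} {i j : Fin n} (h : R.VertCode i j) {x y : ℝ} :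
    R.VertAt x y i j ↔ x = (R.rect i).left ∧ max (R.rect i).bottom (R.rect j).bottom < y ∧
      y < min (R.rect i).top (R.rect j).top := by
  obtain ⟨h1, h2⟩ := h
  simp only [max_lt_iff, lt_min_iff]
  constructor
  · rintro ⟨a1, a2, a3, a4, a5⟩
    exact ⟨a2.symm, ⟨a3.1, a4.1⟩, a3.2, a4.2⟩
  · rintro ⟨rfl, ⟨a1, a2⟩, a3, a4⟩
    exact ⟨h1, rfl, ⟨a1, a3⟩, ⟨a2, a4⟩, h2.imp (fun h => h.1) id⟩

theorem VertCode.max_lt_min {R : Rectangulation n} {i j : Fin n} (h : R.VertCode i j) :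
    max (R.rect i).bottom (R.rect j).bottom < min (R.rect i).top (R.rect j).top := by
  have hi := R.bottom_lt_top i
  have hj := R.bottom_lt_top j
  obtain ⟨h1, h2 | ⟨rfl, h2⟩⟩ := h
  · exact max_lt (lt_min hi h2.2.2) (lt_min h2.2.1 hj)
  · simpa using hi

/-- The point lies strictly inside the left side of `i`, and on its other side there is `j` or the
exterior. A rectangle with a corner there would overlap `i` or `j`, or leave the outer rectangle. -/
theorem VertAt.not_isVertex {R : Rectangulation n} {x y : ℝ} {i j : Fin n}
    (h : R.VertAt x y i j) : ¬ R.IsVertex (x, y) := by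
  obtain ⟨h1, rfl, ⟨h3, h4⟩, ⟨h5, h6⟩, h7⟩ := h
  rintro ⟨k, hk, hk'⟩
  simp only at hk hk'
  have e1 := R.left_lt_right k
  have e2 := R.bottom_lt_top k
  have e3 := R.left_lt_right i
  have e4 := R.left_lt_right j
  have c1 : (R.rect k).bottom ≤ y ∧ y ≤ (R.rect k).top := by
    rcases hk' with h | h <;> constructor <;> linarith
  rcases hk with hk | hk
  · obtain rfl := R.eq_of_lt (i := k) (j := i) (by linarith) (by linarith) (by linarith)
      (by linarith)
    rcases hk' with h | h <;> linarith
  · rcases h7 with h7 | ⟨rfl, h7⟩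
    · obtain rfl := R.eq_of_lt (i := k) (j := j) (by linarith) (by linarith) (by linarith)
        (by linarith)
      rcases hk' with h | h <;> linarith
    · have := R.outer_left_le k
      linarith

theorem VertAt.unique {R : Rectangulation n} {x y : ℝ} {i j i' j' : Fin n}
    (h : R.VertAt x y i j) (h' : R.VertAt x y i' j') : i = i' ∧ j = j' := by
  obtain ⟨h1, rfl, ⟨h3, h4⟩, ⟨h5, h6⟩, h7⟩ := h
  obtain ⟨g1, g2, ⟨g3, g4⟩, ⟨g5, g6⟩, g7⟩ := h'
  have e1 := R.left_lt_right i
  have e2 := R.left_lt_right i'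
  have e3 := R.left_lt_right j
  have e4 := R.left_lt_right j'
  obtain rfl : i = i' := R.eq_of_lt (by linarith) (by linarith) (by linarith) (by linarith)
  refine ⟨rfl, ?_⟩
  have o1 := R.outer_left_le j
  have o2 := R.outer_left_le j'
  rcases h7 with h7 | ⟨rfl, h7⟩ <;> rcases g7 with g7 | ⟨rfl, g7⟩
  · exact R.eq_of_lt (by linarith) (by linarith) (by linarith) (by linarith)
  · linarith
  · linarith
  · rfl

theorem VertCode.isInsertionEdge {R : Rectangulation n} {i j : Fin n} (h : R.VertCode i j) :
    R.IsInsertionEdge (.vert (R.rect i).left (max (R.rect i).bottom (R.rect j).bottom)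
      (min (R.rect i).top (R.rect j).top)) := by
  refine ⟨?_, ?_, h.max_lt_min, fun c hc hc' => (h.vertAt_iff.2 ⟨rfl, hc, hc'⟩).not_isVertex,
    i, h.1, rfl, le_max_left _ _, min_le_left _ _⟩
  · rcases max_choice (R.rect i).bottom (R.rect j).bottom with e | e <;> rw [e]
    · exact ⟨i, Or.inl rfl, Or.inl rfl⟩
    · rcases h.2 with h' | ⟨rfl, h'⟩
      · exact ⟨j, Or.inr h'.1.symm, Or.inl rfl⟩
      · exact ⟨j, Or.inl rfl, Or.inl rfl⟩
  · rcases min_choice (R.rect i).top (R.rect j).top with e | e <;> rw [e]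
    · exact ⟨i, Or.inl rfl, Or.inr rfl⟩
    · rcases h.2 with h' | ⟨rfl, h'⟩
      · exact ⟨j, Or.inr h'.1.symm, Or.inr rfl⟩
      · exact ⟨j, Or.inl rfl, Or.inr rfl⟩

theorem exists_vertAt {R : Rectangulation n} {i : Fin n} (hi : R.TouchesBottom i) {y : ℝ}
    (h1 : (R.rect i).bottom < y) (h2 : y < (R.rect i).top)
    (hv : ¬ R.IsVertex ((R.rect i).left, y)) : ∃ j, R.VertAt (R.rect i).left y i j := by
  have e1 := R.left_lt_right i
  rcases (R.outer_left_le i).eq_or_lt with h | h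
  · exact ⟨i, hi, rfl, ⟨h1, h2⟩, ⟨h1, h2⟩, Or.inr ⟨rfl, h.symm⟩⟩
  · obtain ⟨j, ⟨j1, j2⟩, j3, j4⟩ := R.exists_northwest h (e1.le.trans (R.right_le_outer i))
      ((R.outer_bottom_le i).trans h1.le) (h2.trans_le (R.top_le_outer i))
    have hr : (R.rect j).right = (R.rect i).left := by
      rcases j2.eq_or_lt with h' | h'
      · exact h'.symm
      · obtain rfl := R.eq_of_lt (i := j) (j := i) (by linarith) (by linarith) (by linarith)
          (by linarith)
        linarith
    refine ⟨j, hi, rfl, ⟨h1, h2⟩, ⟨lt_of_le_of_ne j3 fun h' => hv ⟨j, Or.inr hr.symm,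
      Or.inl h'.symm⟩, j4⟩, Or.inl hr⟩

/-- An interior point of the edge lies on some contact segment. Both segments contain this point,
end at vertices and have no vertex inside, so they are equal. -/
theorem IsInsertionEdge.exists_vertCode {R : Rectangulation n} {x a b : ℝ}
    (h : R.IsInsertionEdge (.vert x a b)) : ∃ i j, R.VertCode i j ∧ x = (R.rect i).left ∧
      a = max (R.rect i).bottom (R.rect j).bottom ∧ b = min (R.rect i).top (R.rect j).top := by
  obtain ⟨h1, h2, h3, h4, i, hi, rfl, h5, h6⟩ := h
  obtain ⟨c, hc1, hc2⟩ := exists_between h3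
  obtain ⟨j, hj⟩ := exists_vertAt hi (h5.trans_lt hc1) (hc2.trans_le h6) (h4 c hc1 hc2)
  have hij := hj.vertCode
  have hc := hij.vertAt_iff.1 hj
  obtain ⟨g1, g2, -, -, -⟩ := hij.isInsertionEdge
  refine ⟨i, j, hij, rfl, ?_, ?_⟩
  · apply le_antisymm
    · by_contra! hlt
      exact (hij.vertAt_iff.2 ⟨rfl, hlt, hc1.trans hc.2.2⟩).not_isVertex h1
    · by_contra! hlt
      exact h4 _ hlt (hc.2.1.trans hc2) g1
  · apply le_antisymm
    · by_contra! hlt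
      exact h4 _ (hc1.trans hc.2.2) hlt g2
    · by_contra! hlt
      exact (hij.vertAt_iff.2 ⟨rfl, hc.2.1.trans hc2, hlt⟩).not_isVertex h2

/-! ### Encoding insertion points by labels -/

/-- The insertion point `q` lies on the contact encoded by a flag (vertical or horizontal) and a
pair of rectangles. -/
def HasCode (R : Rectangulation n) : InsPoint → Bool × Fin n × Fin n → Prop
  | .vert x y, (true, i, j) => R.VertAt x y i j
  | .horiz x y, (false, i, j) => R.reflect.VertAt (-y) (-x) i j
  | .vert _ _, (false, _, _) => False
  | .horiz _ _, (true, _, _) => False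

/-- The encodings of insertion edges. -/
def IsCode (R : Rectangulation n) : Bool × Fin n × Fin n → Prop
  | (true, i, j) => R.VertCode i j
  | (false, i, j) => R.reflect.VertCode i j

/-- Reflection of encodings. -/
def flipCode (c : Bool × Fin n × Fin n) : Bool × Fin n × Fin n := (!c.1, c.2)

@[simp] theorem flipCode_flipCode (c : Bool × Fin n × Fin n) : flipCode (flipCode c) = c := by
  simp [flipCode]

theorem hasCode_reflect {R : Rectangulation n} {q : InsPoint} {c : Bool × Fin n × Fin n} :
    R.reflect.HasCode q.reflect (flipCode c) ↔ R.HasCode q c := by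
  obtain ⟨b, i, j⟩ := c
  cases q <;> cases b <;> simp [InsPoint.reflect, HasCode, flipCode]

theorem isCode_reflect {R : Rectangulation n} {c : Bool × Fin n × Fin n} :
    R.reflect.IsCode (flipCode c) ↔ R.IsCode c := by
  obtain ⟨b, i, j⟩ := c
  cases b <;> simp [IsCode, flipCode]

theorem HasCode.isCode {R : Rectangulation n} {q : InsPoint} {c : Bool × Fin n × Fin n}
    (h : R.HasCode q c) : R.IsCode c := by
  obtain ⟨b, i, j⟩ := c
  cases q <;> cases b <;> first | exact VertAt.vertCode h | exact h.elim

theorem HasCode.unique {R : Rectangulation n} {q : InsPoint} {c c' : Bool × Fin n × Fin n}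
    (h : R.HasCode q c) (h' : R.HasCode q c') : c = c' := by
  obtain ⟨b, i, j⟩ := c
  obtain ⟨b', i', j'⟩ := c'
  cases q <;> cases b <;> cases b' <;>
    first
    | exact h.elim
    | exact h'.elim
    | (obtain ⟨rfl, rfl⟩ := VertAt.unique h h'; rfl)

theorem IsInsertionEdge.exists_code {R : Rectangulation n} {e : InsEdge}
    (h : R.IsInsertionEdge e) : ∃ c, R.IsCode c ∧ ∀ q, q.InteriorTo e ↔ R.HasCode q c := by
  have vert : ∀ {R : Rectangulation n} {x a b : ℝ}, R.IsInsertionEdge (.vert x a b) →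
      ∃ c, R.IsCode c ∧ ∀ q, q.InteriorTo (.vert x a b) ↔ R.HasCode q c := by
    intro R x a b h
    obtain ⟨i, j, hij, rfl, rfl, rfl⟩ := h.exists_vertCode
    refine ⟨(true, i, j), hij, fun q => ?_⟩
    cases q with
    | vert x y => exact hij.vertAt_iff.symm
    | horiz x y => exact Iff.rfl
  cases e with
  | vert x a b => exact vert h
  | horiz y a b =>
    obtain ⟨c, hc, hq⟩ := vert (isInsertionEdge_reflect_horiz.2 h)
    refine ⟨flipCode c, ?_, fun q => ?_⟩
    · rw [← isCode_reflect, flipCode_flipCode]; exact hc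
    · rw [← hasCode_reflect, flipCode_flipCode, ← hq, ← InsPoint.interiorTo_reflect]
      rfl

theorem IsCode.exists_edge {R : Rectangulation n} {c : Bool × Fin n × Fin n}
    (h : R.IsCode c) : ∃ e, R.IsInsertionEdge e ∧ ∀ q, q.InteriorTo e ↔ R.HasCode q c := by
  have vert : ∀ {R : Rectangulation n} {i j}, R.IsCode (true, i, j) →
      ∃ e, R.IsInsertionEdge e ∧ ∀ q, q.InteriorTo e ↔ R.HasCode q (true, i, j) := by
    intro R i j h
    refine ⟨_, VertCode.isInsertionEdge h, fun q => ?_⟩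
    cases q with
    | vert x y => exact (VertCode.vertAt_iff h).symm
    | horiz x y => exact Iff.rfl
  obtain ⟨b, i, j⟩ := c
  cases b with
  | true => exact vert h
  | false =>
    obtain ⟨e, he, hq⟩ := vert (R := R.reflect) (i := i) (j := j) h
    refine ⟨e.reflect, ?_, fun q => ?_⟩
    · rw [← isInsertionEdge_reflect, InsEdge.reflect_reflect]; exact he
    · rw [← InsPoint.interiorTo_reflect, InsEdge.reflect_reflect, hq]
      exact hasCode_reflect (c := (false, i, j))

theorem IsCode.exists_hasCode {R : Rectangulation n} {c : Bool × Fin n × Fin n}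
    (h : R.IsCode c) : ∃ q, R.HasCode q c := by
  obtain ⟨b, i, j⟩ := c
  obtain ⟨y, hy⟩ := exists_between (VertCode.max_lt_min
    (show VertCode (if b then R else R.reflect) i j by cases b <;> exact h))
  cases b with
  | true => exact ⟨.vert _ y, (VertCode.vertAt_iff h).2 ⟨rfl, hy⟩⟩
  | false =>
    refine ⟨.horiz (-y) (-(R.reflect.rect i).left), ?_⟩
    change R.reflect.VertAt _ _ i j
    rw [neg_neg, neg_neg]
    exact (VertCode.vertAt_iff h).2 ⟨rfl, hy⟩

/-- Insertion edges and encodings correspond to each other, so edges with real coordinates can be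
replaced by finite data in terms of labels. -/
theorem isInsertionSequence_iff {R : Rectangulation n} {qs : List InsPoint} :
    R.IsInsertionSequence qs ↔ qs.Pairwise InsPoint.Before ∧
      (∀ q ∈ qs, ∃ c, R.HasCode q c) ∧ ∀ c, R.IsCode c → ∃! q, q ∈ qs ∧ R.HasCode q c := by
  refine and_congr Iff.rfl (and_congr (forall₂_congr fun q _ => ?_) ?_)
  · constructor
    · rintro ⟨e, he, hq⟩
      obtain ⟨c, hc, h⟩ := he.exists_code
      exact ⟨c, (h q).1 hq⟩
    · rintro ⟨c, hq⟩
      obtain ⟨e, he, h⟩ := hq.isCode.exists_edge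
      exact ⟨e, he, (h q).2 hq⟩
  · constructor
    · intro H c hc
      obtain ⟨e, he, h⟩ := hc.exists_edge
      simpa only [h] using H e he
    · intro H e he
      obtain ⟨c, hc, h⟩ := he.exists_code
      simpa only [h] using H c hc

theorem IsInsertionSequence.reflect {R : Rectangulation n} {qs : List InsPoint}
    (h : R.IsInsertionSequence qs) :
    R.reflect.IsInsertionSequence (qs.map InsPoint.reflect).reverse := by
  rw [isInsertionSequence_iff] at *
  obtain ⟨h1, h2, h3⟩ := h
  refine ⟨?_, ?_, fun c hc => ?_⟩
  · rw [List.pairwise_reverse, List.pairwise_map]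
    exact h1.imp fun h => InsPoint.before_reflect.2 h
  · simp only [List.mem_reverse, List.mem_map, forall_exists_index, and_imp]
    rintro _ q hq rfl
    obtain ⟨c, hc⟩ := h2 q hq
    exact ⟨_, hasCode_reflect.2 hc⟩
  · rw [← isCode_reflect, reflect_reflect] at hc
    obtain ⟨q, ⟨hq, hqc⟩, hu⟩ := h3 _ hc
    refine ⟨q.reflect, ⟨by simpa using ⟨q, hq, rfl⟩, ?_⟩, ?_⟩
    · rw [← hasCode_reflect, InsPoint.reflect_reflect, reflect_reflect]; exact hqc
    · rintro q' ⟨hq', hc'⟩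
      simp only [List.mem_reverse, List.mem_map] at hq'
      obtain ⟨p, hp, rfl⟩ := hq'
      rw [← hasCode_reflect, InsPoint.reflect_reflect, reflect_reflect] at hc'
      rw [hu p ⟨hp, hc'⟩]

theorem relabel_isInsertionSequence {R : Rectangulation n} {σ : Equiv.Perm (Fin n)}
    {qs : List InsPoint} :
    (R.relabel σ).IsInsertionSequence qs ↔ R.IsInsertionSequence qs := by
  have hv : ∀ v, (R.relabel σ).IsVertex v ↔ R.IsVertex v := fun v =>
    (σ.surjective.exists (p := fun i => (v.1 = (R.rect i).left ∨ v.1 = (R.rect i).right) ∧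
      (v.2 = (R.rect i).bottom ∨ v.2 = (R.rect i).top))).symm
  have he : ∀ e, (R.relabel σ).IsInsertionEdge e ↔ R.IsInsertionEdge e := by
    intro e
    cases e with
    | vert x a b =>
      simp only [IsInsertionEdge, hv]
      rw [σ.surjective.exists (p := fun i => R.TouchesBottom i ∧ x = (R.rect i).left ∧
        (R.rect i).bottom ≤ a ∧ b ≤ (R.rect i).top)]
      rfl
    | horiz y a b =>
      simp only [IsInsertionEdge, hv]
      rw [σ.surjective.exists (p := fun i => R.TouchesRight i ∧ y = (R.rect i).top ∧
        (R.rect i).left ≤ a ∧ b ≤ (R.rect i).right)]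
      rfl
  simp only [IsInsertionSequence, he]

/-! ### The order of the insertion points -/

theorem IsLeftOf.left_lt {R : Rectangulation n} {i j : Fin n} (h : R.IsLeftOf i j) :
    (R.rect i).left < (R.rect j).left := by
  have := R.left_lt_right i
  linarith [h.1]

theorem IsBelow.bottom_lt {R : Rectangulation n} {i j : Fin n} (h : R.IsBelow i j) :
    (R.rect i).bottom < (R.rect j).bottom := by
  have := R.bottom_lt_top i
  linarith [h.1]

theorem left_lt_of_transGen {R : Rectangulation n} {i j : Fin n}
    (h : Relation.TransGen R.IsLeftOf i j) : (R.rect i).left < (R.rect j).left := by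
  induction h with
  | single h => exact h.left_lt
  | tail _ h ih => exact ih.trans h.left_lt

theorem bottom_lt_of_transGen {R : Rectangulation n} {i j : Fin n}
    (h : Relation.TransGen R.IsBelow i j) : (R.rect i).bottom < (R.rect j).bottom := by
  induction h with
  | single h => exact h.bottom_lt
  | tail _ h ih => exact ih.trans h.bottom_lt

/-- Walk along the bottom boundary from `i'` to its left neighbour, and so on, until `i` is reached.
This expresses a comparison of coordinates by the relation alone. -/
theorem transGen_isLeftOf {R : Rectangulation n} {i i' : Fin n} (hi : R.TouchesBottom i)
    (hi' : R.TouchesBottom i') (h : (R.rect i).left < (R.rect i').left) :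
    Relation.TransGen R.IsLeftOf i i' := by
  have wf : WellFounded fun a b : Fin n => (R.rect a).left < (R.rect b).left :=
    @Finite.wellFounded_of_trans_of_irrefl _ _ _ ⟨fun _ _ _ => lt_trans⟩ ⟨fun _ => lt_irrefl _⟩
  induction i' using wf.induction with
  | _ i' ih =>
    have hb := R.bottom_lt_top i
    have hb' := R.bottom_lt_top i'
    have hl' := R.left_lt_right i'
    unfold TouchesBottom at hi hi'
    obtain ⟨k, ⟨k1, k2⟩, k3, k4⟩ := R.exists_northwest ((R.outer_left_le i).trans_lt h)
      (hl'.le.trans (R.right_le_outer i')) le_rfl (by linarith [R.top_le_outer i])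
    have hk : R.TouchesBottom k := le_antisymm k3 (R.outer_bottom_le k)
    have hk' := hk
    unfold TouchesBottom at hk'
    have hr : (R.rect k).right = (R.rect i').left := by
      rcases k2.eq_or_lt with e | e
      · exact e.symm
      · obtain rfl := R.eq_of_lt (i := k) (j := i') (by linarith) (by linarith) (by linarith)
          (by linarith)
        linarith
    have hki : R.IsLeftOf k i' := ⟨hr, by linarith, by linarith⟩
    rcases eq_or_ne i k with rfl | hne
    · exact .single hki
    · refine .tail (ih k hki.left_lt hk ?_) hki
      by_contra! hle
      exact hne (R.eq_of_lt (by linarith) (by linarith [R.left_lt_right i]) (by linarith)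
        (by linarith))

/-- Walk down the left side of `i`, from each rectangle ending there to the next lower one, until
`j` is reached. -/
theorem transGen_isBelow {R : Rectangulation n} {i j j' : Fin n} (hj : R.IsLeftOf j i)
    (hj' : R.IsLeftOf j' i) (h : (R.rect j).bottom < (R.rect j').bottom) :
    Relation.TransGen R.IsBelow j j' := by
  have wf : WellFounded fun a b : Fin n => (R.rect a).bottom < (R.rect b).bottom :=
    @Finite.wellFounded_of_trans_of_irrefl _ _ _ ⟨fun _ _ _ => lt_trans⟩ ⟨fun _ => lt_irrefl _⟩
  -- Rectangles that end at the same vertical line overlap horizontally just left of it, so their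
  -- vertical extents cannot overlap.
  have sep : ∀ {k k'}, R.IsLeftOf k i → R.IsLeftOf k' i →
      (R.rect k).bottom < (R.rect k').bottom → (R.rect k).top ≤ (R.rect k').bottom := by
    intro k k' hk hk' hlt
    by_contra! hlt'
    have := R.left_lt_right k
    have := R.left_lt_right k'
    have := R.bottom_lt_top k'
    obtain rfl := R.eq_of_lt (i := k) (j := k') (by linarith [hk.1, hk'.1])
      (by linarith [hk.1, hk'.1]) (by linarith) (by linarith)
    exact lt_irrefl _ hlt
  induction j' using wf.induction with
  | _ j' ih =>
    have hb := R.bottom_lt_top j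
    have hb' := R.bottom_lt_top j'
    have hl' := R.left_lt_right j'
    have hli := R.left_lt_right i
    have hs := sep hj hj' h
    obtain ⟨hj1, hj2, hj3⟩ := id hj
    obtain ⟨hj1', hj2', hj3'⟩ := id hj'
    -- The next lower rectangle on the left side of `i`: its right side is on that line and its top
    -- supports `j'`.
    obtain ⟨k, ⟨k1, k2⟩, k3, k4⟩ := R.exists_southwest (x := (R.rect i).left)
      (y := (R.rect j').bottom)
      (by linarith [R.outer_left_le j']) (by linarith [R.right_le_outer i])
      (by linarith [R.outer_bottom_le j]) (by linarith [R.top_le_outer j'])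
    have hr : (R.rect k).right = (R.rect i).left := by
      rcases k2.eq_or_lt with e | e
      · exact e.symm
      · obtain rfl := R.eq_of_lt (i := k) (j := i) (by linarith) (by linarith) (by linarith)
          (by linarith)
        linarith
    have ht : (R.rect k).top = (R.rect j').bottom := by
      rcases k4.eq_or_lt with e | e
      · exact e.symm
      · obtain rfl := R.eq_of_lt (i := k) (j := j') (by linarith) (by linarith) (by linarith)
          (by linarith)
        linarith
    have hki : R.IsLeftOf k i := ⟨hr, by linarith, by linarith⟩
    have hkj : R.IsBelow k j' := ⟨ht, by linarith, by linarith⟩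
    rcases eq_or_ne j k with rfl | hne
    · exact .single hkj
    · refine .tail (ih k hkj.bottom_lt hki ?_) hkj
      by_contra! hle
      exact hne (R.eq_of_lt (by linarith [R.left_lt_right j]) (by linarith) (by linarith)
        (by linarith))

/-- The order of the encodings of vertical insertion points, in terms of the relations. -/
def VertLt (R : Rectangulation n) (i j i' j' : Fin n) : Prop :=
  Relation.TransGen R.IsLeftOf i i' ∨ (i = i' ∧ Relation.TransGen R.IsBelow j j')

theorem VertAt.vertLt {R : Rectangulation n} {x y x' y' : ℝ} {i j i' j' : Fin n}
    (h : R.VertAt x y i j) (h' : R.VertAt x' y' i' j') (hlt : x < x' ∨ (x = x' ∧ y < y'))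
    (hne : ¬ (i = i' ∧ j = j')) : R.VertLt i j i' j' := by
  have c := h.vertCode
  have c' := h'.vertCode
  obtain ⟨h1, rfl, ⟨h3, h4⟩, ⟨h5, h6⟩, h7⟩ := h
  obtain ⟨g1, rfl, ⟨g3, g4⟩, ⟨g5, g6⟩, g7⟩ := h'
  rcases hlt with hlt | ⟨hx, hy⟩
  · exact Or.inl (transGen_isLeftOf h1 g1 hlt)
  · have e1 := R.left_lt_right i
    have e2 := R.left_lt_right i'
    have e3 := R.left_lt_right j
    have e4 := R.left_lt_right j'
    have b1 := R.bottom_lt_top i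
    have b2 := R.bottom_lt_top i'
    have b3 := R.bottom_lt_top j
    have b4 := R.bottom_lt_top j'
    have o1 := R.outer_left_le j
    have o2 := R.outer_left_le j'
    unfold TouchesBottom at h1 g1
    obtain rfl : i = i' := R.eq_of_lt (by linarith) (by linarith) (by linarith) (by linarith)
    have hj : j ≠ j' := fun h => hne ⟨rfl, h⟩
    refine Or.inr ⟨rfl, ?_⟩
    rcases c.2 with l | ⟨rfl, l⟩ <;> rcases c'.2 with l' | ⟨rfl, l'⟩
    · refine transGen_isBelow l l' ?_
      by_contra! hle
      exact hj (R.eq_of_lt (by linarith [l.1, l'.1]) (by linarith [l.1, l'.1]) (by linarith)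
        (by linarith))
    · linarith [l.1]
    · linarith [l'.1]
    · exact absurd rfl hj

theorem VertLt.asymm {R : Rectangulation n} {i j i' j' : Fin n} (h : R.VertLt i j i' j') :
    ¬ R.VertLt i' j' i j := by
  rintro (g | ⟨e, g⟩) <;> rcases h with h | ⟨e', h⟩
  · exact lt_asymm (left_lt_of_transGen h) (left_lt_of_transGen g)
  · exact (left_lt_of_transGen g).ne (by rw [e'])
  · exact (left_lt_of_transGen h).ne (by rw [e])
  · exact lt_asymm (bottom_lt_of_transGen h) (bottom_lt_of_transGen g)

/-- The order of the encodings of insertion points, in terms of the relations. -/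
def CodeLt (R : Rectangulation n) : Bool × Fin n × Fin n → Bool × Fin n × Fin n → Prop
  | (true, i, j), (true, i', j') => R.VertLt i j i' j'
  | (true, _, _), (false, _, _) => True
  | (false, _, _), (true, _, _) => False
  | (false, i, j), (false, i', j') => R.reflect.VertLt i' j' i j

theorem CodeLt.asymm {R : Rectangulation n} {c c' : Bool × Fin n × Fin n} (h : R.CodeLt c c') :
    ¬ R.CodeLt c' c := by
  obtain ⟨b, i, j⟩ := c
  obtain ⟨b', i', j'⟩ := c'
  cases b <;> cases b'
  · exact VertLt.asymm h
  · exact h.elim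
  · exact id
  · exact VertLt.asymm h

theorem HasCode.codeLt {R : Rectangulation n} {q q' : InsPoint} {c c' : Bool × Fin n × Fin n}
    (h : R.HasCode q c) (h' : R.HasCode q' c') (hlt : q.Before q') (hne : c ≠ c') :
    R.CodeLt c c' := by
  obtain ⟨b, i, j⟩ := c
  obtain ⟨b', i', j'⟩ := c'
  cases q <;> cases q' <;> cases b <;> cases b' <;>
    first | exact h.elim | exact h'.elim | exact hlt.elim | trivial | skip
  · exact VertAt.vertLt h h' hlt (fun h => hne (by rw [h.1, h.2]))
  · refine VertAt.vertLt h' h ?_ (fun h => hne (by rw [h.1, h.2]))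
    simp only [InsPoint.Before] at hlt
    rcases hlt with hlt | ⟨e, hlt⟩
    · exact Or.inl (neg_lt_neg hlt)
    · exact Or.inr ⟨by rw [e], neg_lt_neg hlt⟩

/-! ### The sorted list of encodings -/

/-- The list of all encodings of insertion points in increasing order. -/
def IsCodeList (R : Rectangulation n) (cs : List (Bool × Fin n × Fin n)) : Prop :=
  cs.Pairwise R.CodeLt ∧ ∀ c, c ∈ cs ↔ R.IsCode c

theorem IsCodeList.nodup {R : Rectangulation n} {cs : List (Bool × Fin n × Fin n)}
    (h : R.IsCodeList cs) : cs.Nodup :=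
  h.1.imp fun {a b} hab => by rintro rfl; exact hab.asymm hab

theorem IsCodeList.unique {R : Rectangulation n} {cs cs' : List (Bool × Fin n × Fin n)}
    (h : R.IsCodeList cs) (h' : R.IsCodeList cs') : cs = cs' := by
  have hp : cs.Perm cs' := (List.perm_ext_iff_of_nodup h.nodup h'.nodup).2 fun c => by
    rw [h.2, h'.2]
  exact hp.eq_of_pairwise (fun a b _ _ hab hba => (hab.asymm hba).elim) h.1 h'.1

theorem SameRel.vertCode {R S : Rectangulation n} (h : R.SameRel S) {i j : Fin n} :
    R.VertCode i j ↔ S.VertCode i j := by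
  unfold VertCode
  rw [h.touchesBottom, h.touchesLeft, h.1]

/-- Encodings and their order are defined by the relations only, so the numbering of insertion
points does not depend on the drawing or on the chosen points. -/
theorem SameRel.isCodeList {R S : Rectangulation n} (h : R.SameRel S)
    {cs : List (Bool × Fin n × Fin n)} : R.IsCodeList cs ↔ S.IsCodeList cs := by
  have hl : R.CodeLt = S.CodeLt := by
    funext ⟨b, i, j⟩ ⟨b', i', j'⟩
    cases b <;> cases b' <;> simp only [CodeLt, VertLt, h.1, h.2, h.reflect.1, h.reflect.2]
  have hc : ∀ c, R.IsCode c ↔ S.IsCode c := by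
    rintro ⟨b, i, j⟩
    cases b
    · exact h.reflect.vertCode
    · exact h.vertCode
  simp only [IsCodeList, hl, hc]

theorem IsInsertionSequence.exists_codeList {R : Rectangulation n} {qs : List InsPoint}
    (h : R.IsInsertionSequence qs) :
    ∃ cs, R.IsCodeList cs ∧ List.Forall₂ R.HasCode qs cs := by
  rw [isInsertionSequence_iff] at h
  obtain ⟨h1, h2, h3⟩ := h
  rcases isEmpty_or_nonempty (Bool × Fin n × Fin n) with he | he
  · obtain rfl : qs = [] := List.eq_nil_iff_forall_not_mem.2 fun q hq =>
      he.elim (h2 q hq).choose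
    exact ⟨[], ⟨.nil, fun c => he.elim c⟩, .nil⟩
  choose! f hf using h2
  refine ⟨qs.map f, ⟨?_, fun c => ?_⟩, ?_⟩
  · rw [List.pairwise_map]
    refine h1.imp_of_mem fun {a b} ha hb hab => (hf a ha).codeLt (hf b hb) hab fun e => ?_
    have := (h3 _ (hf a ha).isCode).unique ⟨ha, hf a ha⟩ ⟨hb, e ▸ hf b hb⟩
    subst this
    exact a.before_irrefl hab
  · rw [List.mem_map]
    constructor
    · rintro ⟨q, hq, rfl⟩
      exact (hf q hq).isCode
    · intro hc
      obtain ⟨q, ⟨hq, hqc⟩, -⟩ := h3 c hc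
      exact ⟨q, hq, (hf q hq).unique hqc⟩
  · rw [List.forall₂_map_right_iff, List.forall₂_same]
    exact hf

theorem IsCodeList.isInsertionSequence {R : Rectangulation n}
    {cs : List (Bool × Fin n × Fin n)} (h : R.IsCodeList cs)
    {f : Bool × Fin n × Fin n → InsPoint} (hf : ∀ c, R.IsCode c → R.HasCode (f c) c) :
    R.IsInsertionSequence (cs.map f) := by
  rw [isInsertionSequence_iff]
  refine ⟨?_, ?_, fun c hc => ⟨f c, ⟨List.mem_map_of_mem ((h.2 c).2 hc), hf c hc⟩, ?_⟩⟩
  · rw [List.pairwise_map]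
    refine h.1.imp_of_mem fun {a b} ha hb hab => ?_
    have ha' := hf a ((h.2 a).1 ha)
    have hb' := hf b ((h.2 b).1 hb)
    rcases (f a).before_total (f b) with h' | h' | h'
    · exact h'
    · rw [h'] at ha'
      obtain rfl := ha'.unique hb'
      exact (hab.asymm hab).elim
    · exact (hab.asymm (hb'.codeLt ha' h' (by rintro rfl; exact hab.asymm hab))).elim
  · simp only [List.mem_map, forall_exists_index, and_imp]
    rintro _ c hc rfl
    exact ⟨c, hf c ((h.2 c).1 hc)⟩
  · rintro q ⟨hq, hqc⟩
    obtain ⟨c', hc', rfl⟩ := List.mem_map.1 hq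
    rw [(hf c' ((h.2 c').1 hc')).unique hqc]

/-- Choose a point on each contact and sort the encodings by these points. -/
theorem exists_isCodeList (R : Rectangulation n) : ∃ cs, R.IsCodeList cs := by
  classical
  have : Nonempty InsPoint := ⟨.vert 0 0⟩
  choose! f hf using fun c (hc : R.IsCode c) => hc.exists_hasCode
  -- Being not after is total and transitive, as sorting requires.
  let r : Bool × Fin n × Fin n → Bool × Fin n × Fin n → Prop := fun a b => ¬ (f b).Before (f a)
  have : Std.Total r := ⟨fun a b => by
    by_contra! h
    simp only [r, not_not] at h
    exact (f a).before_irrefl (h.2.trans h.1)⟩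
  have : IsTrans _ r := ⟨fun a b c hab hbc hca => by
    simp only [r] at hab hbc
    rcases (f a).before_total (f b) with h | h | h
    · exact hbc (hca.trans h)
    · exact hbc (h ▸ hca)
    · exact hab h⟩
  have hmem : ∀ c, c ∈ ((Finset.univ.filter R.IsCode).toList.insertionSort r) ↔ R.IsCode c := by
    intro c
    rw [(List.perm_insertionSort r _).mem_iff]
    simp
  have hnd : ((Finset.univ.filter R.IsCode).toList.insertionSort r).Nodup :=
    (List.perm_insertionSort r _).nodup_iff.2 (Finset.nodup_toList _)
  refine ⟨_, ?_, hmem⟩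
  have hs := List.pairwise_insertionSort r (Finset.univ.filter R.IsCode).toList
  refine (hs.and hnd).imp_of_mem fun {a b} ha hb hab => ?_
  have ha' := hf a ((hmem a).1 ha)
  have hb' := hf b ((hmem b).1 hb)
  refine ha'.codeLt hb' ?_ hab.2
  rcases (f a).before_total (f b) with h' | h' | h'
  · exact h'
  · rw [h'] at ha'
    exact (hab.2 (ha'.unique hb')).elim
  · exact (hab.1 h').elim

end Rectangulation

/-! ### Relations after an insertion -/

namespace Rectangulation

variable {n : ℕ}

theorem isInsertionAt_reflect_horiz {E : Rectangulation n} {D : Rectangulation (n + 1)} {x y : ℝ} :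
    E.reflect.IsInsertionAt D.reflect (.vert (-y) (-x)) ↔ E.IsInsertionAt D (.horiz x y) := by
  have ho : D.reflect.outer = E.reflect.outer ↔ D.outer = E.outer := by
    constructor
    · intro h
      have := congrArg Rect.reflect h
      rwa [show D.reflect.outer = D.outer.reflect from rfl, show E.reflect.outer = E.outer.reflect
        from rfl, Rect.reflect_reflect, Rect.reflect_reflect] at this
    · exact fun h => congrArg Rect.reflect h
  simp only [IsInsertionAt, ho, reflect_left, reflect_right, reflect_bottom, reflect_top,
    reflect_touchesBottom, reflect_touchesRight, neg_inj, neg_le_neg_iff]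
  constructor
  · rintro ⟨h1, h2, h3, h4, h5, h6⟩
    exact ⟨h1, h3, h2, h5, h4, fun i => ⟨(h6 i).2.2.1, (h6 i).2.1, (h6 i).1, (h6 i).2.2.2⟩⟩
  · rintro ⟨h1, h2, h3, h4, h5, h6⟩
    exact ⟨h1, h3, h2, h5, h4, fun i => ⟨(h6 i).2.2.1, (h6 i).2.1, (h6 i).1, (h6 i).2.2.2⟩⟩

theorem isInsertionAt_reflect {E : Rectangulation n} {D : Rectangulation (n + 1)}
    {q : InsPoint} : E.reflect.IsInsertionAt D.reflect q.reflect ↔ E.IsInsertionAt D q := by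
  cases q with
  | horiz x y => exact isInsertionAt_reflect_horiz
  | vert x y =>
    have := isInsertionAt_reflect_horiz (E := E.reflect) (D := D.reflect) (x := -y) (y := -x)
    simp only [neg_neg, reflect_reflect] at this
    exact this.symm

theorem isLeftOf_irrefl (R : Rectangulation n) (i : Fin n) : ¬ R.IsLeftOf i i := fun h =>
  (R.left_lt_right i).ne' h.1

theorem isBelow_irrefl (R : Rectangulation n) (i : Fin n) : ¬ R.IsBelow i i := fun h =>
  (R.bottom_lt_top i).ne' h.1

/-! ### Relations after a vertical insertion -/

/-- `D` arises from `E` by an insertion at the vertical insertion point `(x, y)`, which lies on the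
contact of `i` and `j`. -/
structure VertInsert (E : Rectangulation n) (D : Rectangulation (n + 1)) (x y : ℝ) (i j : Fin n) :
    Prop where
  vertAt : E.VertAt x y i j
  isInsertionAt : E.IsInsertionAt D (.vert x y)

namespace VertInsert

variable {E : Rectangulation n} {D : Rectangulation (n + 1)} {x y : ℝ} {i j : Fin n}

theorem outer_eq (h : E.VertInsert D x y i j) : D.outer = E.outer := h.2.1
theorem left_last (h : E.VertInsert D x y i j) : (D.rect (Fin.last n)).left = x := h.2.2.1
theorem top_last (h : E.VertInsert D x y i j) : (D.rect (Fin.last n)).top = y := h.2.2.2.1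
theorem bottom_last (h : E.VertInsert D x y i j) :
    (D.rect (Fin.last n)).bottom = E.outer.bottom := by
  rw [← h.outer_eq]; exact h.2.2.2.2.1
theorem right_last (h : E.VertInsert D x y i j) :
    (D.rect (Fin.last n)).right = E.outer.right := by
  rw [← h.outer_eq]; exact h.2.2.2.2.2.1
theorem left_eq (h : E.VertInsert D x y i j) (a : Fin n) :
    (D.rect a.castSucc).left = (E.rect a).left := (h.2.2.2.2.2.2 a).1
theorem right_eq (h : E.VertInsert D x y i j) (a : Fin n) :
    (D.rect a.castSucc).right = (E.rect a).right := (h.2.2.2.2.2.2 a).2.1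
theorem top_eq (h : E.VertInsert D x y i j) (a : Fin n) :
    (D.rect a.castSucc).top = (E.rect a).top := (h.2.2.2.2.2.2 a).2.2.1
theorem bottom_of_cut (h : E.VertInsert D x y i j) {a : Fin n} (ha : E.TouchesBottom a)
    (ha' : x ≤ (E.rect a).left) : (D.rect a.castSucc).bottom = y :=
  (h.2.2.2.2.2.2 a).2.2.2.1 ⟨ha, ha'⟩
theorem bottom_of_not_cut (h : E.VertInsert D x y i j) {a : Fin n}
    (ha : ¬ (E.TouchesBottom a ∧ x ≤ (E.rect a).left)) :
    (D.rect a.castSucc).bottom = (E.rect a).bottom :=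
  (h.2.2.2.2.2.2 a).2.2.2.2 ha

theorem outer_bottom_lt (h : E.VertInsert D x y i j) : E.outer.bottom < y := by
  have := D.bottom_lt_top (Fin.last n)
  rwa [h.bottom_last, h.top_last] at this

theorem lt_outer_right (h : E.VertInsert D x y i j) : x < E.outer.right := by
  have := D.left_lt_right (Fin.last n)
  rwa [h.right_last, h.left_last] at this

theorem lt_top_of_cut (h : E.VertInsert D x y i j) {a : Fin n} (ha : E.TouchesBottom a)
    (ha' : x ≤ (E.rect a).left) : y < (E.rect a).top := by
  have := D.bottom_lt_top a.castSucc
  rwa [h.top_eq, h.bottom_of_cut ha ha'] at this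

theorem bottom_le (h : E.VertInsert D x y i j) (a : Fin n) :
    (E.rect a).bottom ≤ (D.rect a.castSucc).bottom := by
  by_cases hc : E.TouchesBottom a ∧ x ≤ (E.rect a).left
  · rw [h.bottom_of_cut hc.1 hc.2, hc.1]; exact h.outer_bottom_lt.le
  · rw [h.bottom_of_not_cut hc]

/-- The new rectangle occupies everything to the right of `x` and below `y`, so an old rectangle
that extends beyond `x` must start at height `y` or above. -/
theorem top_le_or (h : E.VertInsert D x y i j) {a : Fin n} (ha : x < (E.rect a).right) :
    y ≤ (D.rect a.castSucc).bottom := by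
  by_contra! hlt
  refine (Fin.castSucc_lt_last a).ne (D.eq_of_lt ?_ ?_ ?_ ?_)
  · rw [h.left_eq, h.right_last]; linarith [E.left_lt_right a, E.right_le_outer a]
  · rwa [h.right_eq, h.left_last]
  · rwa [h.top_last]
  · rw [h.top_eq, h.bottom_last]; linarith [E.outer_bottom_le a, E.bottom_lt_top a]

theorem cut_of_lt (h : E.VertInsert D x y i j) {a : Fin n} (ha : x < (E.rect a).right)
    (ha' : (E.rect a).bottom < y) : E.TouchesBottom a ∧ x ≤ (E.rect a).left := by
  by_contra hc
  have := h.top_le_or ha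
  rw [h.bottom_of_not_cut hc] at this
  linarith

/-- The point is that an uncut rectangle cannot rest on the new top side. If it starts left of `x`,
it overlaps `i`. Otherwise the rectangle on the bottom boundary under its left end is cut, hence
higher than `y`, and overlaps it. -/
theorem isBelow_last_iff (h : E.VertInsert D x y i j) {a : Fin n} :
    D.IsBelow (Fin.last n) a.castSucc ↔ E.TouchesBottom a ∧ x ≤ (E.rect a).left := by
  have hi := h.vertAt
  have e1 := E.left_lt_right a
  have e2 := E.bottom_lt_top a
  have e3 := E.right_le_outer a
  constructor
  · rintro ⟨h1, h2, h3⟩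
    rw [h.top_last] at h1
    rw [h.left_last, h.right_eq] at h2
    rw [h.left_eq, h.right_last] at h3
    by_contra hc
    rw [h.bottom_of_not_cut hc] at h1
    rcases lt_or_ge (E.rect a).left x with hlt | hge
    · obtain ⟨-, i1, ⟨i2, i3⟩, -, -⟩ := hi
      obtain rfl := E.eq_of_lt (i := a) (j := i) (by linarith [E.left_lt_right i]) (by linarith)
        (by linarith) (by linarith)
      linarith
    · obtain ⟨b, ⟨b1, b2⟩, b3, b4⟩ := E.exists_northeast (E.outer_left_le a) (by linarith)
        le_rfl (E.outer.bottom_lt_top)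
      have hb := h.cut_of_lt (a := b) (by linarith) (by linarith [h.outer_bottom_lt])
      have hb' := h.lt_top_of_cut hb.1 hb.2
      obtain rfl := E.eq_of_lt (i := a) (j := b) (by linarith) (by linarith)
        (by linarith) (by linarith [h.outer_bottom_lt])
      linarith [h.outer_bottom_lt]
  · rintro ⟨h1, h2⟩
    refine ⟨?_, ?_, ?_⟩
    · rw [h.top_last, h.bottom_of_cut h1 h2]
    · rw [h.left_last, h.right_eq]; linarith
    · rw [h.left_eq, h.right_last]; linarith

theorem isBelow_last_iff' (h : E.VertInsert D x y i j) {a : Fin n} :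
    D.IsBelow (Fin.last n) a.castSucc ↔
      E.TouchesBottom a ∧ (a = i ∨ Relation.TransGen E.IsLeftOf i a) := by
  rw [h.isBelow_last_iff]
  obtain ⟨h1, rfl, -⟩ := h.vertAt
  refine and_congr_right fun ha => ?_
  constructor
  · intro hle
    rcases hle.eq_or_lt with e | hlt
    · left
      have := E.left_lt_right a
      have := E.left_lt_right i
      have := E.bottom_lt_top a
      have := E.bottom_lt_top i
      unfold TouchesBottom at *
      exact E.eq_of_lt (by linarith) (by linarith) (by linarith) (by linarith)
    · exact Or.inr (transGen_isLeftOf h1 ha hlt)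
  · rintro (rfl | h')
    · exact le_rfl
    · exact (left_lt_of_transGen h').le

theorem isBelow_last (h : E.VertInsert D x y i j) :
    D.IsBelow (Fin.last n) i.castSucc :=
  h.isBelow_last_iff.2 ⟨h.vertAt.1, h.vertAt.2.1.ge⟩

theorem not_isBelow_last (h : E.VertInsert D x y i j) (a : Fin (n + 1)) :
    ¬ D.IsBelow a (Fin.last n) :=
  touchesBottom_iff.1 h.2.2.2.2.1 a

theorem not_last_isLeftOf (h : E.VertInsert D x y i j) (a : Fin (n + 1)) :
    ¬ D.IsLeftOf (Fin.last n) a :=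
  touchesRight_iff.1 h.2.2.2.2.2.1 a

/-- Only bottom sides on the outer boundary move, and these had nothing below them. -/
theorem isBelow_iff (h : E.VertInsert D x y i j) {a b : Fin n} :
    D.IsBelow a.castSucc b.castSucc ↔ E.IsBelow a b := by
  unfold IsBelow
  rw [h.left_eq, h.left_eq, h.right_eq, h.right_eq, h.top_eq]
  by_cases hc : E.TouchesBottom b ∧ x ≤ (E.rect b).left
  · rw [h.bottom_of_cut hc.1 hc.2]
    constructor
    · rintro ⟨h1, h2, h3⟩
      have := h.top_le_or (a := a) (by linarith)
      have h' := D.bottom_lt_top a.castSucc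
      rw [h.top_eq] at h'
      linarith
    · rintro ⟨h1, h2, h3⟩
      exact (touchesBottom_iff.1 hc.1 a ⟨h1, h2, h3⟩).elim
  · rw [h.bottom_of_not_cut hc]

theorem isLeftOf_last_iff (h : E.VertInsert D x y i j) {a : Fin n} :
    D.IsLeftOf a.castSucc (Fin.last n) ↔
      E.IsLeftOf a i ∧ (a = j ∨ Relation.TransGen E.IsBelow a j) := by
  obtain ⟨h1, h2, ⟨h3, h4⟩, ⟨h5, h6⟩, h7⟩ := h.vertAt
  have hy := h.outer_bottom_lt
  have ea := E.left_lt_right a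
  have eb := E.bottom_lt_top a
  unfold TouchesBottom at h1
  constructor
  · rintro ⟨g1, g2, g3⟩
    rw [h.right_eq, h.left_last] at g1
    rw [h.top_last] at g2
    rw [h.bottom_last, h.top_eq] at g3
    have g2' := (h.bottom_le a).trans_lt g2
    have hl : E.IsLeftOf a i := ⟨by rw [g1, h2], by linarith, by linarith⟩
    refine ⟨hl, ?_⟩
    by_cases haj : a = j
    · exact Or.inl haj
    right
    rcases h7 with h7 | ⟨rfl, h7⟩
    · refine transGen_isBelow hl ⟨by rw [h7, h2], by linarith, by linarith⟩ ?_
      by_contra! hle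
      exact haj (E.eq_of_lt (by linarith) (by linarith [E.left_lt_right j])
        (by linarith) (by linarith))
    · linarith [E.outer_left_le a]
  · rintro ⟨g1, g2⟩
    have hb : (E.rect a).bottom < y := by
      rcases g2 with rfl | g2
      · exact h5
      · exact (bottom_lt_of_transGen g2).trans h5
    have hnc : ¬ (E.TouchesBottom a ∧ x ≤ (E.rect a).left) := fun hc => by
      linarith [hc.2, g1.1]
    refine ⟨?_, ?_, ?_⟩
    · rw [h.right_eq, h.left_last, g1.1, h2]
    · rwa [h.top_last, h.bottom_of_not_cut hnc]
    · rw [h.bottom_last, h.top_eq]; linarith [E.outer_bottom_le a]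

/-- The cut removes the part of the left side of `i` below `y`. Exactly the left neighbours of `i`
under `j` lose their contact, while `j` extends above `y` and keeps it. -/
theorem isLeftOf_iff (h : E.VertInsert D x y i j) {a b : Fin n} :
    D.IsLeftOf a.castSucc b.castSucc ↔
      E.IsLeftOf a b ∧ ¬ (b = i ∧ Relation.TransGen E.IsBelow a j) := by
  obtain ⟨h1, h2, ⟨h3, h4⟩, ⟨h5, h6⟩, h7⟩ := h.vertAt
  have hy := h.outer_bottom_lt
  have ea := E.left_lt_right a
  have eb := E.bottom_lt_top a
  have ej := E.left_lt_right j
  have ei := E.left_lt_right i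
  have h1' := h1
  unfold TouchesBottom at h1
  have hDa := D.bottom_lt_top a.castSucc
  have hDb := D.bottom_lt_top b.castSucc
  rw [h.top_eq] at hDa hDb
  constructor
  · rintro ⟨g1, g2, g3⟩
    rw [h.right_eq, h.left_eq] at g1
    rw [h.top_eq] at g2 g3
    refine ⟨⟨g1, (h.bottom_le a).trans_lt g2, (h.bottom_le b).trans_lt g3⟩, ?_⟩
    rintro ⟨rfl, ht⟩
    have hlt := bottom_lt_of_transGen ht
    rw [h.bottom_of_cut h1' h2.ge] at g3
    rcases h7 with h7 | ⟨rfl, h7⟩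
    · obtain rfl := E.eq_of_lt (i := a) (j := j) (by linarith) (by linarith) (by linarith)
        (by linarith)
      exact lt_irrefl _ hlt
    · linarith [E.outer_left_le a]
  · rintro ⟨⟨g1, g2, g3⟩, hn⟩
    refine ⟨by rw [h.right_eq, h.left_eq, g1], ?_, ?_⟩
    · rw [h.top_eq]
      by_cases hc : E.TouchesBottom a ∧ x ≤ (E.rect a).left
      · have := h.top_le_or (a := b) (by linarith [hc.2, E.left_lt_right b])
        rw [h.bottom_of_cut hc.1 hc.2]
        linarith
      · rwa [h.bottom_of_not_cut hc]
    · rw [h.top_eq]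
      by_cases hc : E.TouchesBottom b ∧ x ≤ (E.rect b).left
      · rw [h.bottom_of_cut hc.1 hc.2]
        by_contra! hle
        rcases hc.2.eq_or_lt with e | hlt
        · have hb := hc.1
          unfold TouchesBottom at hb
          obtain rfl : b = i := E.eq_of_lt (by linarith [E.left_lt_right b])
            (by linarith [E.left_lt_right b]) (by linarith) (by linarith [E.bottom_lt_top b])
          refine hn ⟨rfl, ?_⟩
          rcases h7 with h7 | ⟨rfl, h7⟩
          · refine transGen_isBelow ⟨g1, g2, g3⟩ ⟨by rw [h7, h2], by linarith, by linarith⟩ ?_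
            by_contra! hle'
            obtain rfl := E.eq_of_lt (i := a) (j := j) (by linarith) (by linarith) (by linarith)
              (by linarith)
            linarith
          · linarith [E.outer_left_le a]
        · have := h.top_le_or (a := a) (by linarith)
          linarith
      · rwa [h.bottom_of_not_cut hc]

theorem transGen_irrefl {a : Fin n} : ¬ Relation.TransGen E.IsBelow a a := fun h =>
  lt_irrefl _ (bottom_lt_of_transGen h)

/-- The contacts with `i` that were lost reappear as contacts with the new rectangle, which makes
the insertion reversible. -/
theorem parent_isLeftOf_iff (h : E.VertInsert D x y i j) {a b : Fin n} :
    E.IsLeftOf a b ↔ D.IsLeftOf a.castSucc b.castSucc ∨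
      (D.IsLeftOf a.castSucc (Fin.last n) ∧ b = i) := by
  rw [h.isLeftOf_iff, h.isLeftOf_last_iff]
  constructor
  · intro hl
    by_cases hc : b = i ∧ Relation.TransGen E.IsBelow a j
    · exact Or.inr ⟨⟨hc.1 ▸ hl, Or.inr hc.2⟩, hc.1⟩
    · exact Or.inl ⟨hl, hc⟩
  · rintro (h | ⟨⟨h, -⟩, rfl⟩)
    · exact h.1
    · exact h

theorem not_isBelow_of (h : E.VertInsert D x y i j) {a b : Fin n}
    (ha : D.IsLeftOf a.castSucc (Fin.last n)) (hb : D.IsBelow (Fin.last n) b.castSucc) :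
    ¬ D.IsBelow a.castSucc b.castSucc := by
  intro hab
  have h1 := (h.isBelow_last_iff.1 hb).2
  have h2 := ha.1
  have h3 := hab.2.2
  rw [h.right_eq, h.left_last] at h2
  rw [h.left_eq, h.right_eq] at h3
  linarith

/-- Since `j` extends both above and below height `y`, it touches both the new rectangle and `i`.
Together with `not_isBelow_of` this distinguishes vertical from horizontal insertions. -/
theorem exists_isLeftOf (h : E.VertInsert D x y i j) {a : Fin n}
    (ha : D.IsLeftOf a.castSucc (Fin.last n)) :
    D.IsLeftOf j.castSucc (Fin.last n) ∧ D.IsLeftOf j.castSucc i.castSucc := by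
  have hl := (h.isLeftOf_last_iff.1 ha).1
  have hj : E.IsLeftOf j i := by
    rcases h.vertAt.vertCode.2 with h' | ⟨-, h'⟩
    · exact h'
    · exact (touchesLeft_iff.1 h' a hl).elim
  exact ⟨h.isLeftOf_last_iff.2 ⟨hj, Or.inl rfl⟩,
    h.isLeftOf_iff.2 ⟨hj, fun h' => transGen_irrefl h'.2⟩⟩

theorem sameRel {E' : Rectangulation n} {D' : Rectangulation (n + 1)} {x' y' : ℝ}
    (h : E.VertInsert D x y i j) (h' : E'.VertInsert D' x' y' i j) (hE : E.SameRel E') :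
    D.SameRel D' := by
  constructor
  · funext a b
    apply propext
    induction a using Fin.lastCases with
    | last => simp [h.not_last_isLeftOf, h'.not_last_isLeftOf]
    | cast a =>
      induction b using Fin.lastCases with
      | last => rw [h.isLeftOf_last_iff, h'.isLeftOf_last_iff, hE.1, hE.2]
      | cast b => rw [h.isLeftOf_iff, h'.isLeftOf_iff, hE.1, hE.2]
  · funext a b
    apply propext
    induction b using Fin.lastCases with
    | last => simp [h.not_isBelow_last, h'.not_isBelow_last]
    | cast b =>
      induction a using Fin.lastCases with
      | last => rw [h.isBelow_last_iff', h'.isBelow_last_iff', hE.1, hE.touchesBottom]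
      | cast a => rw [h.isBelow_iff, h'.isBelow_iff, hE.2]

/-- The encoding can be read off from `D`: `i` is the leftmost rectangle above the new one, and `j`
is the topmost one to its left, or `i` itself if there is none. Once `i` is known, the relations of
`E` follow. -/
theorem parent_sameRel {E' : Rectangulation n} {D' : Rectangulation (n + 1)} {x' y' : ℝ}
    {i' j' : Fin n} (h : E.VertInsert D x y i j) (h' : E'.VertInsert D' x' y' i' j')
    (hD : D.SameRel D') : E.SameRel E' ∧ i = i' ∧ j = j' := by
  -- In the mirror image the rectangles above the new one become those left of it, so
  -- `transGen_isBelow` applies and orders them from left to right.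
  have chain : ∀ {E : Rectangulation n} {D : Rectangulation (n + 1)} {x y : ℝ} {i j i' : Fin n},
      E.VertInsert D x y i j → D.IsBelow (Fin.last n) i'.castSucc → i' ≠ i →
      Relation.TransGen D.reflect.IsBelow i'.castSucc i.castSucc := by
    intro E D x y i j i' h hi' hne
    refine transGen_isBelow (i := Fin.last n) (reflect_isLeftOf.2 hi')
      (reflect_isLeftOf.2 h.isBelow_last) ?_
    simp only [reflect_bottom, neg_lt_neg_iff, h.right_eq]
    by_contra! hle
    have ht := h.isBelow_last_iff.1 hi'
    have e1 := E.left_lt_right i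
    have e2 := E.left_lt_right i'
    have e3 := E.bottom_lt_top i
    have e4 := E.bottom_lt_top i'
    obtain ⟨h1, h2, -⟩ := h.vertAt
    unfold TouchesBottom at h1 ht
    exact hne (E.eq_of_lt (by linarith [ht.2]) (by linarith [ht.2]) (by linarith [ht.1])
      (by linarith [ht.1]))
  have hi : i = i' := by
    by_contra hne
    have h1 := chain h' (hD.2 ▸ h.isBelow_last) hne
    have h2 := chain h (hD.symm.2 ▸ h'.isBelow_last) (Ne.symm hne)
    rw [← hD.reflect.2] at h1
    exact lt_asymm (bottom_lt_of_transGen h1) (bottom_lt_of_transGen h2)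
  subst hi
  have hE : E.SameRel E' := by
    constructor
    · funext a b
      apply propext
      rw [h.parent_isLeftOf_iff, h'.parent_isLeftOf_iff, hD.1]
    · funext a b
      apply propext
      rw [← h.isBelow_iff, ← h'.isBelow_iff, hD.2]
  refine ⟨hE, rfl, ?_⟩
  rcases h.vertAt.vertCode.2 with hj | ⟨rfl, hj⟩ <;>
    rcases h'.vertAt.vertCode.2 with hj' | ⟨rfl, hj'⟩
  · have h1 := (h'.isLeftOf_last_iff (a := j)).1
      (hD.1 ▸ h.isLeftOf_last_iff.2 ⟨hj, Or.inl rfl⟩)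
    have h2 := (h.isLeftOf_last_iff (a := j')).1
      (hD.symm.1 ▸ h'.isLeftOf_last_iff.2 ⟨hj', Or.inl rfl⟩)
    rcases h1.2 with h1 | h1
    · exact h1
    rcases h2.2 with h2 | h2
    · exact h2.symm
    rw [hE.2] at h2
    exact (lt_asymm (bottom_lt_of_transGen h1) (bottom_lt_of_transGen h2)).elim
  · rw [hE.1] at hj
    exact (touchesLeft_iff.1 hj' _ hj).elim
  · rw [← hE.1] at hj'
    exact (touchesLeft_iff.1 hj _ hj').elim
  · rfl

end VertInsert

/-! ### Insertions of both kinds -/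

/-- `D` arises from `E` by an insertion at the point `q` with encoding `c`. -/
structure Insert (E : Rectangulation n) (D : Rectangulation (n + 1)) (q : InsPoint)
    (c : Bool × Fin n × Fin n) : Prop where
  hasCode : E.HasCode q c
  isInsertionAt : E.IsInsertionAt D q

theorem insert_reflect {E : Rectangulation n} {D : Rectangulation (n + 1)} {q : InsPoint}
    {c : Bool × Fin n × Fin n} :
    E.reflect.Insert D.reflect q.reflect (flipCode c) ↔ E.Insert D q c :=
  ⟨fun h => ⟨hasCode_reflect.1 h.1, isInsertionAt_reflect.1 h.2⟩,
    fun h => ⟨hasCode_reflect.2 h.1, isInsertionAt_reflect.2 h.2⟩⟩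

theorem Insert.vertInsert {E : Rectangulation n} {D : Rectangulation (n + 1)} {q : InsPoint}
    {i j : Fin n} (h : E.Insert D q (true, i, j)) : ∃ x y, E.VertInsert D x y i j := by
  obtain ⟨h1, h2⟩ := h
  cases q with
  | vert x y => exact ⟨x, y, h1, h2⟩
  | horiz x y => exact h1.elim

theorem Insert.vertInsert_reflect {E : Rectangulation n} {D : Rectangulation (n + 1)}
    {q : InsPoint} {i j : Fin n} (h : E.Insert D q (false, i, j)) :
    ∃ x y, E.reflect.VertInsert D.reflect x y i j :=
  (insert_reflect.2 h).vertInsert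

theorem Insert.sameRel {E E' : Rectangulation n} {D D' : Rectangulation (n + 1)}
    {q q' : InsPoint} {c : Bool × Fin n × Fin n} (h : E.Insert D q c) (h' : E'.Insert D' q' c)
    (hE : E.SameRel E') : D.SameRel D' := by
  obtain ⟨b, i, j⟩ := c
  cases b with
  | true =>
    obtain ⟨x, y, h⟩ := h.vertInsert
    obtain ⟨x', y', h'⟩ := h'.vertInsert
    exact h.sameRel h' hE
  | false =>
    obtain ⟨x, y, h⟩ := h.vertInsert_reflect
    obtain ⟨x', y', h'⟩ := h'.vertInsert_reflect
    simpa using (h.sameRel h' hE.reflect).reflect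

/-- After a vertical insertion with some rectangle left of the new one, a left neighbour of the new
rectangle touches an upper neighbour from the left. After a horizontal insertion `not_isBelow_of`,
reflected, forbids this, although a left neighbour exists. -/
theorem Insert.flag_eq {E E' : Rectangulation n} {D D' : Rectangulation (n + 1)}
    {q q' : InsPoint} {c c' : Bool × Fin n × Fin n} (h : E.Insert D q c) (h' : E'.Insert D' q' c')
    (hD : D.SameRel D') : c.1 = c'.1 := by
  have key : ∀ {E E' : Rectangulation n} {D D' : Rectangulation (n + 1)} {q q' : InsPoint}
      {i j i' j' : Fin n}, E.Insert D q (true, i, j) → E'.Insert D' q' (false, i', j') →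
      ¬ D.SameRel D' := by
    intro E E' D D' q q' i j i' j' h h' hD
    obtain ⟨x, y, h⟩ := h.vertInsert
    obtain ⟨x', y', h'⟩ := h'.vertInsert_reflect
    have h1 : D.IsLeftOf i'.castSucc (Fin.last n) := by
      rw [hD.1, ← reflect_isBelow]
      exact h'.isBelow_last
    obtain ⟨h2, h3⟩ := h.exists_isLeftOf h1
    have h4 := h.isBelow_last
    rw [hD.1] at h2 h3
    rw [hD.2] at h4
    exact h'.not_isBelow_of (reflect_isLeftOf.2 h4) (reflect_isBelow.2 h2) (reflect_isBelow.2 h3)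
  obtain ⟨b, i, j⟩ := c
  obtain ⟨b', i', j'⟩ := c'
  cases b <;> cases b' <;> try rfl
  · exact (key h' h hD.symm).elim
  · exact (key h h' hD).elim

/-- The relations of the child determine the relations of the parent and the encoding. This is what
makes parent and position well defined on equivalence classes. -/
theorem Insert.parent_sameRel {E E' : Rectangulation n} {D D' : Rectangulation (n + 1)}
    {q q' : InsPoint} {c c' : Bool × Fin n × Fin n} (h : E.Insert D q c) (h' : E'.Insert D' q' c')
    (hD : D.SameRel D') : E.SameRel E' ∧ c = c' := by
  have hb := h.flag_eq h' hD
  obtain ⟨b, i, j⟩ := c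
  obtain ⟨b', i', j'⟩ := c'
  obtain rfl : b = b' := hb
  cases b with
  | true =>
    obtain ⟨x, y, h⟩ := h.vertInsert
    obtain ⟨x', y', h'⟩ := h'.vertInsert
    obtain ⟨h1, rfl, rfl⟩ := h.parent_sameRel h' hD
    exact ⟨h1, rfl⟩
  | false =>
    obtain ⟨x, y, h⟩ := h.vertInsert_reflect
    obtain ⟨x', y', h'⟩ := h'.vertInsert_reflect
    obtain ⟨h1, rfl, rfl⟩ := h.parent_sameRel h' hD.reflect
    exact ⟨by simpa using h1.reflect, rfl⟩

/-! ### Deletion and insertion are inverse -/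

theorem reflect_hasEdgeLeft {R : Rectangulation n} {x y : ℝ} :
    R.reflect.HasEdgeLeft (-y, -x) ↔ R.HasEdgeUp (x, y) := by
  simp only [HasEdgeLeft, HasEdgeUp, reflect_left, reflect_right, reflect_bottom, reflect_top,
    neg_inj, neg_le_neg_iff, neg_lt_neg_iff]
  exact exists_congr fun i => by tauto

theorem reflect_hasEdgeRight {R : Rectangulation n} {x y : ℝ} :
    R.reflect.HasEdgeRight (-y, -x) ↔ R.HasEdgeDown (x, y) := by
  simp only [HasEdgeRight, HasEdgeDown, reflect_left, reflect_right, reflect_bottom, reflect_top,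
    neg_inj, neg_le_neg_iff, neg_lt_neg_iff]
  exact exists_congr fun i => by tauto

theorem reflect_hasEdgeUp {R : Rectangulation n} {x y : ℝ} :
    R.reflect.HasEdgeUp (-y, -x) ↔ R.HasEdgeLeft (x, y) := by
  have := reflect_hasEdgeLeft (R := R.reflect) (x := -y) (y := -x)
  simp only [neg_neg, reflect_reflect] at this
  exact this.symm

theorem reflect_hasEdgeDown {R : Rectangulation n} {x y : ℝ} :
    R.reflect.HasEdgeDown (-y, -x) ↔ R.HasEdgeRight (x, y) := by
  have := reflect_hasEdgeRight (R := R.reflect) (x := -y) (y := -x)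
  simp only [neg_neg, reflect_reflect] at this
  exact this.symm

theorem reflect_isRightT {R : Rectangulation n} {x y : ℝ} :
    R.reflect.IsRightT (-y, -x) ↔ R.IsBottomT (x, y) := by
  unfold IsRightT IsBottomT
  rw [reflect_hasEdgeLeft, reflect_hasEdgeRight, reflect_hasEdgeUp, reflect_hasEdgeDown]

/-- The first case in the definition of a deletion. -/
def IsVertDeletion (D : Rectangulation (n + 1)) (E : Rectangulation n) : Prop :=
  D.TouchesBottom (Fin.last n) ∧ D.TouchesRight (Fin.last n) ∧ E.outer = D.outer ∧
  D.IsRightT ((D.rect (Fin.last n)).left, (D.rect (Fin.last n)).top) ∧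
      ∀ i : Fin n,
        (E.rect i).left = (D.rect i.castSucc).left ∧
        (E.rect i).right = (D.rect i.castSucc).right ∧
        (E.rect i).top = (D.rect i.castSucc).top ∧
        (D.IsBelow (Fin.last n) i.castSucc → (E.rect i).bottom = D.outer.bottom) ∧
        (¬ D.IsBelow (Fin.last n) i.castSucc → (E.rect i).bottom = (D.rect i.castSucc).bottom)

theorem isDeletion_iff {D : Rectangulation (n + 1)} {E : Rectangulation n} :
    D.IsDeletion E ↔ D.IsVertDeletion E ∨ D.reflect.IsVertDeletion E.reflect := by
  have ho : E.reflect.outer = D.reflect.outer ↔ E.outer = D.outer := by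
    constructor
    · intro h
      have := congrArg Rect.reflect h
      rwa [show D.reflect.outer = D.outer.reflect from rfl, show E.reflect.outer = E.outer.reflect
        from rfl, Rect.reflect_reflect, Rect.reflect_reflect] at this
    · exact fun h => congrArg Rect.reflect h
  simp only [IsVertDeletion, IsDeletion, ho, reflect_left, reflect_right, reflect_bottom,
    reflect_top, reflect_isRightT, reflect_isBelow, reflect_touchesBottom, reflect_touchesRight,
    reflect_outer_bottom, neg_inj]
  constructor
  · rintro ⟨h1, h2, h3, h | ⟨h, h'⟩⟩
    · exact Or.inl ⟨h1, h2, h3, h⟩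
    · exact Or.inr ⟨h2, h1, h3, h, fun i => ⟨(h' i).2.2.1, (h' i).2.1, (h' i).1, (h' i).2.2.2⟩⟩
  · rintro (⟨h1, h2, h3, h⟩ | ⟨h1, h2, h3, h, h'⟩)
    · exact ⟨h1, h2, h3, Or.inl h⟩
    · exact ⟨h2, h1, h3,
        Or.inr ⟨h, fun i => ⟨(h' i).2.2.1, (h' i).2.1, (h' i).1, (h' i).2.2.2⟩⟩⟩

/-- Here `i` and `j` are the rectangles north-east and north-west of the top-left corner of the
deleted rectangle, or `j = i` on the left boundary. Shape ⊢ has no edge to the left, so the left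
side of `i` is flush with that corner and `j` extends past its height. -/
theorem IsVertDeletion.exists_vertInsert {D : Rectangulation (n + 1)} {E : Rectangulation n}
    (h : D.IsVertDeletion E) :
    ∃ i j, E.VertInsert D (D.rect (Fin.last n)).left (D.rect (Fin.last n)).top i j := by
  obtain ⟨hb, hr, ho, ⟨⟨u, -, hu1, hu2⟩, -, -, hleft⟩, hE⟩ := h
  have hb' := hb
  have hr' := hr
  unfold TouchesBottom at hb'
  unfold TouchesRight at hr'
  have rl := D.left_lt_right (Fin.last n)
  have rb := D.bottom_lt_top (Fin.last n)
  have noleft : ∀ a, (D.rect a).left < (D.rect (Fin.last n)).left →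
      (D.rect (Fin.last n)).left ≤ (D.rect a).right →
      (D.rect a).bottom ≠ (D.rect (Fin.last n)).top := fun a h1 h2 h3 =>
    hleft ⟨a, Or.inl h3.symm, h1, h2⟩
  have hlast : ∀ a : Fin n, a.castSucc ≠ Fin.last n := fun a => (Fin.castSucc_lt_last a).ne
  obtain ⟨i, ⟨i1, i2⟩, i3, i4⟩ := D.exists_northeast (D.outer_left_le (Fin.last n))
    (rl.trans_le (D.right_le_outer _)) (hb'.symm.le.trans rb.le) (hu2.trans_le (D.top_le_outer u))
  induction i using Fin.lastCases with
  | last => exact (lt_irrefl _ i4).elim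
  | cast i =>
  have ir := D.right_le_outer i.castSucc
  have ib : (D.rect i.castSucc).bottom = (D.rect (Fin.last n)).top := by
    rcases i3.eq_or_lt with e | e
    · exact e
    · exact (hlast i (D.eq_of_lt (by linarith) (by linarith) (by linarith) (by linarith))).elim
  have il : (D.rect i.castSucc).left = (D.rect (Fin.last n)).left := by
    rcases i1.eq_or_lt with e | e
    · exact e
    · exact (noleft _ e i2.le ib).elim
  have hri : D.IsBelow (Fin.last n) i.castSucc := ⟨ib.symm, by linarith, by linarith⟩
  have hEi : (E.rect i).bottom = E.outer.bottom := by rw [(hE i).2.2.2.1 hri, ho]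
  have htop : D.outer.bottom < (D.rect (Fin.last n)).top := by linarith
  have ins : E.IsInsertionAt D
      (.vert (D.rect (Fin.last n)).left (D.rect (Fin.last n)).top) := by
    refine ⟨ho.symm, rfl, rfl, hb, hr, fun a => ?_⟩
    obtain ⟨a1, a2, a3, a4, a5⟩ := hE a
    have la := D.left_lt_right a.castSucc
    have ba := D.bottom_lt_top a.castSucc
    have ra := D.right_le_outer a.castSucc
    refine ⟨a1.symm, a2.symm, a3.symm, ?_, ?_⟩
    · rintro ⟨c1, c2⟩
      by_cases hc : D.IsBelow (Fin.last n) a.castSucc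
      · exact hc.1.symm
      · unfold TouchesBottom at c1
        rw [a5 hc, ho] at c1
        rw [a1] at c2
        exact (hlast a (D.eq_of_lt (by linarith) (by linarith) (by linarith) (by linarith))).elim
    · intro hc
      by_cases hc' : D.IsBelow (Fin.last n) a.castSucc
      · refine (hc ⟨(a4 hc').trans (by rw [ho]), ?_⟩).elim
        rw [a1]
        by_contra! hlt
        exact noleft _ hlt hc'.2.1.le hc'.1.symm
      · exact (a5 hc').symm
  have hv : E.TouchesBottom i := hEi
  have il' : (E.rect i).left = (D.rect (Fin.last n)).left := by rw [(hE i).1, il]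
  have ib' : (E.rect i).bottom < (D.rect (Fin.last n)).top := by rw [hEi, ho]; exact htop
  have it' : (D.rect (Fin.last n)).top < (E.rect i).top := by rw [(hE i).2.2.1]; exact i4
  rcases (D.outer_left_le (Fin.last n)).eq_or_lt with hL | hL
  · exact ⟨i, i, ⟨hv, il', ⟨ib', it'⟩, ⟨ib', it'⟩, Or.inr ⟨rfl, by rw [ho, hL]⟩⟩, ins⟩
  · obtain ⟨j, ⟨j1, j2⟩, j3, j4⟩ := D.exists_northwest hL (rl.le.trans (D.right_le_outer _))
      htop.le (i4.trans_le (D.top_le_outer _))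
    induction j using Fin.lastCases with
    | last => exact (lt_irrefl _ j1).elim
    | cast j =>
    have jr : (D.rect j.castSucc).right = (D.rect (Fin.last n)).left := by
      rcases j2.eq_or_lt with e | e
      · exact e.symm
      · have := D.eq_of_lt (i := j.castSucc) (j := i.castSucc) (by linarith) (by linarith)
          (by linarith) (by linarith)
        rw [this] at j1
        linarith
    have hnj : ¬ D.IsBelow (Fin.last n) j.castSucc := fun hc => by linarith [hc.2.1]
    refine ⟨i, j, ⟨hv, il', ⟨ib', it'⟩, ⟨?_, ?_⟩, Or.inl ?_⟩, ins⟩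
    · rw [(hE j).2.2.2.2 hnj]
      exact lt_of_le_of_ne j3 (noleft _ j1 jr.ge)
    · rw [(hE j).2.2.1]; exact j4
    · rw [(hE j).2.1, jr]

theorem VertInsert.isVertDeletion {E : Rectangulation n} {D : Rectangulation (n + 1)} {x y : ℝ}
    {i j : Fin n} (h : E.VertInsert D x y i j) : D.IsVertDeletion E := by
  obtain ⟨h1, h2, ⟨h3, h4⟩, ⟨h5, h6⟩, h7⟩ := h.vertAt
  have hy := h.outer_bottom_lt
  have hx := h.lt_outer_right
  have hcut := h.bottom_of_cut h1 h2.ge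
  refine ⟨h.2.2.2.2.1, h.2.2.2.2.2.1, h.outer_eq.symm, ⟨?_, ?_, ?_, ?_⟩, fun a => ?_⟩
  · refine ⟨i.castSucc, Or.inl ?_, ?_, ?_⟩ <;>
      simp only [h.left_last, h.top_last, h.left_eq, h.top_eq, h2, hcut, le_refl, h4]
  · exact ⟨Fin.last n, Or.inl rfl, D.bottom_lt_top _, le_rfl⟩
  · exact ⟨Fin.last n, Or.inr rfl, le_rfl, D.left_lt_right _⟩
  · rintro ⟨a, a1, a2, a3⟩
    simp only [h.left_last, h.top_last] at a1 a2 a3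
    have ba := D.bottom_lt_top a
    rcases h7 with h7 | ⟨-, h7⟩
    · have jb : (D.rect j.castSucc).bottom = (E.rect j).bottom :=
        h.bottom_of_not_cut fun hc => by linarith [hc.2, E.left_lt_right j]
      have jt := h.top_eq j
      have jr := h.right_eq j
      have jl := D.left_lt_right j.castSucc
      obtain rfl : a = j.castSucc := by
        apply D.eq_of_lt <;> first | linarith | (rcases a1 with a1 | a1 <;> linarith)
      rcases a1 with a1 | a1 <;> linarith
    · have := D.outer_left_le a
      rw [h.outer_eq] at this
      linarith
  · refine ⟨(h.left_eq a).symm, (h.right_eq a).symm, (h.top_eq a).symm, fun hc => ?_,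
      fun hc => ?_⟩
    · rw [h.outer_eq]
      exact (h.isBelow_last_iff.1 hc).1
    · rw [h.isBelow_last_iff] at hc
      exact (h.bottom_of_not_cut hc).symm

theorem isDeletion_iff_insert {D : Rectangulation (n + 1)} {E : Rectangulation n} :
    D.IsDeletion E ↔ ∃ q c, E.Insert D q c := by
  have key : ∀ {q c}, E.reflect.Insert D.reflect q c → ∃ q c, E.Insert D q c := fun {q c} h =>
    ⟨q.reflect, flipCode c, by
      rwa [← insert_reflect, InsPoint.reflect_reflect, flipCode_flipCode]⟩
  rw [isDeletion_iff]
  constructor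
  · rintro (h | h)
    · obtain ⟨i, j, h⟩ := h.exists_vertInsert
      exact ⟨.vert _ _, (true, i, j), h.1, h.2⟩
    · obtain ⟨i, j, h⟩ := h.exists_vertInsert
      exact key (q := .vert _ _) (c := (true, i, j)) ⟨h.1, h.2⟩
  · rintro ⟨q, ⟨b, i, j⟩, h⟩
    cases b with
    | true =>
      obtain ⟨x, y, h⟩ := h.vertInsert
      exact Or.inl h.isVertDeletion
    | false =>
      obtain ⟨x, y, h⟩ := h.vertInsert_reflect
      exact Or.inr h.isVertDeletion

end Rectangulation

/-! ### Existence of deletions and insertions -/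

namespace Rectangulation

variable {n : ℕ}

/-- The corner always has edges going down and right. A further edge up or left exists because the
rectangle is not the whole drawing; if both existed, the rectangles in the four quadrants would form
a cross. -/
theorem isRightT_or_isBottomT {D : Rectangulation (n + 1)} (hn : 1 ≤ n)
    (hb : D.TouchesBottom (Fin.last n)) (hr : D.TouchesRight (Fin.last n)) :
    D.IsRightT ((D.rect (Fin.last n)).left, (D.rect (Fin.last n)).top) ∨
      D.IsBottomT ((D.rect (Fin.last n)).left, (D.rect (Fin.last n)).top) := by
  have hb' := hb
  have hr' := hr
  unfold TouchesBottom at hb'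
  unfold TouchesRight at hr'
  set r := Fin.last n with hrdef
  have rl := D.left_lt_right r
  have rb := D.bottom_lt_top r
  have hdown : D.HasEdgeDown ((D.rect r).left, (D.rect r).top) := ⟨r, Or.inl rfl, rb, le_rfl⟩
  have hright : D.HasEdgeRight ((D.rect r).left, (D.rect r).top) := ⟨r, Or.inr rfl, le_rfl, rl⟩
  have hor : D.HasEdgeUp ((D.rect r).left, (D.rect r).top) ∨
      D.HasEdgeLeft ((D.rect r).left, (D.rect r).top) := by
    rcases (D.top_le_outer r).eq_or_lt with ht | ht
    · rcases (D.outer_left_le r).eq_or_lt with hl | hl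
      · exfalso
        -- A second rectangle, which exists by `1 ≤ n`; here `r` would fill the outer rectangle and
        -- overlap it.
        let z : Fin (n + 1) := ⟨0, by omega⟩
        have hz : z ≠ r := by
          intro h
          have := congrArg Fin.val h
          simp only [z, hrdef, Fin.val_last] at this
          omega
        refine hz (D.eq_of_lt ?_ ?_ ?_ ?_) <;>
          linarith [D.outer_left_le z, D.right_le_outer z, D.outer_bottom_le z,
            D.top_le_outer z, D.left_lt_right z, D.bottom_lt_top z]
      · right
        obtain ⟨s, ⟨s1, s2⟩, s3, s4⟩ := D.exists_southwest hl
          (rl.le.trans (D.right_le_outer r)) (by linarith) (D.top_le_outer r)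
        exact ⟨s, Or.inr (le_antisymm s4 (by linarith [D.top_le_outer s])), s1, s2⟩
    · obtain ⟨p, ⟨p1, p2⟩, p3, p4⟩ := D.exists_northeast (D.outer_left_le r)
        (rl.trans_le (D.right_le_outer r)) (by linarith) ht
      rcases p1.eq_or_lt with e | e
      · exact Or.inl ⟨p, Or.inl e.symm, p3, p4⟩
      · rcases p3.eq_or_lt with e' | e'
        · exact Or.inr ⟨p, Or.inl e'.symm, e, p2.le⟩
        · obtain rfl := D.eq_of_lt (i := p) (j := r) (by linarith) (by linarith) (by linarith)
            (by linarith)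
          exact (lt_irrefl _ p4).elim
  have hnot : ¬ (D.HasEdgeUp ((D.rect r).left, (D.rect r).top) ∧
      D.HasEdgeLeft ((D.rect r).left, (D.rect r).top)) := by
    rintro ⟨⟨k, k1, k2, k3⟩, ⟨m, m1, m2, m3⟩⟩
    simp only at k1 k2 k3 m1 m2 m3
    have hL := (D.outer_left_le m).trans_lt m2
    have hT := k3.trans_le (D.top_le_outer k)
    have km := D.left_lt_right k
    have mm := D.bottom_lt_top m
    -- The upward edge prevents any rectangle from crossing it horizontally; `hm` is the analogue
    -- for the left edge. Hence all four quadrant rectangles have a corner at the point.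
    have hk : ∀ a, (D.rect a).left < (D.rect r).left → (D.rect r).left < (D.rect a).right →
        (D.rect a).bottom ≤ (D.rect r).top → (D.rect r).top < (D.rect a).top → False := by
      intro a a1 a2 a3 a4
      obtain rfl := D.eq_of_lt (i := a) (j := k) (by rcases k1 with h | h <;> linarith)
        (by rcases k1 with h | h <;> linarith) (by linarith) (by linarith)
      rcases k1 with h | h <;> linarith
    have hm : ∀ a, (D.rect a).left < (D.rect r).left → (D.rect r).left ≤ (D.rect a).right →
        (D.rect a).bottom < (D.rect r).top → (D.rect r).top < (D.rect a).top → False := by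
      intro a a1 a2 a3 a4
      obtain rfl := D.eq_of_lt (i := a) (j := m) (by linarith) (by linarith)
        (by rcases m1 with h | h <;> linarith) (by rcases m1 with h | h <;> linarith)
      rcases m1 with h | h <;> linarith
    obtain ⟨p, ⟨p1, p2⟩, p3, p4⟩ := D.exists_northeast (D.outer_left_le r)
        (rl.trans_le (D.right_le_outer r)) (by linarith) hT
    obtain ⟨q, ⟨q1, q2⟩, q3, q4⟩ := D.exists_northwest hL
        (rl.le.trans (D.right_le_outer r)) (by linarith) hT
    obtain ⟨s, ⟨s1, s2⟩, s3, s4⟩ := D.exists_southwest hL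
        (rl.le.trans (D.right_le_outer r)) (by linarith) hT.le
    have sr : (D.rect s).right = (D.rect r).left := by
      rcases s2.eq_or_lt with e | e
      · exact e.symm
      · obtain rfl := D.eq_of_lt (i := s) (j := r) (by linarith) (by linarith) (by linarith)
          (by linarith)
        exact (lt_irrefl _ s1).elim
    have st : (D.rect s).top = (D.rect r).top := by
      rcases s4.eq_or_lt with e | e
      · exact e.symm
      · exact (hm s s1 s2 s3 e).elim
    have qr : (D.rect q).right = (D.rect r).left := by
      rcases q2.eq_or_lt with e | e
      · exact e.symm
      · exact (hk q q1 e q3 q4).elim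
    have qb : (D.rect q).bottom = (D.rect r).top := by
      rcases q3.eq_or_lt with e | e
      · exact e
      · exact (hm q q1 q2 e q4).elim
    have pl : (D.rect p).left = (D.rect r).left := by
      rcases p1.eq_or_lt with e | e
      · exact e
      · exact (hk p e p2 p3 p4).elim
    have pb : (D.rect p).bottom = (D.rect r).top := by
      rcases p3.eq_or_lt with e | e
      · exact e
      · obtain rfl := D.eq_of_lt (i := p) (j := r) (by linarith) (by linarith) (by linarith)
          (by linarith)
        exact (lt_irrefl _ p4).elim
    exact D.not_isCross ((D.rect r).left, (D.rect r).top)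
      ⟨⟨s, sr, st⟩, ⟨r, rfl, rfl⟩, ⟨q, qr, qb⟩, ⟨p, pl, pb⟩⟩
  unfold IsRightT IsBottomT
  tauto

/-- Shape ⊢ means that no rectangle resting on the deleted one overhangs its left side, so extending
these rectangles downwards fills exactly the freed area. -/
theorem exists_isVertDeletion {D : Rectangulation (n + 1)} (hb : D.TouchesBottom (Fin.last n))
    (hr : D.TouchesRight (Fin.last n))
    (hT : D.IsRightT ((D.rect (Fin.last n)).left, (D.rect (Fin.last n)).top)) :
    ∃ E, D.IsVertDeletion E := by
  classical
  obtain ⟨⟨u, -, hu1, hu2⟩, -, -, hleft⟩ := id hT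
  simp only at hu1 hu2
  have hb' := hb
  have hr' := hr
  unfold TouchesBottom at hb'
  unfold TouchesRight at hr'
  have rl := D.left_lt_right (Fin.last n)
  have rb := D.bottom_lt_top (Fin.last n)
  have ut := D.top_le_outer u
  have hne : ∀ a : Fin n, a.castSucc ≠ Fin.last n := fun a => (Fin.castSucc_lt_last a).ne
  have noleft : ∀ a, D.IsBelow (Fin.last n) a → (D.rect (Fin.last n)).left ≤ (D.rect a).left := by
    intro a ha
    by_contra! hlt
    exact hleft ⟨a, Or.inl ha.1, hlt, ha.2.1.le⟩
  let r : Fin n → Rect := fun a =>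
    ⟨(D.rect a.castSucc).left, (D.rect a.castSucc).right,
      if D.IsBelow (Fin.last n) a.castSucc then D.outer.bottom else (D.rect a.castSucc).bottom,
      (D.rect a.castSucc).top, D.left_lt_right _, by
        split_ifs
        · exact (D.outer_bottom_le _).trans_lt (D.bottom_lt_top _)
        · exact D.bottom_lt_top _⟩
  have rbot : ∀ a, D.IsBelow (Fin.last n) a.castSucc → (r a).bottom = D.outer.bottom :=
    fun a ha => if_pos ha
  have rbot' : ∀ a, ¬ D.IsBelow (Fin.last n) a.castSucc →
      (r a).bottom = (D.rect a.castSucc).bottom :=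
    fun a ha => if_neg ha
  have rle : ∀ a, (r a).bottom ≤ (D.rect a.castSucc).bottom := by
    intro a
    by_cases ha : D.IsBelow (Fin.last n) a.castSucc
    · rw [rbot a ha]; exact D.outer_bottom_le _
    · rw [rbot' a ha]
  have rge : ∀ a, D.outer.bottom ≤ (r a).bottom := by
    intro a
    by_cases ha : D.IsBelow (Fin.last n) a.castSucc
    · rw [rbot a ha]
    · rw [rbot' a ha]; exact D.outer_bottom_le _
  have cov : ∀ p ∈ D.outer.region, ∃ i, p ∈ (r i).region := by
    rintro p ⟨⟨p1, p2⟩, p3, p4⟩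
    obtain ⟨a, ⟨a1, a2⟩, a3, a4⟩ := D.exists_mem_region p1 p2 p3 p4
    induction a using Fin.lastCases with
    | cast a => exact ⟨a, ⟨a1, a2⟩, (rle a).trans a3, a4⟩
    | last =>
      obtain ⟨m, ⟨m1, m2⟩, m3, m4, m5, m6⟩ : ∃ m, ((D.rect m).left ≤ p.1 ∧ p.1 ≤ (D.rect m).right) ∧
          (D.rect m).bottom ≤ (D.rect (Fin.last n)).top ∧
          (D.rect (Fin.last n)).top < (D.rect m).top ∧
          (D.rect (Fin.last n)).left < (D.rect m).right ∧
          (D.rect m).left < (D.rect (Fin.last n)).right := by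
        -- On the right boundary nothing lies further to the right, so there the covering rectangle
        -- is found from the left.
        rcases p2.eq_or_lt with e | e
        · obtain ⟨m, ⟨m1, m2⟩, m3, m4⟩ := D.exists_northwest
            (D.outer.left_lt_right) le_rfl (y := (D.rect (Fin.last n)).top) (by linarith)
            (by linarith)
          exact ⟨m, ⟨by linarith, by linarith⟩, m3, m4, by linarith, by linarith⟩
        · obtain ⟨m, ⟨m1, m2⟩, m3, m4⟩ := D.exists_northeast
            p1 e (y := (D.rect (Fin.last n)).top) (by linarith) (by linarith)
          exact ⟨m, ⟨by linarith, by linarith⟩, m3, m4, by linarith, by linarith⟩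
      induction m using Fin.lastCases with
      | last => exact (lt_irrefl _ m4).elim
      | cast m =>
      have hm : D.IsBelow (Fin.last n) m.castSucc := by
        refine ⟨?_, m5, m6⟩
        rcases m3.eq_or_lt with e | e
        · exact e.symm
        · exact (hne m (D.eq_of_lt (by linarith) (by linarith) (by linarith) (by linarith))).elim
      exact ⟨m, ⟨m1, m2⟩, by rw [rbot m hm]; exact p3, a4.trans m4.le⟩
  have disj : ∀ i j, i ≠ j → ¬ (r i).Overlap (r j) := by
    have key : ∀ i j, i ≠ j → D.IsBelow (Fin.last n) i.castSucc →
        ¬ D.IsBelow (Fin.last n) j.castSucc → ¬ (r i).Overlap (r j) := by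
      rintro i j hij hi hj ⟨⟨h1, h2⟩, h3, h4⟩
      rw [rbot' j hj] at h4
      rw [rbot i hi] at h3
      simp only [r] at h1 h2 h3 h4
      have hl := noleft _ hi
      have := D.left_lt_right j.castSucc
      have := D.right_le_outer j.castSucc
      have := D.bottom_lt_top j.castSucc
      rcases le_or_gt (D.rect j.castSucc).top (D.rect (Fin.last n)).top with ht | ht
      · exact hne j (D.eq_of_lt (by linarith) (by linarith) (by linarith) (by linarith))
      · exact hij (Fin.castSucc_injective _
          (D.eq_of_lt h1 h2 (by linarith [hi.1]) h4))
    intro i j hij h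
    by_cases hi : D.IsBelow (Fin.last n) i.castSucc <;>
      by_cases hj : D.IsBelow (Fin.last n) j.castSucc
    · obtain ⟨⟨h1, h2⟩, h3, h4⟩ := h
      have := D.bottom_lt_top i.castSucc
      have := D.bottom_lt_top j.castSucc
      exact hij (Fin.castSucc_injective _ (D.eq_of_lt h1 h2 (by linarith [hi.1, hj.1])
        (by linarith [hi.1, hj.1])))
    · exact key i j hij hi hj h
    · exact key j i hij.symm hj hi ⟨⟨h.1.2, h.1.1⟩, h.2.2, h.2.1⟩
    · obtain ⟨⟨h1, h2⟩, h3, h4⟩ := h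
      rw [rbot' i hi] at h3
      rw [rbot' j hj] at h4
      exact hij (Fin.castSucc_injective _ (D.eq_of_lt h1 h2 h3 h4))
  have cross : ∀ p, ¬ IsCross r p := by
    rintro p ⟨⟨a, a1, a2⟩, ⟨b, b1, b2⟩, ⟨c, c1, c2⟩, ⟨d, d1, d2⟩⟩
    -- A cross lies above the outer bottom, so its two upper rectangles were not extended and it is
    -- already a cross in `D`.
    have hlt := (rge a).trans_lt (r a).bottom_lt_top
    have hc : ¬ D.IsBelow (Fin.last n) c.castSucc := fun h => by linarith [rbot c h]
    have hd : ¬ D.IsBelow (Fin.last n) d.castSucc := fun h => by linarith [rbot d h]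
    rw [rbot' c hc] at c2
    rw [rbot' d hd] at d2
    exact D.not_isCross p ⟨⟨_, a1, a2⟩, ⟨_, b1, b2⟩, ⟨_, c1, c2⟩, ⟨_, d1, d2⟩⟩
  refine ⟨ofRects D.outer r (fun a => ⟨(D.bounds a.castSucc).1, rge a, D.top_le_outer _⟩)
    cov disj cross, hb, hr, rfl, hT, fun a => ⟨rfl, rfl, rfl, rbot a, rbot' a⟩⟩

theorem exists_isDeletion {D : Rectangulation (n + 1)} (hn : 1 ≤ n)
    (hb : D.TouchesBottom (Fin.last n)) (hr : D.TouchesRight (Fin.last n)) :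
    ∃ E, D.IsDeletion E := by
  rcases isRightT_or_isBottomT hn hb hr with h | h
  · obtain ⟨E, hE⟩ := exists_isVertDeletion hb hr h
    exact ⟨E, isDeletion_iff.2 (Or.inl hE)⟩
  · obtain ⟨E, hE⟩ := exists_isVertDeletion (D := D.reflect) (reflect_touchesBottom.2 hr)
      (reflect_touchesRight.2 hb) (reflect_isRightT.2 h)
    refine ⟨E.reflect, isDeletion_iff.2 (Or.inr ?_)⟩
    rwa [reflect_reflect]

/-- The only obstruction to an insertion in a fixed drawing is a rectangle on the bottom boundary,
right of `x`, that is too low to be cut at height `y`; `htop` excludes this. -/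
theorem exists_vertInsert_of_lt_top {E : Rectangulation n} {x y : ℝ} {i j : Fin n}
    (h : E.VertAt x y i j)
    (htop : ∀ a, E.TouchesBottom a → x ≤ (E.rect a).left → y < (E.rect a).top) :
    ∃ D, E.VertInsert D x y i j := by
  classical
  obtain ⟨h1, h2, ⟨h3, h4⟩, ⟨h5, h6⟩, h7⟩ := id h
  have hi1 := E.left_lt_right i
  have hi2 := E.right_le_outer i
  have hi3 := E.top_le_outer i
  have hi4 := E.outer_left_le i
  have h1' := h1
  unfold TouchesBottom at h1'
  let r : Fin (n + 1) → Rect := Fin.lastCases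
    ⟨x, E.outer.right, E.outer.bottom, y, by linarith, by linarith⟩
    (fun a => ⟨(E.rect a).left, (E.rect a).right,
      if E.TouchesBottom a ∧ x ≤ (E.rect a).left then y else (E.rect a).bottom,
      (E.rect a).top, E.left_lt_right _, by
        split_ifs with hc
        · exact htop a hc.1 hc.2
        · exact E.bottom_lt_top _⟩)
  have rlast : r (Fin.last n) = ⟨x, E.outer.right, E.outer.bottom, y, by linarith, by linarith⟩ :=
    Fin.lastCases_last
  have rcast : ∀ a : Fin n, (r a.castSucc).left = (E.rect a).left ∧
      (r a.castSucc).right = (E.rect a).right ∧ (r a.castSucc).top = (E.rect a).top ∧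
      (r a.castSucc).bottom =
        if E.TouchesBottom a ∧ x ≤ (E.rect a).left then y else (E.rect a).bottom := by
    intro a
    simp only [r, Fin.lastCases_castSucc, and_self]
  have rbot : ∀ a : Fin n, E.TouchesBottom a ∧ x ≤ (E.rect a).left →
      (r a.castSucc).bottom = y := fun a ha => by rw [(rcast a).2.2.2, if_pos ha]
  have rbot' : ∀ a : Fin n, ¬ (E.TouchesBottom a ∧ x ≤ (E.rect a).left) →
      (r a.castSucc).bottom = (E.rect a).bottom := fun a ha => by rw [(rcast a).2.2.2, if_neg ha]
  -- The area of the new rectangle meets only rectangles that are cut: below any other candidate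
  -- there would be one on the bottom boundary, and that one reaches above `y`.
  have cut : ∀ a, x < (E.rect a).right → (E.rect a).bottom < y →
      E.TouchesBottom a ∧ x ≤ (E.rect a).left := by
    intro a a1 a2
    have e1 := E.left_lt_right a
    have e2 := E.bottom_lt_top a
    have e3 := E.right_le_outer a
    have e4 := E.outer_bottom_le a
    rcases lt_or_ge (E.rect a).left x with hlt | hge
    · obtain rfl := E.eq_of_lt (i := a) (j := i) (by linarith) (by linarith) (by linarith)
        (by linarith)
      linarith
    · refine ⟨?_, hge⟩
      obtain ⟨b, ⟨b1, b2⟩, b3, b4⟩ := E.exists_northeast (E.outer_left_le a) (by linarith)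
        le_rfl (E.outer.bottom_lt_top)
      have hb : E.TouchesBottom b := le_antisymm b3 (E.outer_bottom_le b)
      have hbl : x ≤ (E.rect b).left := by
        by_contra! hlt
        obtain rfl := E.eq_of_lt (i := b) (j := i) (by linarith) (by linarith) (by linarith)
          (by linarith)
        linarith
      have hbt := htop b hb hbl
      obtain rfl := E.eq_of_lt (i := a) (j := b) (by linarith) (by linarith) (by linarith)
        (by linarith)
      exact hb
  have sub : ∀ a, (E.outer.left ≤ (r a).left ∧ (r a).right ≤ E.outer.right) ∧
      E.outer.bottom ≤ (r a).bottom ∧ (r a).top ≤ E.outer.top := by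
    intro a
    induction a using Fin.lastCases with
    | last =>
      rw [rlast]
      exact ⟨⟨by simp only; linarith, le_rfl⟩, le_rfl, by simp only; linarith⟩
    | cast a =>
      rw [(rcast a).1, (rcast a).2.1, (rcast a).2.2.1]
      refine ⟨(E.bounds a).1, ?_, E.top_le_outer a⟩
      by_cases hc : E.TouchesBottom a ∧ x ≤ (E.rect a).left
      · rw [rbot a hc]; linarith
      · rw [rbot' a hc]; exact E.outer_bottom_le a
  have cov : ∀ p ∈ E.outer.region, ∃ i, p ∈ (r i).region := by
    rintro p ⟨⟨p1, p2⟩, p3, p4⟩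
    by_cases hp : x ≤ p.1 ∧ p.2 ≤ y
    · exact ⟨Fin.last n, by rw [rlast]; exact ⟨⟨hp.1, p2⟩, p3, hp.2⟩⟩
    · obtain ⟨a, ⟨a1, a2⟩, a3, a4⟩ := E.exists_mem_region p1 p2 p3 p4
      refine ⟨a.castSucc, ?_⟩
      rw [Rect.mem_region, (rcast a).1, (rcast a).2.1, (rcast a).2.2.1]
      refine ⟨⟨a1, a2⟩, ?_, a4⟩
      by_cases hc : E.TouchesBottom a ∧ x ≤ (E.rect a).left
      · rw [rbot a hc]
        by_contra! hlt
        exact hp ⟨hc.2.trans a1, hlt.le⟩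
      · rw [rbot' a hc]; exact a3
  have disj : ∀ i j, i ≠ j → ¬ (r i).Overlap (r j) := by
    have key : ∀ a : Fin n, ¬ (r (Fin.last n)).Overlap (r a.castSucc) := by
      rintro a ⟨⟨g1, g2⟩, g3, g4⟩
      rw [rlast, (rcast a).2.1] at g1
      rw [rlast] at g4
      simp only at g1 g4
      by_cases hc : E.TouchesBottom a ∧ x ≤ (E.rect a).left
      · rw [rbot a hc] at g4; exact lt_irrefl _ g4
      · rw [rbot' a hc] at g4; exact hc (cut a g1 g4)
    intro a b hab g
    induction a using Fin.lastCases with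
    | last =>
      induction b using Fin.lastCases with
      | last => exact hab rfl
      | cast b => exact key b g
    | cast a =>
      induction b using Fin.lastCases with
      | last => exact key a ⟨⟨g.1.2, g.1.1⟩, g.2.2, g.2.1⟩
      | cast b =>
        obtain ⟨⟨g1, g2⟩, g3, g4⟩ := g
        have le : ∀ c : Fin n, (E.rect c).bottom ≤ (r c.castSucc).bottom := by
          intro c
          by_cases hc : E.TouchesBottom c ∧ x ≤ (E.rect c).left
          · have := hc.1
            unfold TouchesBottom at this
            rw [rbot c hc]; linarith
          · rw [rbot' c hc]
        rw [(rcast a).1, (rcast b).2.1] at g1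
        rw [(rcast b).1, (rcast a).2.1] at g2
        rw [(rcast b).2.2.1] at g3
        rw [(rcast a).2.2.1] at g4
        exact hab (congrArg _ (E.eq_of_lt g1 g2 ((le a).trans_lt g3) ((le b).trans_lt g4)))
  have cross : ∀ p, ¬ IsCross r p := by
    rintro p ⟨⟨a, a1, a2⟩, ⟨b, b1, b2⟩, ⟨c, c1, c2⟩, ⟨d, d1, d2⟩⟩
    have hbR := (sub b).1.2
    have hbl := (r b).left_lt_right
    have hab := (sub a).2.1
    have hat := (r a).bottom_lt_top
    induction a using Fin.lastCases with
    | last => rw [rlast] at a1; simp only at a1; linarith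
    | cast a =>
    induction c using Fin.lastCases with
    | last => rw [rlast] at c2; simp only at c2; linarith
    | cast c =>
    induction d using Fin.lastCases with
    | last => rw [rlast] at d2; simp only at d2; linarith
    | cast d =>
    rw [(rcast a).2.1] at a1
    rw [(rcast a).2.2.1] at a2 hat
    have hvert : ¬ (p.1 = x ∧ p.2 = y) := by
      rintro ⟨e1, e2⟩
      exact h.not_isVertex ⟨a, Or.inr (by simp only; linarith), Or.inr (by simp only; linarith)⟩
    -- The south-west rectangle of a cross on the new top side would be cut at `y` and at the same
    -- time end at `y`.
    have hright : p.2 = y → ¬ x < p.1 := by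
      intro e hlt
      have := cut a (by linarith) (by linarith [E.bottom_lt_top a])
      rw [rbot a this] at hat
      linarith
    induction b using Fin.lastCases with
    | last => rw [rlast] at b1 b2; exact hvert ⟨b1.symm, b2.symm⟩
    | cast b =>
    rw [(rcast b).1] at b1
    rw [(rcast b).2.2.1] at b2
    rw [(rcast c).2.1] at c1
    rw [(rcast d).1] at d1
    have hc : ¬ (E.TouchesBottom c ∧ x ≤ (E.rect c).left) := by
      intro hc
      rw [rbot c hc] at c2
      exact hright c2.symm (by linarith [hc.2, E.left_lt_right c])
    have hd : ¬ (E.TouchesBottom d ∧ x ≤ (E.rect d).left) := by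
      intro hd
      rw [rbot d hd] at d2
      rcases hd.2.eq_or_lt with e | e
      · exact hvert ⟨by linarith, d2.symm⟩
      · exact hright d2.symm (by linarith)
    rw [rbot' c hc] at c2
    rw [rbot' d hd] at d2
    exact E.not_isCross p ⟨⟨_, a1, a2⟩, ⟨_, b1, b2⟩, ⟨_, c1, c2⟩, ⟨_, d1, d2⟩⟩
  refine ⟨ofRects E.outer r sub cov disj cross, h, rfl, ?_, ?_, ?_, ?_, fun a =>
    ⟨(rcast a).1, (rcast a).2.1, (rcast a).2.2.1, rbot a, rbot' a⟩⟩
  · change (r (Fin.last n)).left = x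
    rw [rlast]
  · change (r (Fin.last n)).top = y
    rw [rlast]
  · change (r (Fin.last n)).bottom = E.outer.bottom
    rw [rlast]
  · change (r (Fin.last n)).right = E.outer.right
    rw [rlast]

/-! ### Deforming a drawing to make room for an insertion -/

/-- The map that contracts the interval `[b, y)` towards `b` by the factor `s`. -/
noncomputable def squeeze (b s y c : ℝ) : ℝ := if c < y then b + (c - b) * s else c

theorem squeeze_of_le {b s y c : ℝ} (h : y ≤ c) : squeeze b s y c = c := if_neg h.not_gt

theorem squeeze_of_lt {b s y c : ℝ} (h : c < y) : squeeze b s y c = b + (c - b) * s := if_pos h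

theorem squeeze_le {b s y c : ℝ} (hs : s < 1) (hc : b ≤ c) : squeeze b s y c ≤ c := by
  unfold squeeze
  split_ifs
  · nlinarith
  · exact le_rfl

theorem strictMonoOn_squeeze {b s y : ℝ} (hs : 0 < s) (hs' : s < 1) :
    StrictMonoOn (squeeze b s y) (Set.Ici b) := by
  intro c hc d hd hcd
  rw [Set.mem_Ici] at hc hd
  rcases lt_or_ge d y with h | h
  · rw [squeeze_of_lt h, squeeze_of_lt (hcd.trans h)]
    nlinarith
  · rw [squeeze_of_le h]
    exact (squeeze_le hs' hc).trans_lt hcd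

theorem le_squeeze {b s y c : ℝ} (hs : 0 < s) (hs' : s < 1) (hy : b < y) (hc : b ≤ c) :
    b ≤ squeeze b s y c := by
  have := (strictMonoOn_squeeze (y := y) hs hs').monotoneOn (Set.self_mem_Ici) hc hc
  rwa [squeeze_of_lt hy, sub_self, zero_mul, add_zero] at this

/-- By lowering everything to the left of a vertical insertion point, the drawing can be changed
so that a new rectangle can be inserted at this point. -/
theorem exists_sameRel_lt_top {E : Rectangulation n} {x y : ℝ} {i j : Fin n}
    (h : E.VertAt x y i j) :
    ∃ E' y', E.SameRel E' ∧ E'.VertAt x y' i j ∧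
      ∀ a, E'.TouchesBottom a → x ≤ (E'.rect a).left → y' < (E'.rect a).top := by
  classical
  obtain ⟨h1, h2, ⟨h3, h4⟩, ⟨h5, h6⟩, h7⟩ := id h
  have hil := E.left_lt_right i
  have hir := E.right_le_outer i
  have hib : (E.rect i).bottom = E.outer.bottom := h1
  have hy : E.outer.bottom < y := by linarith
  obtain ⟨ε, hε, hgap⟩ := exists_pos_gap _ E.finite_coords E.outer.bottom
  have hgap' : ∀ a, E.outer.bottom + ε < (E.rect a).top := fun a =>
    (hgap _ (E.top_mem_coords a)).1 ((E.outer_bottom_le a).trans_lt (E.bottom_lt_top a))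
  -- The strip below `y` is contracted to a height less than `ε`, while all tops are more than `ε`
  -- above the outer bottom.
  obtain ⟨s, hs, hs', hsε⟩ : ∃ s, 0 < s ∧ s < 1 ∧ (y - E.outer.bottom) * s < ε := by
    have hpos : 0 < ε + (y - E.outer.bottom) := by linarith
    refine ⟨ε / (ε + (y - E.outer.bottom)), by positivity, ?_, ?_⟩
    · rw [div_lt_one hpos]; linarith
    · rw [mul_div_assoc', div_lt_iff₀ hpos]; nlinarith
  set B := E.outer.bottom with hB
  -- This map jumps at `y`: lower heights are contracted, all others stay fixed. Rectangles starting
  -- left of `x` that straddle `y` are thereby stretched downwards.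
  let φ := squeeze B s y
  have mono : StrictMonoOn φ (Set.Ici B) := strictMonoOn_squeeze hs hs'
  have φB : φ B = B := by simp only [φ, squeeze_of_lt hy]; ring
  have φid : ∀ {c}, y ≤ c → φ c = c := fun hc => squeeze_of_le hc
  have φle : ∀ {c}, B ≤ c → φ c ≤ c := fun hc => squeeze_le hs' hc
  have hbot : ∀ a, (E.rect a).bottom ∈ Set.Ici B := fun a => E.outer_bottom_le a
  have htop : ∀ a, (E.rect a).top ∈ Set.Ici B := fun a =>
    (E.outer_bottom_le a).trans (E.bottom_lt_top a).le
  let r : Fin n → Rect := fun a =>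
    ⟨(E.rect a).left, (E.rect a).right,
      if (E.rect a).left < x then φ (E.rect a).bottom else (E.rect a).bottom,
      if (E.rect a).left < x then φ (E.rect a).top else (E.rect a).top, E.left_lt_right a, by
        split_ifs
        · exact mono (hbot a) (htop a) (E.bottom_lt_top a)
        · exact E.bottom_lt_top a⟩
  have hL : ∀ {a}, (E.rect a).left < x →
      (r a).bottom = φ (E.rect a).bottom ∧ (r a).top = φ (E.rect a).top :=
    fun ha => ⟨if_pos ha, if_pos ha⟩
  -- A rectangle that crosses the line at `x` lies above `y`, since `i` blocks this line from the
  -- bottom to beyond `y`; such a rectangle is fixed by `φ`.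
  have hR : ∀ {a}, x < (E.rect a).right →
      (r a).bottom = (E.rect a).bottom ∧ (r a).top = (E.rect a).top := by
    intro a ha
    by_cases hl : (E.rect a).left < x
    · have : y ≤ (E.rect a).bottom := by
        by_contra! hlt
        have := hbot a
        rw [Set.mem_Ici] at this
        obtain rfl := E.eq_of_lt (i := a) (j := i) (by linarith) (by linarith) (by linarith)
          (by linarith [E.bottom_lt_top a])
        linarith
      rw [(hL hl).1, (hL hl).2, φid this, φid (this.trans (E.bottom_lt_top a).le)]
      exact ⟨rfl, rfl⟩
    · exact ⟨if_neg hl, if_neg hl⟩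
  have wall : ∀ {a}, (E.rect a).left = x → a = i ∨ y < (E.rect a).bottom := by
    intro a ha
    by_contra! hcon
    refine hcon.1 (E.eq_of_lt ?_ ?_ ?_ ?_) <;>
      linarith [E.left_lt_right a, E.bottom_lt_top a, E.outer_bottom_le a]
  have wallt : ∀ {a}, (E.rect a).left = x → y < (E.rect a).top := by
    intro a ha
    rcases wall ha with rfl | h
    · exact h4
    · exact h.trans (E.bottom_lt_top a)
  -- For any two rectangles, either `φ` acts on both, or both are unchanged, or the line at `x`
  -- separates them.
  have cases3 : ∀ a b, ((E.rect a).left < x ∧ (E.rect b).left < x) ∨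
      (x < (E.rect a).right ∧ x < (E.rect b).right) ∨
      ((E.rect a).right ≤ x ∧ x ≤ (E.rect b).left) ∨
      ((E.rect b).right ≤ x ∧ x ≤ (E.rect a).left) := by
    intro a b
    have := E.left_lt_right a
    have := E.left_lt_right b
    by_cases ha : (E.rect a).left < x <;> by_cases hb : (E.rect b).left < x
    · exact Or.inl ⟨ha, hb⟩
    · by_cases ha' : x < (E.rect a).right
      · exact Or.inr (Or.inl ⟨ha', by linarith⟩)
      · exact Or.inr (Or.inr (Or.inl ⟨by linarith, by linarith⟩))
    · by_cases hb' : x < (E.rect b).right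
      · exact Or.inr (Or.inl ⟨by linarith, hb'⟩)
      · exact Or.inr (Or.inr (Or.inr ⟨by linarith, by linarith⟩))
    · exact Or.inr (Or.inl ⟨by linarith, by linarith⟩)
  have sub : ∀ a, (E.outer.left ≤ (r a).left ∧ (r a).right ≤ E.outer.right) ∧
      E.outer.bottom ≤ (r a).bottom ∧ (r a).top ≤ E.outer.top := by
    intro a
    refine ⟨(E.bounds a).1, ?_⟩
    rcases lt_or_ge (E.rect a).left x with ha | ha
    · rw [(hL ha).1, (hL ha).2]
      exact ⟨le_squeeze hs hs' hy (hbot a), (φle (htop a)).trans (E.top_le_outer a)⟩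
    · rw [(hR (ha.trans_lt (E.left_lt_right a))).1, (hR (ha.trans_lt (E.left_lt_right a))).2]
      exact (E.bounds a).2
  have cov : ∀ p ∈ E.outer.region, ∃ i, p ∈ (r i).region := by
    rintro p ⟨⟨p1, p2⟩, p3, p4⟩
    have raw : ∀ a, x < (E.rect a).right → ((E.rect a).left ≤ p.1 ∧ p.1 ≤ (E.rect a).right) ∧
        (E.rect a).bottom ≤ p.2 ∧ p.2 ≤ (E.rect a).top → ∃ i, p ∈ (r i).region := by
      rintro a ha ⟨⟨a1, a2⟩, a3, a4⟩
      exact ⟨a, ⟨a1, a2⟩, by rw [(hR ha).1]; exact a3, by rw [(hR ha).2]; exact a4⟩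
    rcases lt_trichotomy p.1 x with hp | hp | hp
    · have hpR : p.1 < E.outer.right := by linarith
      rcases p3.eq_or_lt with hpB | hpB
      · obtain ⟨a, ⟨a1, a2⟩, a3, a4⟩ := E.exists_northeast p1 hpR le_rfl E.outer.bottom_lt_top
        have ha := a1.trans_lt hp
        refine ⟨a, ⟨a1, a2.le⟩, ?_, ?_⟩
        · rw [(hL ha).1, le_antisymm a3 (hbot a), ← hpB, φB]
        · rw [(hL ha).2, ← hpB]
          exact le_squeeze hs hs' hy (htop a)
      · rcases le_or_gt y p.2 with hpy | hpy
        · obtain ⟨a, ⟨a1, a2⟩, a3, a4⟩ := E.exists_southeast p1 hpR hpB p4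
          have ha := a1.trans_lt hp
          refine ⟨a, ⟨a1, a2.le⟩, ?_, ?_⟩
          · rw [(hL ha).1]; exact (φle (hbot a)).trans a3.le
          · rw [(hL ha).2, φid (hpy.trans a4)]; exact a4
        -- The height `z` is the preimage of `p.2` under the contraction. Heights in the gap of the
        -- image of `φ` belong to `z = y`, where the rectangles straddling or ending at `y` have
        -- been stretched.
        · obtain ⟨z, hz1, hz2, hz3, hz4⟩ : ∃ z, B < z ∧ z ≤ y ∧ (z - B) * s ≤ p.2 - B ∧
              (z < y → (z - B) * s = p.2 - B) := by
            rcases le_or_gt (p.2 - B) ((y - B) * s) with hc | hc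
            · have hdiv : (p.2 - B) / s ≤ y - B := by rwa [div_le_iff₀ hs]
              have hpos : 0 < (p.2 - B) / s := div_pos (by linarith) hs
              have hmul : (B + (p.2 - B) / s - B) * s = p.2 - B := by field_simp; ring
              exact ⟨B + (p.2 - B) / s, by linarith, by linarith, hmul.le, fun _ => hmul⟩
            · exact ⟨y, hy, le_rfl, hc.le, fun h => (lt_irrefl _ h).elim⟩
          obtain ⟨a, ⟨a1, a2⟩, a3, a4⟩ := E.exists_southeast p1 hpR hz1
            (by linarith [E.top_le_outer i])
          have ha := a1.trans_lt hp
          refine ⟨a, ⟨a1, a2.le⟩, ?_, ?_⟩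
          · rw [(hL ha).1]
            simp only [φ]
            rw [squeeze_of_lt (a3.trans_le hz2)]
            nlinarith
          · rw [(hL ha).2]
            rcases le_or_gt y (E.rect a).top with ht | ht
            · rw [φid ht]; linarith
            · simp only [φ]
              rw [squeeze_of_lt ht]
              have := hz4 (a4.trans_lt ht)
              nlinarith
    · rcases p4.eq_or_lt with e | e
      · obtain ⟨a, ⟨a1, a2⟩, a3, a4⟩ := E.exists_southeast p1 (by linarith)
          (by rw [e]; exact E.outer.bottom_lt_top) p4
        exact raw a (by linarith) ⟨⟨a1, a2.le⟩, a3.le, a4⟩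
      · obtain ⟨a, ⟨a1, a2⟩, a3, a4⟩ := E.exists_northeast p1 (by linarith) p3 e
        exact raw a (by linarith) ⟨⟨a1, a2.le⟩, a3, a4.le⟩
    · obtain ⟨a, ha⟩ := E.exists_mem_region p1 p2 p3 p4
      exact raw a (hp.trans_le ha.1.2) ha
  have disj : ∀ i j, i ≠ j → ¬ (r i).Overlap (r j) := by
    rintro a b hab ⟨⟨g1, g2⟩, g3, g4⟩
    simp only [r] at g1 g2
    rcases cases3 a b with ⟨ha, hb⟩ | ⟨ha, hb⟩ | ⟨ha, hb⟩ | ⟨ha, hb⟩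
    · rw [(hL ha).1, (hL hb).2] at g3
      rw [(hL hb).1, (hL ha).2] at g4
      exact hab (E.eq_of_lt g1 g2 ((mono.lt_iff_lt (hbot a) (htop b)).1 g3)
        ((mono.lt_iff_lt (hbot b) (htop a)).1 g4))
    · rw [(hR ha).1, (hR hb).2] at g3
      rw [(hR hb).1, (hR ha).2] at g4
      exact hab (E.eq_of_lt g1 g2 g3 g4)
    · linarith
    · linarith
  have cross : ∀ p, ¬ IsCross r p := by
    rintro p ⟨⟨a, a1, a2⟩, ⟨b, b1, b2⟩, ⟨c, c1, c2⟩, ⟨d, d1, d2⟩⟩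
    simp only [r] at a1 b1 c1 d1
    have ea := E.left_lt_right a
    have eb := E.left_lt_right b
    have ec := E.left_lt_right c
    have ed := E.left_lt_right d
    rcases lt_trichotomy p.1 x with hp | hp | hp
    · rw [(hL (by linarith)).2] at a2 b2
      rw [(hL (by linarith)).1] at c2 d2
      refine E.not_isCross (p.1, (E.rect a).top) ⟨⟨a, a1, rfl⟩, ⟨b, b1, ?_⟩, ⟨c, c1, ?_⟩,
        ⟨d, d1, ?_⟩⟩
      · exact mono.injOn (htop b) (htop a) (by rw [a2, b2])
      · exact mono.injOn (hbot c) (htop a) (by rw [a2, c2])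
      · exact mono.injOn (hbot d) (htop a) (by rw [a2, d2])
    · rw [(hR (by linarith)).2] at b2
      rw [(hR (by linarith)).1] at d2
      rw [(hL (by linarith)).2] at a2
      rw [(hL (by linarith)).1] at c2
      have hpy := wallt (b1.trans hp)
      -- A cross on the line is higher than `y`, and `φ` takes a value above `y` only at that value
      -- itself.
      have back : ∀ c, B ≤ c → φ c = p.2 → c = p.2 := by
        intro c hc hc'
        rcases lt_or_ge c y with h | h
        · linarith [φle hc]
        · rwa [φid h] at hc'
      exact E.not_isCross p ⟨⟨a, a1, back _ (htop a) a2⟩, ⟨b, b1, b2⟩,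
        ⟨c, c1, back _ (hbot c) c2⟩, ⟨d, d1, d2⟩⟩
    · rw [(hR (by linarith)).2] at a2 b2
      rw [(hR (by linarith)).1] at c2 d2
      exact E.not_isCross p ⟨⟨a, a1, a2⟩, ⟨b, b1, b2⟩, ⟨c, c1, c2⟩, ⟨d, d1, d2⟩⟩
  have hxi : x < (E.rect i).right := by linarith
  -- The new height is the limit of `φ` at `y` from below; `φ y` itself is `y`.
  refine ⟨ofRects E.outer r sub cov disj cross, B + (y - B) * s, ⟨?_, ?_⟩,
    ⟨?_, h2, ⟨?_, ?_⟩, ?_, h7⟩, ?_⟩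
  · funext a b
    apply propext
    change (E.rect a).right = (E.rect b).left ∧ _ ↔ (E.rect a).right = (E.rect b).left ∧
      (r a).bottom < (r b).top ∧ (r b).bottom < (r a).top
    refine and_congr_right fun hab => ?_
    rcases cases3 a b with ⟨ha, hb⟩ | ⟨ha, hb⟩ | ⟨ha, hb⟩ | ⟨ha, hb⟩
    · rw [(hL ha).1, (hL hb).2, (hL hb).1, (hL ha).2, mono.lt_iff_lt (hbot a) (htop b),
        mono.lt_iff_lt (hbot b) (htop a)]
    · rw [(hR ha).1, (hR hb).2, (hR hb).1, (hR ha).2]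
    -- For contacts across the line, `b` is `i` or lies above `y`. In both cases contracting heights
    -- below `y` on one side changes no comparison.
    · have hbx : (E.rect b).left = x := by linarith
      have ha' : (E.rect a).left < x := by linarith [E.left_lt_right a]
      have hb' : x < (E.rect b).right := by linarith [E.left_lt_right b]
      rw [(hL ha').1, (hL ha').2, (hR hb').1, (hR hb').2]
      have hbt := wallt hbx
      have hat : B < (E.rect a).top := (E.outer_bottom_le a).trans_lt (E.bottom_lt_top a)
      refine and_congr ?_ ?_
      · rcases lt_or_ge (E.rect a).bottom y with hlt | hge
        · have := φle (hbot a)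
          exact iff_of_true (by linarith) (by linarith)
        · rw [φid hge]
      · rcases lt_or_ge (E.rect a).top y with hlt | hge
        · rcases wall hbx with rfl | hbb
          · have := mono Set.self_mem_Ici (htop a) hat
            rw [φB] at this
            exact iff_of_true (by linarith) (by linarith)
          · have := φle (htop a)
            exact iff_of_false (by linarith) (by linarith)
        · rw [φid hge]
    · linarith [E.left_lt_right a, E.left_lt_right b]
  · funext a b
    apply propext
    change (E.rect a).top = (E.rect b).bottom ∧ _ ∧ _ ↔ (r a).top = (r b).bottom ∧
      (E.rect a).left < (E.rect b).right ∧ (E.rect b).left < (E.rect a).right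
    refine and_congr_left fun hab => ?_
    rcases cases3 a b with ⟨ha, hb⟩ | ⟨ha, hb⟩ | ⟨ha, hb⟩ | ⟨ha, hb⟩
    · rw [(hL hb).1, (hL ha).2, mono.injOn.eq_iff (htop a) (hbot b)]
    · rw [(hR hb).1, (hR ha).2]
    · linarith [hab.1, hab.2]
    · linarith [hab.1, hab.2]
  · change (r i).bottom = B
    rw [(hR hxi).1, hib]
  · change (r i).bottom < _
    rw [(hR hxi).1, hib]
    have : 0 < (y - B) * s := mul_pos (by linarith) hs
    linarith
  · change _ < (r i).top
    rw [(hR hxi).2]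
    linarith [hgap' i]
  · change (r j).bottom < _ ∧ _ < (r j).top
    rcases h7 with h7 | ⟨rfl, -⟩
    · have hjx : (E.rect j).left < x := by linarith [E.left_lt_right j]
      rw [(hL hjx).1, (hL hjx).2, φid h6.le]
      simp only [φ]
      rw [squeeze_of_lt h5]
      exact ⟨by nlinarith, by linarith [hgap' j]⟩
    · rw [(hR hxi).1, (hR hxi).2, hib]
      have : 0 < (y - B) * s := mul_pos (by linarith) hs
      exact ⟨by linarith, by linarith [hgap' j]⟩
  · intro a _ ha
    change x ≤ (E.rect a).left at ha
    change _ < (r a).top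
    rw [(hR (ha.trans_lt (E.left_lt_right a))).2]
    linarith [hgap' a]

/-- After a deformation that preserves all relations, insertion is possible at every encoding, so
every child exists. -/
theorem IsCode.exists_insert {E : Rectangulation n} {c : Bool × Fin n × Fin n}
    (h : E.IsCode c) : ∃ E' D q, E.SameRel E' ∧ E'.Insert D q c := by
  have vert : ∀ {E : Rectangulation n} {i j}, E.IsCode (true, i, j) →
      ∃ E' D q, E.SameRel E' ∧ E'.Insert D q (true, i, j) := by
    intro E i j h
    obtain ⟨q, hq⟩ := h.exists_hasCode
    cases q with
    | horiz x y => exact hq.elim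
    | vert x y =>
      obtain ⟨E', y', h1, h2, h3⟩ := exists_sameRel_lt_top hq
      obtain ⟨D, hD⟩ := exists_vertInsert_of_lt_top h2 h3
      exact ⟨E', D, .vert x y', h1, hD.1, hD.2⟩
  obtain ⟨b, i, j⟩ := c
  cases b with
  | true => exact vert h
  | false =>
    obtain ⟨E', D, q, h1, h2⟩ := vert (E := E.reflect) (i := i) (j := j) h
    refine ⟨E'.reflect, D.reflect, q.reflect, by simpa using h1.reflect, ?_⟩
    exact insert_reflect.2 h2

/-! ### Based rectangulations -/

/-- A bottom-based result means that the new rectangle starts at the left boundary. Only one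
insertion edge lies there, on the bottom-left rectangle, and its point precedes all others. -/
theorem Insert.isBottomBased_iff {E : Rectangulation n} {D : Rectangulation (n + 1)}
    {q : InsPoint} {c : Bool × Fin n × Fin n} {qs : List InsPoint} (h : E.Insert D q c)
    (hqs : E.IsInsertionSequence qs) (hq : q ∈ qs) :
    D.IsBottomBased ↔ ∀ q' ∈ qs, ¬ q'.Before q := by
  rw [isInsertionSequence_iff] at hqs
  obtain ⟨-, hcode, huniq⟩ := hqs
  have hlast : D.IsBottomBased ↔ (D.rect (Fin.last n)).left = E.outer.left := by
    obtain ⟨hb, hr, ho, -⟩ := isDeletion_iff_insert.2 ⟨q, c, h⟩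
    rw [ho]
    constructor
    · rintro ⟨a, a1, a2, a3⟩
      unfold TouchesBottom at *
      unfold TouchesRight at hr
      obtain rfl := D.eq_of_lt (i := a) (j := Fin.last n)
        (by linarith [D.left_lt_right (Fin.last n), D.outer_left_le (Fin.last n)])
        (by linarith [D.left_lt_right (Fin.last n)]) (by linarith [D.bottom_lt_top (Fin.last n)])
        (by linarith [D.bottom_lt_top a])
      exact a2
    · exact fun hl => ⟨_, hb, hl, hr⟩
  rw [hlast]
  have hx : (D.rect (Fin.last n)).left = match q with | .vert x _ => x | .horiz x _ => x := by
    cases q with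
    | vert x y => exact h.2.2.1
    | horiz x y => exact h.2.2.1
  constructor
  · intro hl q' hq' hlt
    rw [hx] at hl
    obtain ⟨⟨b', i', j'⟩, hc'⟩ := hcode q' hq'
    obtain ⟨b, i, j⟩ := c
    have hc := h.1
    cases q with
    | horiz x y =>
      cases b with
      | true => exact hc
      | false =>
        obtain ⟨-, -, ⟨h7, h8⟩, -, -⟩ := hc
        simp only [reflect_bottom, reflect_top] at h7 h8
        simp only at hl
        linarith [E.outer_left_le i]
    | vert x y =>
      cases q' with
      | horiz x' y' => exact hlt
      | vert x' y' =>
        cases b with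
        | false => exact hc
        | true =>
        cases b' with
        | false => exact hc'
        | true =>
        simp only at hl
        obtain ⟨h1, h2, ⟨h3, h4⟩, ⟨h5, h6⟩, h7⟩ := id hc
        obtain ⟨g1, g2, ⟨g3, g4⟩, ⟨g5, g6⟩, g7⟩ := id hc'
        unfold TouchesBottom at h1 g1
        have hx' : x' = x := by
          rcases hlt with hlt | hlt
          · linarith [E.outer_left_le i']
          · exact hlt.1
        obtain rfl : i = i' := E.eq_of_lt (by linarith [E.left_lt_right i'])
          (by linarith [E.left_lt_right i]) (by linarith) (by linarith)
        have hj : j = i := by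
          rcases h7 with h7 | h7
          · linarith [E.outer_left_le j, E.left_lt_right j]
          · exact h7.1
        have hj' : j' = i := by
          rcases g7 with g7 | g7
          · linarith [E.outer_left_le j', E.left_lt_right j']
          · exact g7.1
        subst hj hj'
        have := (huniq _ (HasCode.isCode hc)).unique ⟨hq, hc⟩ ⟨hq', hc'⟩
        rw [← this] at hlt
        exact InsPoint.before_irrefl _ hlt
  · intro hmin
    obtain ⟨i, ⟨i1, i2⟩, i3, i4⟩ := E.exists_northeast le_rfl E.outer.left_lt_right le_rfl
      E.outer.bottom_lt_top
    have hi : (E.rect i).left = E.outer.left := le_antisymm i1 (E.outer_left_le i)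
    have hib : E.TouchesBottom i := le_antisymm i3 (E.outer_bottom_le i)
    -- The insertion point on the left boundary, encoded by the same rectangle twice.
    obtain ⟨q₀, ⟨hq₀, hc₀⟩, -⟩ := huniq (true, i, i) ⟨hib, Or.inr ⟨rfl, hi⟩⟩
    have hle := hmin q₀ hq₀
    cases q₀ with
    | horiz x y => exact hc₀.elim
    | vert x₀ y₀ =>
      obtain ⟨-, h2, -⟩ := hc₀
      cases q with
      | horiz x y => exact (hle trivial).elim
      | vert x y =>
        rw [hx]
        simp only
        obtain ⟨⟨b, i', j'⟩, hc'⟩ := hcode _ hq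
        cases b with
        | false => exact hc'.elim
        | true =>
          obtain ⟨-, g2, -⟩ := hc'
          by_contra hne
          exact hle (Or.inl (lt_of_le_of_ne (by linarith [E.outer_left_le i'])
            (by rw [← h2, hi]; exact Ne.symm hne)))

theorem Insert.isRightBased_iff {E : Rectangulation n} {D : Rectangulation (n + 1)}
    {q : InsPoint} {c : Bool × Fin n × Fin n} {qs : List InsPoint} (h : E.Insert D q c)
    (hqs : E.IsInsertionSequence qs) (hq : q ∈ qs) :
    D.IsRightBased ↔ ∀ q' ∈ qs, ¬ q.Before q' := by
  rw [← reflect_isBottomBased, (insert_reflect.2 h).isBottomBased_iff hqs.reflect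
    (by simpa using ⟨q, hq, rfl⟩)]
  simp only [List.mem_reverse, List.mem_map, forall_exists_index, and_imp,
    forall_apply_eq_imp_iff₂, InsPoint.before_reflect]

/-! ### The bottom-right rectangle and relabelling -/

theorem exists_bottomRight (R : Rectangulation n) : ∃ i, R.TouchesBottom i ∧ R.TouchesRight i := by
  obtain ⟨i, ⟨i1, i2⟩, i3, i4⟩ := R.exists_northwest R.outer.left_lt_right le_rfl le_rfl
    R.outer.bottom_lt_top
  exact ⟨i, le_antisymm i3 (R.outer_bottom_le i), le_antisymm (R.right_le_outer i) i2⟩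

theorem bottomRight_unique {R : Rectangulation n} {i j : Fin n} (hi : R.TouchesBottom i)
    (hi' : R.TouchesRight i) (hj : R.TouchesBottom j) (hj' : R.TouchesRight j) : i = j := by
  unfold TouchesBottom TouchesRight at *
  have := R.left_lt_right i
  have := R.left_lt_right j
  have := R.bottom_lt_top i
  have := R.bottom_lt_top j
  exact R.eq_of_lt (by linarith) (by linarith) (by linarith) (by linarith)

/-- The extension of a permutation by a fixed point. -/
def extendPerm (τ : Equiv.Perm (Fin n)) : Equiv.Perm (Fin (n + 1)) where
  toFun := Fin.lastCases (Fin.last n) fun a => (τ a).castSucc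
  invFun := Fin.lastCases (Fin.last n) fun a => (τ.symm a).castSucc
  left_inv a := by
    induction a using Fin.lastCases <;> simp
  right_inv a := by
    induction a using Fin.lastCases <;> simp

@[simp] theorem extendPerm_last (τ : Equiv.Perm (Fin n)) :
    extendPerm τ (Fin.last n) = Fin.last n := by
  simp [extendPerm]

@[simp] theorem extendPerm_castSucc (τ : Equiv.Perm (Fin n)) (a : Fin n) :
    extendPerm τ a.castSucc = (τ a).castSucc := by
  simp [extendPerm]

theorem exists_extendPerm {σ : Equiv.Perm (Fin (n + 1))} (h : σ (Fin.last n) = Fin.last n) :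
    ∃ τ, σ = extendPerm τ := by
  have hne : ∀ (ρ : Equiv.Perm (Fin (n + 1))), ρ (Fin.last n) = Fin.last n →
      ∀ a : Fin n, ρ a.castSucc ≠ Fin.last n := fun ρ hρ a ha =>
    (Fin.castSucc_lt_last a).ne (ρ.injective (ha.trans hρ.symm))
  have h' : σ.symm (Fin.last n) = Fin.last n := by rw [Equiv.symm_apply_eq, h]
  refine ⟨⟨fun a => (σ a.castSucc).castPred (hne σ h a),
    fun a => (σ.symm a.castSucc).castPred (hne σ.symm h' a), fun a => by simp,
    fun a => by simp⟩, ?_⟩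
  ext a
  induction a using Fin.lastCases with
  | last => rw [h, extendPerm_last]
  | cast a => simp

theorem isInsertionAt_relabel {E : Rectangulation n} {D : Rectangulation (n + 1)} {q : InsPoint}
    (h : E.IsInsertionAt D q) (τ : Equiv.Perm (Fin n)) :
    (E.relabel τ).IsInsertionAt (D.relabel (extendPerm τ)) q := by
  cases q with
  | vert x y =>
    obtain ⟨h1, h2, h3, h4, h5, h6⟩ := h
    refine ⟨h1, ?_, ?_, ?_, ?_, fun i => ?_⟩
    · change (D.rect (extendPerm τ (Fin.last n))).left = x
      rw [extendPerm_last, h2]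
    · change (D.rect (extendPerm τ (Fin.last n))).top = y
      rw [extendPerm_last, h3]
    · change D.TouchesBottom (extendPerm τ (Fin.last n))
      rwa [extendPerm_last]
    · change D.TouchesRight (extendPerm τ (Fin.last n))
      rwa [extendPerm_last]
    · have e : (D.relabel (extendPerm τ)).rect i.castSucc = D.rect (τ i).castSucc := by
        change D.rect (extendPerm τ i.castSucc) = _
        rw [extendPerm_castSucc]
      rw [e]
      exact h6 (τ i)
  | horiz x y =>
    obtain ⟨h1, h2, h3, h4, h5, h6⟩ := h
    refine ⟨h1, ?_, ?_, ?_, ?_, fun i => ?_⟩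
    · change (D.rect (extendPerm τ (Fin.last n))).left = x
      rw [extendPerm_last, h2]
    · change (D.rect (extendPerm τ (Fin.last n))).top = y
      rw [extendPerm_last, h3]
    · change D.TouchesBottom (extendPerm τ (Fin.last n))
      rwa [extendPerm_last]
    · change D.TouchesRight (extendPerm τ (Fin.last n))
      rwa [extendPerm_last]
    · have e : (D.relabel (extendPerm τ)).rect i.castSucc = D.rect (τ i).castSucc := by
        change D.rect (extendPerm τ i.castSucc) = _
        rw [extendPerm_castSucc]
      rw [e]
      exact h6 (τ i)

end Rectangulation

/-! ### Parents and children of rectangulations up to equivalence -/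

namespace Rectangulation

variable {n : ℕ}

theorem hasCode_relabel {E : Rectangulation n} {τ : Equiv.Perm (Fin n)} {q : InsPoint}
    {b : Bool} {i j : Fin n} :
    (E.relabel τ).HasCode q (b, i, j) ↔ E.HasCode q (b, τ i, τ j) := by
  have vert : ∀ (E : Rectangulation n) x y, (E.relabel τ).VertAt x y i j ↔
      E.VertAt x y (τ i) (τ j) := by
    intro E x y
    unfold VertAt
    rw [τ.injective.eq_iff]
    rfl
  cases q <;> cases b
  · exact Iff.rfl
  · exact vert E _ _
  · exact vert E.reflect _ _
  · exact Iff.rfl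

theorem Insert.relabel {E : Rectangulation n} {D : Rectangulation (n + 1)} {q : InsPoint}
    {c : Bool × Fin n × Fin n} (h : E.Insert D q c) (τ : Equiv.Perm (Fin n)) :
    (E.relabel τ).Insert (D.relabel (extendPerm τ)) q (c.1, τ.symm c.2.1, τ.symm c.2.2) := by
  refine ⟨hasCode_relabel.2 ?_, isInsertionAt_relabel h.2 τ⟩
  rw [τ.apply_symm_apply, τ.apply_symm_apply]
  exact h.1

theorem Insert.bottomRight {E : Rectangulation n} {D : Rectangulation (n + 1)} {q : InsPoint}
    {c : Bool × Fin n × Fin n} (h : E.Insert D q c) :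
    D.TouchesBottom (Fin.last n) ∧ D.TouchesRight (Fin.last n) := by
  obtain ⟨h1, h2, -⟩ := isDeletion_iff_insert.2 ⟨q, c, h⟩
  exact ⟨h1, h2⟩

/-- Equivalent drawings whose last rectangles lie in the bottom-right corner differ, up to
equality of relations, by a permutation that fixes the last label. -/
theorem Equivalent.exists_extendPerm {D D' : Rectangulation (n + 1)} (h : D.Equivalent D')
    (hD : D.TouchesBottom (Fin.last n) ∧ D.TouchesRight (Fin.last n))
    (hD' : D'.TouchesBottom (Fin.last n) ∧ D'.TouchesRight (Fin.last n)) :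
    ∃ τ, D.SameRel (D'.relabel (extendPerm τ)) := by
  obtain ⟨σ, hσ⟩ := equivalent_iff.1 h
  have h1 : D'.TouchesBottom (σ (Fin.last n)) := hσ.touchesBottom.1 hD.1
  have h2 : D'.TouchesRight (σ (Fin.last n)) := hσ.touchesRight.1 hD.2
  obtain ⟨τ, rfl⟩ := Rectangulation.exists_extendPerm (bottomRight_unique h1 h2 hD'.1 hD'.2)
  exact ⟨τ, hσ⟩

/-- The insertion sequence through a given insertion point. -/
theorem HasCode.exists_isInsertionSequence {E : Rectangulation n} {q : InsPoint}
    {c : Bool × Fin n × Fin n} (h : E.HasCode q c) {cs : List (Bool × Fin n × Fin n)}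
    (hcs : E.IsCodeList cs) {k : ℕ} (hk : cs[k]? = some c) :
    ∃ qs, E.IsInsertionSequence qs ∧ qs[k]? = some q := by
  classical
  have : Nonempty InsPoint := ⟨q⟩
  choose! f hf using fun c (hc : E.IsCode c) => hc.exists_hasCode
  refine ⟨cs.map (Function.update f c q), hcs.isInsertionSequence fun c' hc' => ?_, ?_⟩
  · rcases eq_or_ne c' c with rfl | hne
    · rwa [Function.update_self]
    · rw [Function.update_of_ne hne]; exact hf c' hc'
  · rw [List.getElem?_map, hk, Option.map_some, Function.update_self]

end Rectangulation

namespace GenRect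

open Rectangulation

variable {n : ℕ}

/-- The rectangulation represented by a drawing. -/
def ofDrawing (D : Rectangulation n) : GenRect n := Quotient.mk (Rectangulation.setoid n) D

theorem ofDrawing_eq {D E : Rectangulation n} : ofDrawing D = ofDrawing E ↔ D.Equivalent E :=
  Quotient.eq (r := Rectangulation.setoid n)

theorem exists_ofDrawing (R : GenRect n) : ∃ D, ofDrawing D = R := Quotient.exists_rep R

theorem ofDrawing_relabel (D : Rectangulation n) (σ : Equiv.Perm (Fin n)) :
    ofDrawing (D.relabel σ) = ofDrawing D :=
  ofDrawing_eq.2 (relabel_equivalent D σ)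

theorem isParent_iff_insert {R : GenRect (n + 1)} {P : GenRect n} :
    IsParent R P ↔ ∃ E D q c, ofDrawing E = P ∧ ofDrawing D = R ∧ E.Insert D q c := by
  constructor
  · rintro ⟨D, E, hD, hE, h⟩
    obtain ⟨q, c, h⟩ := isDeletion_iff_insert.1 h
    exact ⟨E, D, q, c, hE, hD, h⟩
  · rintro ⟨E, D, q, c, hE, hD, h⟩
    exact ⟨D, E, hD, hE, isDeletion_iff_insert.2 ⟨q, c, h⟩⟩

theorem exists_isParent (hn : 1 ≤ n) (R : GenRect (n + 1)) : ∃ P, IsParent R P := by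
  obtain ⟨D, rfl⟩ := exists_ofDrawing R
  obtain ⟨i, h1, h2⟩ := D.exists_bottomRight
  have e : Equiv.swap i (Fin.last n) (Fin.last n) = i := Equiv.swap_apply_right _ _
  obtain ⟨E, hE⟩ := exists_isDeletion (D := D.relabel (Equiv.swap i (Fin.last n))) hn
    (show D.TouchesBottom _ by rwa [e]) (show D.TouchesRight _ by rwa [e])
  exact ⟨ofDrawing E, _, E, ofDrawing_relabel D _, rfl, hE⟩

/-- The bottom-right rectangle is unique, so two drawings of `R` can be aligned by a permutation
fixing the last label; then `Insert.parent_sameRel` applies. -/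
theorem IsParent.unique {R : GenRect (n + 1)} {P P' : GenRect n} (h : IsParent R P)
    (h' : IsParent R P') : P = P' := by
  rw [isParent_iff_insert] at h h'
  obtain ⟨E, D, q, c, rfl, rfl, h⟩ := h
  obtain ⟨E', D', q', c', rfl, hD, h'⟩ := h'
  obtain ⟨τ, hτ⟩ := (ofDrawing_eq.1 hD.symm).exists_extendPerm h.bottomRight h'.bottomRight
  rw [← ofDrawing_relabel E' τ]
  exact ofDrawing_eq.2 (h.parent_sameRel (h'.relabel τ) hτ).1.equivalent

/-- Transports an arbitrary witness to the labels of a fixed drawing `E₁`, where the lists of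
encodings of different witnesses can be compared. -/
theorem IsChild.exists_code {P : GenRect n} {k : ℕ} {R : GenRect (n + 1)} (h : IsChild P k R)
    {E₁ : Rectangulation n} (hE₁ : ofDrawing E₁ = P) :
    ∃ E D qs q c cs, E₁.SameRel E ∧ ofDrawing E = P ∧ ofDrawing D = R ∧
      E.IsInsertionSequence qs ∧ 1 ≤ k ∧ qs[k - 1]? = some q ∧ E.Insert D q c ∧
      E.IsCodeList cs ∧ cs.length = qs.length ∧ cs[k - 1]? = some c := by
  obtain ⟨E, D, qs, q, hE, hD, hqs, hk, hq, hins⟩ := h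
  obtain ⟨τ, hτ⟩ := equivalent_iff.1 (ofDrawing_eq.1 (hE₁.trans hE.symm))
  have hqs' := relabel_isInsertionSequence (σ := τ).2 hqs
  obtain ⟨cs, hcs, hall⟩ := hqs'.exists_codeList
  obtain ⟨hlt, hq'⟩ := List.getElem?_eq_some_iff.1 hq
  have hlt' : k - 1 < cs.length := hall.length_eq ▸ hlt
  refine ⟨E.relabel τ, D.relabel (extendPerm τ), qs, q, cs[k - 1], cs, hτ,
    (ofDrawing_relabel E τ).trans hE, (ofDrawing_relabel D _).trans hD, hqs', hk, hq,
    ⟨?_, isInsertionAt_relabel hins τ⟩, hcs, hall.length_eq.symm, List.getElem?_eq_getElem hlt'⟩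
  have := hall.get hlt hlt'
  simpa [hq'] using this

theorem isChild_of_insert {E : Rectangulation n} {D : Rectangulation (n + 1)} {q : InsPoint}
    {c : Bool × Fin n × Fin n} (h : E.Insert D q c) {cs : List (Bool × Fin n × Fin n)}
    (hcs : E.IsCodeList cs) {k : ℕ} (hk : 1 ≤ k) (hc : cs[k - 1]? = some c) :
    IsChild (ofDrawing E) k (ofDrawing D) := by
  obtain ⟨qs, hqs, hq⟩ := h.1.exists_isInsertionSequence hcs hc
  exact ⟨E, D, qs, q, rfl, rfl, hqs, hk, hq, h.2⟩

theorem IsChild.unique {P : GenRect n} {k : ℕ} {R R' : GenRect (n + 1)} (h : IsChild P k R)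
    (h' : IsChild P k R') : R = R' := by
  obtain ⟨E₁, hE₁⟩ := exists_ofDrawing P
  obtain ⟨E, D, qs, q, c, cs, hE, -, rfl, -, -, -, hins, hcs, -, hc⟩ := h.exists_code hE₁
  obtain ⟨E', D', qs', q', c', cs', hE', -, rfl, -, -, -, hins', hcs', -, hc'⟩ := h'.exists_code hE₁
  have hEE := hE.symm.trans hE'
  obtain rfl := (hEE.isCodeList.1 hcs).unique hcs'
  obtain rfl : c = c' := Option.some_injective _ (hc.symm.trans hc')
  exact ofDrawing_eq.2 (hins.sameRel hins' hEE).equivalent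

theorem IsChild.isParent {P : GenRect n} {k : ℕ} {R : GenRect (n + 1)} (h : IsChild P k R) :
    IsParent R P := by
  obtain ⟨E₁, hE₁⟩ := exists_ofDrawing P
  obtain ⟨E, D, qs, q, c, cs, -, hE, hD, -, -, -, hins, -⟩ := h.exists_code hE₁
  exact isParent_iff_insert.2 ⟨E, D, q, c, hE, hD, hins⟩

theorem IsParent.exists_isChild {R : GenRect (n + 1)} {P : GenRect n} (h : IsParent R P) :
    ∃ k, IsChild P k R := by
  obtain ⟨E, D, q, c, rfl, rfl, hins⟩ := isParent_iff_insert.1 h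
  obtain ⟨cs, hcs⟩ := E.exists_isCodeList
  obtain ⟨k, hk⟩ := List.mem_iff_getElem?.1 ((hcs.2 c).2 hins.1.isCode)
  exact ⟨k + 1, isChild_of_insert hins hcs (by omega) hk⟩

/-- Both insertions have the same encoding after alignment, and the list of encodings has no
repetition. -/
theorem IsChild.index_unique {P : GenRect n} {k k' : ℕ} {R : GenRect (n + 1)}
    (h : IsChild P k R) (h' : IsChild P k' R) : k = k' := by
  obtain ⟨E₁, hE₁⟩ := exists_ofDrawing P
  obtain ⟨E, D, qs, q, c, cs, -, hE, hD, -, hk, -, hins, hcs, -, hc⟩ := h.exists_code hE₁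
  obtain ⟨E', D', qs', q', c', -, -, -, hD', hqs', hk', hq', hins', -, -, -⟩ := h'.exists_code hE₁
  obtain ⟨τ, hτ⟩ := (ofDrawing_eq.1 (hD.trans hD'.symm)).exists_extendPerm hins.bottomRight
    hins'.bottomRight
  have hins'' := hins'.relabel τ
  obtain ⟨hEE, hcc⟩ := hins.parent_sameRel hins'' hτ
  obtain ⟨cs', hcs', hall⟩ := (relabel_isInsertionSequence (σ := τ).2 hqs').exists_codeList
  obtain rfl := (hEE.isCodeList.1 hcs).unique hcs'
  obtain ⟨hlt, hq''⟩ := List.getElem?_eq_some_iff.1 hq'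
  have hlt' : k' - 1 < cs.length := hall.length_eq ▸ hlt
  have h2 := hall.get hlt hlt'
  rw [List.get_eq_getElem, List.get_eq_getElem] at h2
  simp only at h2
  rw [hq''] at h2
  have h3 := h2.unique hins''.1
  obtain ⟨hlt₁, hc₁⟩ := List.getElem?_eq_some_iff.1 hc
  have := (hcs.nodup.getElem_inj_iff (hi := hlt₁) (hj := hlt')).1 (by rw [hc₁, h3, hcc])
  omega

theorem isInsertionCount_iff_codeList {E : Rectangulation n} {cs : List (Bool × Fin n × Fin n)}
    (hcs : E.IsCodeList cs) {ν : ℕ} : IsInsertionCount (ofDrawing E) ν ↔ ν = cs.length := by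
  constructor
  · rintro ⟨E', qs, hE', hqs, rfl⟩
    obtain ⟨τ, hτ⟩ := equivalent_iff.1
      (ofDrawing_eq.1 (show ofDrawing E = ofDrawing E' from hE'.symm))
    obtain ⟨cs', hcs', hall⟩ := (relabel_isInsertionSequence (σ := τ).2 hqs).exists_codeList
    rw [hall.length_eq, (hτ.isCodeList.1 hcs).unique hcs']
  · rintro rfl
    have : Nonempty InsPoint := ⟨.vert 0 0⟩
    choose! f hf using fun c (hc : E.IsCode c) => hc.exists_hasCode
    exact ⟨E, cs.map f, rfl, hcs.isInsertionSequence hf, by simp⟩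

theorem existsUnique_isInsertionCount (P : GenRect n) : ∃! ν, IsInsertionCount P ν := by
  obtain ⟨E, rfl⟩ := exists_ofDrawing P
  obtain ⟨cs, hcs⟩ := E.exists_isCodeList
  exact ⟨cs.length, (isInsertionCount_iff_codeList hcs).2 rfl,
    fun ν hν => (isInsertionCount_iff_codeList hcs).1 hν⟩

theorem IsInsertionCount.exists_isChild {P : GenRect n} {ν k : ℕ} (h : IsInsertionCount P ν)
    (hk : 1 ≤ k) (hk' : k ≤ ν) : ∃ R, IsChild P k R := by
  obtain ⟨E, rfl⟩ := exists_ofDrawing P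
  obtain ⟨cs, hcs⟩ := E.exists_isCodeList
  obtain rfl := (isInsertionCount_iff_codeList hcs).1 h
  have hlt : k - 1 < cs.length := by omega
  obtain ⟨E', D, q, hE, hins⟩ := ((hcs.2 cs[k - 1]).1 (List.getElem_mem hlt)).exists_insert
  rw [ofDrawing_eq.2 hE.equivalent]
  exact ⟨ofDrawing D, isChild_of_insert hins (hE.isCodeList.1 hcs) hk
    (List.getElem?_eq_getElem hlt)⟩

theorem IsChild.le_count {P : GenRect n} {ν k : ℕ} {R : GenRect (n + 1)} (h : IsChild P k R)
    (hν : IsInsertionCount P ν) : 1 ≤ k ∧ k ≤ ν := by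
  obtain ⟨E₁, rfl⟩ := exists_ofDrawing P
  obtain ⟨E, D, qs, q, c, cs, hE, -, -, -, hk, -, -, hcs, -, hc⟩ := h.exists_code rfl
  obtain rfl := (isInsertionCount_iff_codeList (hE.symm.isCodeList.1 hcs)).1 hν
  obtain ⟨hlt, -⟩ := List.getElem?_eq_some_iff.1 hc
  omega

/-- The bottom-left rectangle gives a vertical point on the left boundary, the top-right one a
horizontal point on the top boundary. Hence the two extreme children always differ. -/
theorem IsInsertionCount.two_le {P : GenRect n} {ν : ℕ} (h : IsInsertionCount P ν) : 2 ≤ ν := by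
  obtain ⟨E, rfl⟩ := exists_ofDrawing P
  obtain ⟨cs, hcs⟩ := E.exists_isCodeList
  obtain rfl := (isInsertionCount_iff_codeList hcs).1 h
  have key : ∀ E : Rectangulation n, ∃ i, E.VertCode i i := by
    intro E
    obtain ⟨i, ⟨i1, i2⟩, i3, i4⟩ := E.exists_northeast le_rfl E.outer.left_lt_right le_rfl
      E.outer.bottom_lt_top
    exact ⟨i, le_antisymm i3 (E.outer_bottom_le i),
      Or.inr ⟨rfl, le_antisymm i1 (E.outer_left_le i)⟩⟩
  obtain ⟨i, hi⟩ := key E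
  obtain ⟨j, hj⟩ := key E.reflect
  have h1 : (true, i, i) ∈ cs := (hcs.2 _).2 hi
  have h2 : (false, j, j) ∈ cs := (hcs.2 _).2 hj
  rcases cs with _ | ⟨a, _ | ⟨b, l⟩⟩
  · simp at h1
  · rw [List.mem_singleton] at h1 h2
    simp [← h1] at h2
  · simp

theorem IsInsertionCount.le_two {P : GenRect 1} {ν : ℕ} (h : IsInsertionCount P ν) : ν ≤ 2 := by
  obtain ⟨E, rfl⟩ := exists_ofDrawing P
  obtain ⟨cs, hcs⟩ := E.exists_isCodeList
  obtain rfl := (isInsertionCount_iff_codeList hcs).1 h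
  simpa using hcs.nodup.length_le_card

theorem isBottomBased_ofDrawing {D : Rectangulation n} :
    IsBottomBased (ofDrawing D) ↔ D.IsBottomBased :=
  ⟨fun ⟨_, h, h'⟩ => (ofDrawing_eq.1 h).isBottomBased.1 h', fun h => ⟨D, rfl, h⟩⟩

theorem isRightBased_ofDrawing {D : Rectangulation n} :
    IsRightBased (ofDrawing D) ↔ D.IsRightBased :=
  ⟨fun ⟨_, h, h'⟩ => (ofDrawing_eq.1 h).isRightBased.1 h', fun h => ⟨D, rfl, h⟩⟩

theorem IsChild.isBottomBased_iff {P : GenRect n} {k : ℕ} {R : GenRect (n + 1)}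
    (h : IsChild P k R) : IsBottomBased R ↔ k = 1 := by
  obtain ⟨E₁, rfl⟩ := exists_ofDrawing P
  obtain ⟨E, D, qs, q, c, cs, hE, -, rfl, hqs, hk, hq, hins, -⟩ := h.exists_code rfl
  obtain ⟨hlt, rfl⟩ := List.getElem?_eq_some_iff.1 hq
  rw [isBottomBased_ofDrawing, hins.isBottomBased_iff hqs (List.getElem_mem hlt)]
  have hpw := List.pairwise_iff_getElem.1 hqs.1
  constructor
  · intro hmin
    by_contra hne
    exact hmin _ (List.getElem_mem (by omega : 0 < qs.length))
      (hpw 0 (k - 1) (by omega) hlt (by omega))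
  · rintro rfl q' hq' hb
    obtain ⟨l, hl, rfl⟩ := List.getElem_of_mem hq'
    rcases Nat.eq_zero_or_pos l with rfl | hpos
    · exact InsPoint.before_irrefl _ hb
    · exact InsPoint.before_irrefl _ (hb.trans (hpw 0 l hlt hl hpos))

theorem IsChild.isRightBased_iff {P : GenRect n} {k ν : ℕ} {R : GenRect (n + 1)}
    (h : IsChild P k R) (hν : IsInsertionCount P ν) : IsRightBased R ↔ k = ν := by
  obtain ⟨E₁, rfl⟩ := exists_ofDrawing P
  obtain ⟨E, D, qs, q, c, cs, hE, -, rfl, hqs, hk, hq, hins, hcs, hlen, -⟩ := h.exists_code rfl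
  obtain ⟨hlt, rfl⟩ := List.getElem?_eq_some_iff.1 hq
  obtain rfl := (isInsertionCount_iff_codeList (hE.symm.isCodeList.1 hcs)).1 hν
  rw [isRightBased_ofDrawing, hins.isRightBased_iff hqs (List.getElem_mem hlt), hlen]
  have hpw := List.pairwise_iff_getElem.1 hqs.1
  constructor
  · intro hmax
    by_contra hne
    exact hmax _ (List.getElem_mem (by omega : qs.length - 1 < qs.length))
      (hpw (k - 1) (qs.length - 1) hlt (by omega) (by omega))
  · rintro rfl q' hq' hb
    obtain ⟨l, hl, rfl⟩ := List.getElem_of_mem hq'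
    rcases Nat.lt_or_ge l (qs.length - 1) with hl' | hl'
    · exact InsPoint.before_irrefl _ (hb.trans (hpw l _ hl hlt hl'))
    · obtain rfl : l = qs.length - 1 := by omega
      exact InsPoint.before_irrefl _ hb

/-! ### Reflection -/

/-- The reflection of a rectangulation at the main diagonal. -/
def reflect : GenRect n → GenRect n :=
  Quotient.map (sa := Rectangulation.setoid n) (sb := Rectangulation.setoid n)
    Rectangulation.reflect fun _ _ h => Equivalent.reflect h

theorem reflect_ofDrawing (D : Rectangulation n) :
    reflect (ofDrawing D) = ofDrawing D.reflect := rfl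

@[simp] theorem reflect_reflect (R : GenRect n) : reflect (reflect R) = R := by
  obtain ⟨D, rfl⟩ := exists_ofDrawing R
  rw [reflect_ofDrawing, reflect_ofDrawing, Rectangulation.reflect_reflect]

theorem isReflection_iff {R R' : GenRect n} : IsReflection R R' ↔ R' = reflect R := by
  constructor
  · rintro ⟨D, E, rfl, rfl, h⟩
    obtain rfl := Rectangulation.isReflection_iff.1 h
    rfl
  · rintro rfl
    obtain ⟨D, rfl⟩ := exists_ofDrawing R
    exact ⟨D, D.reflect, rfl, rfl, Rectangulation.isReflection_iff.2 rfl⟩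

theorem IsParent.reflect {R : GenRect (n + 1)} {P : GenRect n} (h : IsParent R P) :
    IsParent (reflect R) (reflect P) := by
  rw [isParent_iff_insert] at *
  obtain ⟨E, D, q, c, rfl, rfl, h⟩ := h
  exact ⟨E.reflect, D.reflect, q.reflect, flipCode c, rfl, rfl, insert_reflect.2 h⟩

/-- Reflection exchanges vertical and horizontal insertions, whereas the kind is an invariant of the
rectangulation by `Insert.flag_eq`. -/
theorem reflect_ne (hn : 1 ≤ n) (R : GenRect (n + 1)) : reflect R ≠ R := by
  intro heq
  obtain ⟨P, hP⟩ := exists_isParent hn R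
  obtain ⟨E, D, q, c, rfl, rfl, h⟩ := isParent_iff_insert.1 hP
  have h' := insert_reflect.2 h
  obtain ⟨τ, hτ⟩ := (ofDrawing_eq.1 heq).exists_extendPerm h'.bottomRight h.bottomRight
  have := h'.flag_eq (h.relabel τ) hτ
  simp [flipCode] at this

theorem isBottomBased_reflect {R : GenRect n} : IsBottomBased (reflect R) ↔ IsRightBased R := by
  obtain ⟨D, rfl⟩ := exists_ofDrawing R
  rw [reflect_ofDrawing, isBottomBased_ofDrawing, isRightBased_ofDrawing, reflect_isBottomBased]

theorem onTop_eq_reflect (hn : 1 ≤ n) : onTop n hn = reflect (sideBySide n hn) := by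
  -- Reflection turns left to right into top to bottom, so the labels have to be reversed.
  refine ofDrawing_eq.2 ⟨Fin.revPerm, fun i j => ?_⟩
  have h1 := Fin.val_rev i
  have h2 := Fin.val_rev j
  have hi := i.2
  have hj := j.2
  rw [reflect_isLeftOf, reflect_isBelow]
  simp only [IsLeftOf, IsBelow, Rectangulation.onTop, Rectangulation.sideBySide, Fin.revPerm_apply]
  norm_cast
  simp only [false_and, zero_lt_one, and_true, true_and, iff_self]
  rw [h1, h2]
  omega

theorem isRightBased_sideBySide (hn : 1 ≤ n) : IsRightBased (sideBySide n hn) := by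
  refine isRightBased_ofDrawing.2 ⟨⟨n - 1, by omega⟩, ?_, rfl, rfl⟩
  simp only [TouchesRight, Rectangulation.sideBySide]
  norm_cast
  omega

theorem isParent_sideBySide (hn : 1 ≤ n) :
    IsParent (sideBySide (n + 1) (by omega)) (sideBySide n hn) := by
  obtain ⟨E, hE⟩ := exists_isDeletion (D := Rectangulation.sideBySide (n + 1) (by omega)) hn
    (by simp [TouchesBottom, Rectangulation.sideBySide])
    (by simp [TouchesRight, Rectangulation.sideBySide])
  refine ⟨_, E, rfl, ofDrawing_eq.2 (SameRel.equivalent ?_), hE⟩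
  -- Shape ⊢ would need an edge continuing above the top boundary.
  obtain ⟨-, -, -, ⟨⟨⟨a, -, -, h⟩, -⟩, -⟩ | ⟨-, h⟩⟩ := hE
  · simp [Rectangulation.sideBySide] at h
  -- Only the rectangle next to the deleted one grows, to width 2. The drawing differs from the row
  -- of squares, but its relations are the same.
  · have hright : ∀ a : Fin n, (E.rect a).right = if (a : ℕ) + 1 = n then (n : ℝ) + 1 else
        (a : ℝ) + 1 := by
      intro a
      have hl : (Rectangulation.sideBySide (n + 1) (by omega)).IsLeftOf a.castSucc (Fin.last n) ↔
          (a : ℕ) + 1 = n := by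
        simp only [IsLeftOf, Rectangulation.sideBySide, Fin.val_castSucc, Fin.val_last]
        norm_cast
        simp
      split_ifs with hc
      · rw [(h a).2.2.2.1 (hl.2 hc)]
        simp [Rectangulation.sideBySide]
      · rw [(h a).2.2.2.2 (mt hl.1 hc)]
        simp [Rectangulation.sideBySide]
    have hleft : ∀ a : Fin n, (E.rect a).left = (a : ℝ) := fun a => by
      rw [(h a).1]; simp [Rectangulation.sideBySide]
    have hbot : ∀ a : Fin n, (E.rect a).bottom = 0 := fun a => by
      rw [(h a).2.1]; simp [Rectangulation.sideBySide]
    have htop : ∀ a : Fin n, (E.rect a).top = 1 := fun a => by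
      rw [(h a).2.2.1]; simp [Rectangulation.sideBySide]
    constructor
    · funext a b
      simp only [IsLeftOf, hleft, hbot, htop, hright, Rectangulation.sideBySide]
      split_ifs with hc
      · norm_cast
        simp only [eq_iff_iff, and_congr_left_iff]
        omega
      · rfl
    · funext a b
      simp [IsBelow, hbot, htop, Rectangulation.sideBySide]

/-! ### The parent function and the position among the siblings -/

/-- The rectangulation obtained by deletion of the bottom-right rectangle. -/
noncomputable def parent (R : GenRect (n + 2)) : GenRect (n + 1) :=
  (exists_isParent (Nat.le_add_left 1 n) R).choose

theorem isParent_iff {R : GenRect (n + 2)} {P : GenRect (n + 1)} :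
    IsParent R P ↔ parent R = P :=
  have h := (exists_isParent (Nat.le_add_left 1 n) R).choose_spec
  ⟨fun h' => h.unique h', fun h' => h' ▸ h⟩

/-- The number `k` such that a rectangulation is the `k`th child of its parent. -/
noncomputable def index (R : GenRect (n + 2)) : ℕ :=
  (isParent_iff.2 (rfl : parent R = parent R)).exists_isChild.choose

theorem isChild_iff {R : GenRect (n + 2)} {P : GenRect (n + 1)} {k : ℕ} :
    IsChild P k R ↔ parent R = P ∧ index R = k := by
  have h := (isParent_iff.2 (rfl : parent R = parent R)).exists_isChild.choose_spec
  constructor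
  · intro h'
    obtain rfl := isParent_iff.1 h'.isParent
    exact ⟨rfl, h.index_unique h'⟩
  · rintro ⟨rfl, rfl⟩
    exact h

/-- The number of insertion points. -/
noncomputable def count (P : GenRect (n + 1)) : ℕ := (existsUnique_isInsertionCount P).choose

theorem isInsertionCount_iff {P : GenRect (n + 1)} {ν : ℕ} :
    IsInsertionCount P ν ↔ ν = count P :=
  ⟨fun h => (existsUnique_isInsertionCount P).choose_spec.2 ν h,
    fun h => h ▸ (existsUnique_isInsertionCount P).choose_spec.1⟩

theorem two_le_count (P : GenRect (n + 1)) : 2 ≤ count P :=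
  (isInsertionCount_iff.2 rfl).two_le

theorem count_le_two (P : GenRect 1) : count P ≤ 2 :=
  (isInsertionCount_iff.2 rfl).le_two

theorem isChild_index (R : GenRect (n + 2)) : IsChild (parent R) (index R) R :=
  isChild_iff.2 ⟨rfl, rfl⟩

theorem one_le_index (R : GenRect (n + 2)) : 1 ≤ index R :=
  ((isChild_index R).le_count (isInsertionCount_iff.2 rfl)).1

theorem index_le_count (R : GenRect (n + 2)) : index R ≤ count (parent R) :=
  ((isChild_index R).le_count (isInsertionCount_iff.2 rfl)).2

theorem exists_child (P : GenRect (n + 1)) {k : ℕ} (hk : 1 ≤ k) (hk' : k ≤ count P) :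
    ∃ R, parent R = P ∧ index R = k := by
  obtain ⟨R, hR⟩ := (isInsertionCount_iff.2 (rfl : count P = count P)).exists_isChild hk hk'
  exact ⟨R, isChild_iff.1 hR⟩

/-- The tree structure in its final form: `parent` and `index` are coordinates in which the
algorithm is analysed. -/
theorem ext_child {R R' : GenRect (n + 2)} (h : parent R = parent R') (h' : index R = index R') :
    R = R' :=
  (isChild_index R).unique (isChild_iff.2 ⟨h.symm, h'.symm⟩)

theorem isBottomBased_iff {R : GenRect (n + 2)} : IsBottomBased R ↔ index R = 1 :=
  (isChild_index R).isBottomBased_iff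

theorem isRightBased_iff {R : GenRect (n + 2)} : IsRightBased R ↔ index R = count (parent R) :=
  (isChild_index R).isRightBased_iff (isInsertionCount_iff.2 rfl)

theorem parent_reflect (R : GenRect (n + 2)) : parent (reflect R) = reflect (parent R) :=
  isParent_iff.1 (isParent_iff.2 rfl : IsParent R (parent R)).reflect

theorem mem_parents {C : Set (GenRect (n + 2))} {P : GenRect (n + 1)} :
    P ∈ parents C ↔ ∃ R ∈ C, parent R = P := by
  simp only [parents, Set.mem_ofPred_eq, isParent_iff]

end GenRect

/-! ### Minimal jumps in terms of parents and positions -/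

namespace GenRect

variable {n : ℕ}

/-- The opposite direction. -/
def Direction.flip : Direction → Direction
  | .left => .right
  | .right => .left

@[simp] theorem Direction.flip_flip (dir : Direction) : dir.flip.flip = dir := by
  cases dir <;> rfl

/-- The order of the positions in the given direction. -/
def Direction.Lt : Direction → ℕ → ℕ → Prop
  | .left, a, b => b < a
  | .right, a, b => a < b

theorem Direction.Lt.irrefl {dir : Direction} {a : ℕ} : ¬ dir.Lt a a := by
  cases dir <;> simp [Direction.Lt]

theorem Direction.Lt.asymm {dir : Direction} {a b : ℕ} (h : dir.Lt a b) : ¬ dir.Lt b a := by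
  cases dir <;> simp only [Direction.Lt] at * <;> omega

theorem Direction.Lt.trichotomy {dir : Direction} {a b : ℕ} (h : ¬ dir.Lt a b)
    (h' : ¬ dir.Lt b a) : a = b := by
  cases dir <;> simp only [Direction.Lt] at * <;> omega

/-- The last position among the children of `P` in the given direction. -/
noncomputable def Direction.extreme (P : GenRect (n + 1)) : Direction → ℕ
  | .left => 1
  | .right => count P

theorem Direction.one_le_extreme (P : GenRect (n + 1)) (dir : Direction) :
    1 ≤ dir.extreme P ∧ dir.extreme P ≤ count P := by
  have := two_le_count P
  cases dir <;> simp only [Direction.extreme] <;> omega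

theorem Direction.not_extreme_lt (dir : Direction) (R : GenRect (n + 2)) :
    ¬ dir.Lt (dir.extreme (parent R)) (index R) := by
  have := one_le_index R
  have := index_le_count R
  cases dir <;> simp only [Direction.extreme, Direction.Lt] <;> omega

theorem exists_extreme_child (P : GenRect (n + 1)) (dir : Direction) :
    ∃ R, parent R = P ∧ index R = dir.extreme P :=
  exists_child P (dir.one_le_extreme P).1 (dir.one_le_extreme P).2

theorem IsZigzag.parents {C : Set (GenRect (n + 2))} (h : IsZigzag (n + 2) C) :
    IsZigzag (n + 1) (parents C) := h.1

theorem IsZigzag.extreme_mem {C : Set (GenRect (n + 2))} (h : IsZigzag (n + 2) C)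
    {R : GenRect (n + 2)} (hP : parent R ∈ GenRect.parents C) {dir : Direction}
    (hR : index R = dir.extreme (parent R)) : R ∈ C := by
  refine h.2 _ hP (count (parent R)) (isInsertionCount_iff.2 rfl) R ?_
  rw [isChild_iff, isChild_iff]
  cases dir
  · exact Or.inl ⟨rfl, hR⟩
  · exact Or.inr ⟨rfl, hR⟩

theorem IsMinRightJump.bounds {C : Set (GenRect n)} {R R' : GenRect n} {j d : ℕ}
    (h : IsMinRightJump n C R R' j d) : 2 ≤ j ∧ j ≤ n ∧ 0 < d := by
  match n, C, R, R', h with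
  | 0, _, _, _, h => exact h.elim
  | 1, _, _, _, h => exact h.elim
  | n + 2, _, _, _, h =>
    obtain ⟨h1, h2, h | h⟩ := h
    · exact ⟨h1, h.1.le, h2⟩
    · exact ⟨h1, h.1.le, h2⟩

theorem IsMinJump.bounds {C : Set (GenRect n)} {R R' : GenRect n} {j d : ℕ} {dir : Direction}
    (h : IsMinJump C R R' j d dir) : 2 ≤ j ∧ j ≤ n ∧ 0 < d := by
  cases dir
  · exact IsMinRightJump.bounds h
  · exact IsMinRightJump.bounds h

theorem isMinRightJump_last_iff {C : Set (GenRect (n + 2))} {R R' : GenRect (n + 2)} {d : ℕ} :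
    IsMinRightJump (n + 2) C R R' (n + 2) d ↔ 0 < d ∧ parent R = parent R' ∧
      index R' = index R + d ∧ ∀ Q ∈ C, parent Q = parent R →
        ¬ (index R < index Q ∧ index Q < index R + d) := by
  simp only [IsMinRightJump, isParent_iff, isChild_iff]
  constructor
  · rintro ⟨-, h2, ⟨-, P, k, -, rfl, h4, ⟨-, rfl⟩, ⟨-, h5⟩, h6⟩ | h⟩
    · exact ⟨h2, h4.symm, h5, fun Q hQ hQP hlt => h6 ⟨_, hlt.1, hlt.2, Q, hQ, hQP, rfl⟩⟩
    · exact (lt_irrefl _ h.1).elim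
  · rintro ⟨h1, h2, h3, h4⟩
    refine ⟨by omega, h1, Or.inl ⟨trivial, parent R, index R, one_le_index R, rfl, h2.symm,
      ⟨rfl, rfl⟩, ⟨h2.symm, h3⟩, ?_⟩⟩
    rintro ⟨l, hl1, hl2, Q, hQ, hQP, rfl⟩
    exact h4 Q hQ hQP ⟨hl1, hl2⟩

theorem exists_isMinJump_last_iff {C : Set (GenRect (n + 2))} {R R' : GenRect (n + 2)}
    {dir : Direction} :
    (∃ d, IsMinJump C R R' (n + 2) d dir) ↔ parent R = parent R' ∧ dir.Lt (index R) (index R') ∧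
      ∀ Q ∈ C, parent Q = parent R →
        ¬ (dir.Lt (index R) (index Q) ∧ dir.Lt (index Q) (index R')) := by
  cases dir
  · simp only [IsMinJump, isMinRightJump_last_iff, Direction.Lt]
    constructor
    · rintro ⟨d, h1, h2, h3, h4⟩
      refine ⟨h2.symm, by omega, fun Q hQ hQP hlt => h4 Q hQ (hQP.trans h2.symm) ?_⟩
      omega
    · rintro ⟨h1, h2, h3⟩
      refine ⟨index R - index R', by omega, h1.symm, by omega, fun Q hQ hQP hlt => ?_⟩
      refine h3 Q hQ (hQP.trans h1.symm) ?_
      omega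
  · simp only [IsMinJump, isMinRightJump_last_iff, Direction.Lt]
    constructor
    · rintro ⟨d, h1, h2, h3, h4⟩
      refine ⟨h2, by omega, fun Q hQ hQP hlt => h4 Q hQ hQP ?_⟩
      omega
    · rintro ⟨h1, h2, h3⟩
      refine ⟨index R' - index R, by omega, h1, by omega, fun Q hQ hQP hlt => ?_⟩
      refine h3 Q hQ hQP ?_
      omega

theorem isMinRightJump_iff_of_ne {C : Set (GenRect (n + 2))} {R R' : GenRect (n + 2)} {j d : ℕ}
    (hj : j ≠ n + 2) :
    IsMinRightJump (n + 2) C R R' j d ↔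
      ((index R = 1 ∧ index R' = 1) ∨
        (index R = count (parent R) ∧ index R' = count (parent R'))) ∧
      IsMinRightJump (n + 1) (parents C) (parent R) (parent R') j d := by
  rw [IsMinRightJump]
  simp only [isParent_iff, isBottomBased_iff, isRightBased_iff]
  constructor
  · rintro ⟨-, -, h | ⟨-, h, P, P', rfl, rfl, h'⟩⟩
    · exact (hj h.1).elim
    · exact ⟨h, h'⟩
  · rintro ⟨h, h'⟩
    obtain ⟨h1, h2, h3⟩ := h'.bounds
    exact ⟨h1, h3, Or.inr ⟨by omega, h, _, _, rfl, rfl, h'⟩⟩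

/-- Since 1 differs from the number of children, `R` is of only one extreme type, so the alternative
in the definition of a jump forces `R'` to have the same type. -/
theorem isMinJump_iff_of_ne {C : Set (GenRect (n + 2))} {R R' : GenRect (n + 2)} {j d : ℕ}
    (hj : j ≠ n + 2) {dir dir' : Direction} (hR : index R = dir.extreme (parent R)) :
    IsMinJump C R R' j d dir' ↔ index R' = dir.extreme (parent R') ∧
      IsMinJump (parents C) (parent R) (parent R') j d dir' := by
  have h2 := two_le_count (parent R)
  have h2' := two_le_count (parent R')
  cases dir' <;> simp only [IsMinJump, isMinRightJump_iff_of_ne hj] <;>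
    refine and_congr_left fun _ => ?_ <;> cases dir <;> simp only [Direction.extreme] at * <;>
    omega

theorem isCandidate_le {C : Set (GenRect n)} {V : List (GenRect n)} {cur nxt : GenRect n}
    {j : ℕ} {dir : Direction} (h : IsCandidate C V cur j dir nxt) : j ≤ n := by
  obtain ⟨-, -, d, h⟩ := h
  exact h.bounds.2.1

/-- A step of the algorithm between two children of the same rectangulation. -/
theorem isStep_iff_of_siblings {C : Set (GenRect (n + 2))} {V : List (GenRect (n + 2))}
    {cur nxt : GenRect (n + 2)} {dir : Direction} (hnxt : nxt ∈ C)
    (hV : ∀ R ∈ C, parent R = parent cur → (R ∈ V ↔ ¬ dir.Lt (index cur) (index R)))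
    (hpar : parent cur = parent nxt) (hlt : dir.Lt (index cur) (index nxt))
    (hmin : ∀ Q ∈ C, parent Q = parent cur →
      ¬ (dir.Lt (index cur) (index Q) ∧ dir.Lt (index Q) (index nxt)))
    {x : GenRect (n + 2)} : IsStep C V cur x ↔ x = nxt := by
  -- Jumps of the last rectangle have the greatest possible index, so they take precedence over all
  -- others.
  have hcand : IsCandidate C V cur (n + 2) dir nxt :=
    ⟨hnxt, fun h => (hV nxt hnxt hpar.symm).1 h hlt, exists_isMinJump_last_iff.2 ⟨hpar, hlt, hmin⟩⟩
  have huniq : ∀ dir' R, IsCandidate C V cur (n + 2) dir' R → dir' = dir ∧ R = nxt := by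
    rintro dir' R ⟨h1, h2, h3⟩
    obtain ⟨h4, h5, h6⟩ := exists_isMinJump_last_iff.1 h3
    rw [hV R h1 h4.symm, not_not] at h2
    -- Siblings that are not ahead have been visited, so no jump backwards is a candidate.
    obtain rfl : dir' = dir := by
      cases dir <;> cases dir' <;> simp only [Direction.Lt] at * <;> omega
    refine ⟨rfl, ext_child (h4.symm.trans hpar) ?_⟩
    exact Direction.Lt.trichotomy (dir := dir') (fun h => hmin R h1 h4.symm ⟨h2, h⟩)
      (fun h => h6 nxt hnxt hpar.symm ⟨hlt, h⟩)
  constructor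
  · rintro ⟨j, dir', h1, h2, -⟩
    obtain rfl : j = n + 2 := le_antisymm (isCandidate_le h1) (h2 _ _ _ hcand)
    exact (huniq _ _ h1).2
  · rintro rfl
    exact ⟨n + 2, dir, hcand, fun j' dir' R h => isCandidate_le h, fun dir' R h => (huniq _ _ h).1⟩

/-- When all children of a rectangulation have been visited, the steps of the algorithm correspond
to those one level below. -/
theorem isStep_iff_parent {C : Set (GenRect (n + 2))} (hC : IsZigzag (n + 2) C)
    {V : List (GenRect (n + 2))} {VP : List (GenRect (n + 1))} {cur : GenRect (n + 2)}
    {dir : Direction} (hcur : index cur = dir.extreme (parent cur))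
    (hV : ∀ R ∈ C, R ∈ V ↔ parent R ∈ VP) (hP : parent cur ∈ VP) {x : GenRect (n + 2)} :
    IsStep C V cur x ↔ index x = dir.extreme (parent x) ∧
      IsStep (parents C) VP (parent cur) (parent x) := by
  have hcand : ∀ j dir' R, IsCandidate C V cur j dir' R ↔ index R = dir.extreme (parent R) ∧
      IsCandidate (parents C) VP (parent cur) j dir' (parent R) := by
    intro j dir' R
    constructor
    · rintro ⟨h1, h2, h3⟩
      rw [hV R h1] at h2
      -- A jump of the last rectangle keeps the parent, and all children in `C` of this parent have
      -- been visited.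
      have hj : j ≠ n + 2 := by
        rintro rfl
        exact h2 ((exists_isMinJump_last_iff.1 h3).1 ▸ hP)
      simp only [isMinJump_iff_of_ne hj hcur, exists_and_left] at h3
      exact ⟨h3.1, mem_parents.2 ⟨R, h1, rfl⟩, h2, h3.2⟩
    · rintro ⟨h, h1, h2, d, h3⟩
      -- The zigzag condition enters here: the lift of a jump one level below stays in `C`.
      have hR := hC.extreme_mem h1 h
      have hj : j ≠ n + 2 := by
        have := h3.bounds
        omega
      exact ⟨hR, by rwa [hV R hR], d, (isMinJump_iff_of_ne hj hcur).2 ⟨h, h3⟩⟩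
  have hlift : ∀ j dir' P, IsCandidate (parents C) VP (parent cur) j dir' P →
      ∃ R, IsCandidate C V cur j dir' R := by
    intro j dir' P h
    obtain ⟨R, rfl, hR⟩ := exists_extreme_child P dir
    exact ⟨R, (hcand _ _ _).2 ⟨hR, h⟩⟩
  constructor
  · rintro ⟨j, dir', h1, h2, h3⟩
    obtain ⟨hx, h1⟩ := (hcand _ _ _).1 h1
    refine ⟨hx, j, dir', h1, fun j' dir'' P h => ?_, fun dir'' P h => ?_⟩
    · obtain ⟨R, hR⟩ := hlift _ _ _ h
      exact h2 _ _ _ hR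
    · obtain ⟨R, hR⟩ := hlift _ _ _ h
      exact h3 _ _ hR
  · rintro ⟨hx, j, dir', h1, h2, h3⟩
    exact ⟨j, dir', (hcand _ _ _).2 ⟨hx, h1⟩, fun j' dir'' R h => h2 _ _ _ ((hcand _ _ _).1 h).2,
      fun dir'' R h => h3 _ _ ((hcand _ _ _).1 h).2⟩

/-! ### Runs of the algorithm -/

/-- After the visits in `vis` and of `cur`, the algorithm necessarily continues with the list given
last, and then everything has been visited. -/
def Run (C : Set (GenRect n)) :
    List (GenRect n) → GenRect n → List (GenRect n) → Prop
  | vis, cur, [] => ∀ R ∈ C, R ∈ vis ++ [cur]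
  | vis, cur, nxt :: rest =>
      (∀ x, IsStep C (vis ++ [cur]) cur x ↔ x = nxt) ∧ Run C (vis ++ [cur]) nxt rest

/-- A forced run can be restarted at any of its entries. -/
theorem Run.split {C : Set (GenRect n)} {vis : List (GenRect n)} {cur : GenRect n}
    {rest : List (GenRect n)} (h : Run C vis cur rest) {a : List (GenRect n)} {c : GenRect n}
    {b : List (GenRect n)} (hs : cur :: rest = a ++ c :: b) : Run C (vis ++ a) c b := by
  induction a generalizing vis cur rest with
  | nil =>
    obtain ⟨rfl, rfl⟩ := List.cons.inj hs
    simpa using h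
  | cons x a ih =>
    obtain ⟨rfl, rfl⟩ := List.cons.inj hs
    cases a with
    | nil =>
      simpa using ih h.2 rfl
    | cons y a =>
      simpa using ih h.2 rfl

theorem not_isStep_of_subset {C : Set (GenRect n)} {V : List (GenRect n)} {cur x : GenRect n}
    (h : ∀ R ∈ C, R ∈ V) : ¬ IsStep C V cur x := by
  rintro ⟨j, dir, ⟨h1, h2, -⟩, -⟩
  exact h2 (h x h1)

/-- As every step is forced, any stage of the algorithm is a nonempty prefix of the run;
`Run.visits` is the converse. -/
theorem Visits.exists_split {C : Set (GenRect n)} {R₀ : GenRect n} {rest : List (GenRect n)}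
    (h : Run C [] R₀ rest) {l : List (GenRect n)} (hl : Visits C R₀ l) :
    ∃ a c b, l = a ++ [c] ∧ R₀ :: rest = a ++ c :: b := by
  induction hl with
  | init => exact ⟨[], R₀, rest, rfl, rfl⟩
  | step visited cur nxt _ hstep ih =>
    obtain ⟨a, c, b, h1, h2⟩ := ih
    obtain ⟨rfl, h1'⟩ := List.append_inj' h1 rfl
    obtain rfl := List.singleton_inj.1 h1'
    have hrun := h.split h2
    rw [List.nil_append] at hrun
    cases b with
    | nil => exact (not_isStep_of_subset hrun hstep).elim
    | cons x b =>
      obtain rfl := (hrun.1 nxt).1 hstep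
      exact ⟨visited ++ [cur], nxt, b, rfl, by simp [h2]⟩

theorem Run.visits {C : Set (GenRect n)} {R₀ : GenRect n} {rest : List (GenRect n)}
    (h : Run C [] R₀ rest) (a : List (GenRect n)) {c : GenRect n} {b : List (GenRect n)}
    (hs : R₀ :: rest = a ++ c :: b) : Visits C R₀ (a ++ [c]) := by
  induction a using List.reverseRecOn generalizing c b with
  | nil =>
    obtain ⟨rfl, rfl⟩ := List.cons.inj hs
    exact .init
  | append_singleton a c' ih =>
    have hs' : R₀ :: rest = a ++ c' :: (c :: b) := by simpa using hs
    have hrun := h.split hs'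
    rw [List.nil_append] at hrun
    exact .step a c' c (ih hs') ((hrun.1 c).2 rfl)

theorem Run.isOutput_iff {C : Set (GenRect n)} {R₀ : GenRect n} {rest : List (GenRect n)}
    (h : Run C [] R₀ rest) {L : List (GenRect n)} :
    IsOutput C R₀ L ↔ L = R₀ :: rest := by
  constructor
  · rintro ⟨h1, h2⟩
    obtain ⟨a, c, b, rfl, hs⟩ := h1.exists_split h
    have hrun := h.split hs
    rw [List.nil_append] at hrun
    cases b with
    | nil => exact hs.symm
    | cons x b => exact (h2 a c rfl ⟨x, (hrun.1 x).2 rfl⟩).elim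
  · rintro rfl
    refine ⟨?_, fun visited cur hL => ?_⟩
    · obtain ⟨a, c, hs⟩ := List.eq_nil_or_concat' (R₀ :: rest) |>.resolve_left (by simp)
      rw [hs]
      exact h.visits a hs
    · rintro ⟨x, hx⟩
      have hrun := h.split hL
      rw [List.nil_append] at hrun
      rw [hL] at hx
      exact not_isStep_of_subset hrun hx

/-! ### The recursive description of the listing -/

theorem exists_block (C : Set (GenRect (n + 2))) (P : GenRect (n + 1)) (dir : Direction) :
    ∃ l : List (GenRect (n + 2)), l.Pairwise (fun R R' => dir.Lt (index R) (index R')) ∧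
      ∀ R, R ∈ l ↔ R ∈ C ∧ parent R = P := by
  classical
  have key : ∃ l : List (GenRect (n + 2)), l.Pairwise (fun R R' => index R < index R') ∧
      ∀ R, R ∈ l ↔ R ∈ C ∧ parent R = P := by
    have : Nonempty (GenRect (n + 2)) := ⟨(exists_extreme_child P .left).choose⟩
    choose! f hf hf' using fun k (hk : 1 ≤ k ∧ k ≤ count P) => exists_child P hk.1 hk.2
    -- The range starts at 0, the positions of children at 1.
    refine ⟨((List.range (count P)).map fun k => f (k + 1)).filter (· ∈ C), ?_, fun R => ?_⟩
    · refine List.Pairwise.filter _ ?_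
      rw [List.pairwise_map]
      refine List.pairwise_lt_range.imp_of_mem fun {a b} ha hb hab => ?_
      rw [List.mem_range] at ha hb
      rw [hf' _ ⟨by omega, by omega⟩, hf' _ ⟨by omega, by omega⟩]
      omega
    · simp only [List.mem_filter, List.mem_map, List.mem_range, decide_eq_true_eq]
      constructor
      · rintro ⟨⟨k, hk, rfl⟩, hC⟩
        exact ⟨hC, hf _ ⟨by omega, by omega⟩⟩
      · rintro ⟨hC, rfl⟩
        have h1 := one_le_index R
        have h2 := index_le_count R
        refine ⟨⟨index R - 1, by omega, ?_⟩, hC⟩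
        have h3 : index R - 1 + 1 = index R := by omega
        rw [h3]
        exact ext_child (hf _ ⟨h1, h2⟩) (hf' _ ⟨h1, h2⟩)
  obtain ⟨l, h1, h2⟩ := key
  cases dir
  · exact ⟨l.reverse, List.pairwise_reverse.2 h1, fun R => by rw [List.mem_reverse, h2]⟩
  · exact ⟨l, h1, h2⟩

/-- The children of `P` in `C`, sorted in the given direction. -/
noncomputable def block (C : Set (GenRect (n + 2))) (P : GenRect (n + 1)) (dir : Direction) :
    List (GenRect (n + 2)) := (exists_block C P dir).choose

theorem pairwise_block (C : Set (GenRect (n + 2))) (P : GenRect (n + 1)) (dir : Direction) :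
    (block C P dir).Pairwise (fun R R' => dir.Lt (index R) (index R')) :=
  (exists_block C P dir).choose_spec.1

theorem mem_block {C : Set (GenRect (n + 2))} {P : GenRect (n + 1)} {dir : Direction}
    {R : GenRect (n + 2)} : R ∈ block C P dir ↔ R ∈ C ∧ parent R = P :=
  (exists_block C P dir).choose_spec.2 R

theorem nodup_block (C : Set (GenRect (n + 2))) (P : GenRect (n + 1)) (dir : Direction) :
    (block C P dir).Nodup :=
  (pairwise_block C P dir).imp fun {a b} h => by rintro rfl; exact h.irrefl

/-- The extreme child belongs to `C` by the zigzag condition and no sibling lies beyond it, so every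
block ends there. By the same argument it begins at the opposite extreme. -/
theorem block_eq_append {C : Set (GenRect (n + 2))} (hC : IsZigzag (n + 2) C)
    {P : GenRect (n + 1)} (hP : P ∈ parents C) {dir : Direction} {u : List (GenRect (n + 2))}
    {R : GenRect (n + 2)} (h : block C P dir = u ++ [R]) :
    parent R = P ∧ index R = dir.extreme P := by
  have hpw := pairwise_block C P dir
  have hR : parent R = P := (mem_block.1 (by rw [h]; simp : R ∈ block C P dir)).2
  refine ⟨hR, ?_⟩
  obtain ⟨Q, rfl, hQ⟩ := exists_extreme_child P dir
  have hmem : Q ∈ block C (parent Q) dir := mem_block.2 ⟨hC.extreme_mem hP hQ, rfl⟩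
  rw [h] at hmem hpw
  rcases List.mem_append.1 hmem with hu | hu
  · have := (List.pairwise_append.1 hpw).2.2 Q hu R (by simp)
    rw [hQ, ← hR] at this
    exact (dir.not_extreme_lt R this).elim
  · rw [← List.mem_singleton.1 hu, hQ]

theorem exists_block_eq_cons {C : Set (GenRect (n + 2))} (hC : IsZigzag (n + 2) C)
    {P : GenRect (n + 1)} (hP : P ∈ parents C) (dir : Direction) :
    ∃ R t, block C P dir = R :: t ∧ parent R = P ∧ index R = dir.flip.extreme P := by
  have hpw := pairwise_block C P dir
  obtain ⟨Q, rfl, hQ⟩ := exists_extreme_child P dir.flip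
  have hmem : Q ∈ block C (parent Q) dir := mem_block.2 ⟨hC.extreme_mem hP hQ, rfl⟩
  cases h : block C (parent Q) dir with
  | nil => rw [h] at hmem; simp at hmem
  | cons R t =>
    have hR : parent R = parent Q :=
      (mem_block.1 (by rw [h]; simp : R ∈ block C (parent Q) dir)).2
    refine ⟨R, t, rfl, hR, ?_⟩
    rw [h] at hmem hpw
    rcases List.mem_cons.1 hmem with rfl | ht
    · exact hQ
    · have hlt := (List.pairwise_cons.1 hpw).1 Q ht
      refine (dir.flip.not_extreme_lt R ?_).elim
      rw [hR, ← hQ]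
      cases dir <;> exact hlt

/-- The concatenation of the lists of children of the given rectangulations, in alternating
directions. -/
noncomputable def weave (C : Set (GenRect (n + 2))) :
    Direction → List (GenRect (n + 1)) → List (GenRect (n + 2))
  | _, [] => []
  | dir, P :: Ps => block C P dir ++ weave C dir.flip Ps

theorem mem_weave {C : Set (GenRect (n + 2))} {dir : Direction} {Ps : List (GenRect (n + 1))}
    {R : GenRect (n + 2)} : R ∈ weave C dir Ps ↔ R ∈ C ∧ parent R ∈ Ps := by
  induction Ps generalizing dir with
  | nil => simp [weave]
  | cons P Ps ih =>
    rw [weave, List.mem_append, mem_block, ih, List.mem_cons]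
    tauto

theorem nodup_weave {C : Set (GenRect (n + 2))} {dir : Direction} {Ps : List (GenRect (n + 1))}
    (h : Ps.Nodup) : (weave C dir Ps).Nodup := by
  induction Ps generalizing dir with
  | nil => exact List.nodup_nil
  | cons P Ps ih =>
    obtain ⟨h1, h2⟩ := List.nodup_cons.1 h
    refine (nodup_block C P dir).append (ih h2) fun R hR hR' => h1 ?_
    rw [← (mem_block.1 hR).2]
    exact (mem_weave.1 hR').2

/-- Directions alternate, so the parity of the number of blocks decides in which direction the last
block runs. -/
theorem getLast?_weave {C : Set (GenRect (n + 2))} (hC : IsZigzag (n + 2) C) {dir : Direction}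
    {Ps : List (GenRect (n + 1))} (hPs : ∀ P ∈ Ps, P ∈ parents C) {P : GenRect (n + 1)}
    (hP : Ps.getLast? = some P) :
    ∃ R, (weave C dir Ps).getLast? = some R ∧ parent R = P ∧
      index R = (if Even Ps.length then dir.flip else dir).extreme P := by
  induction Ps generalizing dir with
  | nil => simp at hP
  | cons Q Ps ih =>
    cases Ps with
    | nil =>
      obtain rfl : Q = P := by simpa using hP
      have hQ : Q ∈ parents C := hPs Q (by simp)
      obtain ⟨S, t, hS, -⟩ := exists_block_eq_cons hC hQ dir
      obtain ⟨u, R, hs⟩ := (List.eq_nil_or_concat' (block C Q dir)).resolve_left (by simp [hS])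
      obtain ⟨h1, h2⟩ := block_eq_append hC hQ hs
      exact ⟨R, by simp [weave, hs], h1, by simpa using h2⟩
    | cons Q' Ps =>
      obtain ⟨R, h1, h2, h3⟩ := ih (dir := dir.flip) (fun P hP => hPs P (List.mem_cons_of_mem _ hP))
        (by simpa using hP)
      refine ⟨R, ?_, h2, ?_⟩
      · rw [weave, List.getLast?_append, h1]
        rfl
      · rw [h3]
        simp only [List.length_cons, Direction.flip_flip]
        congr 1
        by_cases he : Even (Ps.length + 1)
        · rw [if_pos he, if_neg (by rw [Nat.even_add_one]; simpa using he)]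
        · rw [if_neg he, if_pos (by rw [Nat.even_add_one]; exact he)]

/-- A double recursion: over the parents, and within a block over its remaining elements. Within a
block the next step leads to the next sibling; after the last sibling it is the lift of the next
step of the parents' run. -/
theorem Run.weave {C : Set (GenRect (n + 2))} (hC : IsZigzag (n + 2) C)
    {visP : List (GenRect (n + 1))} {P : GenRect (n + 1)} {Ps : List (GenRect (n + 1))}
    (hrun : Run (parents C) visP P Ps) (hnd : (visP ++ P :: Ps).Nodup)
    (hPs : ∀ Q ∈ P :: Ps, Q ∈ parents C) {dir : Direction} {vis : List (GenRect (n + 2))}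
    (hvis : ∀ R ∈ C, R ∈ vis ↔ parent R ∈ visP) {h : GenRect (n + 2)}
    {t : List (GenRect (n + 2))} (hb : block C P dir = h :: t) :
    Run C vis h (t ++ GenRect.weave C dir.flip Ps) := by
  have hP : P ∈ parents C := hPs P (by simp)
  have hPvis : P ∉ visP := fun hmem =>
    (List.nodup_append.1 hnd).2.2 P hmem P (by simp) rfl
  have hpw := pairwise_block C P dir
  -- The block is split into the visited part `u`, the current element and the rest `w`.
  suffices key : ∀ (w u : List (GenRect (n + 2))) (cur : GenRect (n + 2))
      (vis' : List (GenRect (n + 2))), block C P dir = u ++ cur :: w →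
      (∀ R ∈ C, R ∈ vis' ↔ parent R ∈ visP ∨ R ∈ u) →
      Run C vis' cur (w ++ GenRect.weave C dir.flip Ps) from
    key t [] h vis hb (by simpa using hvis)
  intro w
  induction w with
  | nil =>
    intro u cur vis' hu hvis'
    obtain ⟨h1, h2⟩ := block_eq_append hC hP hu
    have hV : ∀ R ∈ C, R ∈ vis' ++ [cur] ↔ parent R ∈ visP ++ [P] := by
      intro R hR
      have : R ∈ block C P dir ↔ parent R = P := by simp [mem_block, hR]
      rw [List.mem_append, hvis' R hR, List.mem_append, List.mem_singleton, List.mem_singleton,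
        ← this, hu]
      simp [or_assoc]
    rw [List.nil_append]
    cases Ps with
    | nil => exact fun R hR => (hV R hR).2 (hrun _ (mem_parents.2 ⟨R, hR, rfl⟩))
    | cons P' Ps =>
      have hP' : P' ∈ parents C := hPs P' (by simp)
      -- The flipped direction makes the next block begin at the extreme type at which the current
      -- one ends.
      obtain ⟨h', t', hb', hpar', hidx'⟩ := exists_block_eq_cons hC hP' dir.flip
      rw [Direction.flip_flip] at hidx'
      rw [GenRect.weave, hb', List.cons_append]
      refine ⟨fun x => ?_, ?_⟩
      · rw [isStep_iff_parent hC (h1.symm ▸ h2) hV (by rw [h1]; simp), h1, hrun.1]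
        constructor
        · rintro ⟨hx, rfl⟩
          exact ext_child hpar'.symm (hx.trans hidx'.symm)
        · rintro rfl
          exact ⟨by rw [hidx', hpar'], hpar'⟩
      · exact Run.weave hC hrun.2 (by simpa using hnd)
          (fun Q hQ => hPs Q (List.mem_cons_of_mem _ hQ)) hV hb'
  | cons nxt w ihw =>
    intro u cur vis' hu hvis'
    have hmem : ∀ R ∈ C, parent R = P → R ∈ u ∨ R = cur ∨ R = nxt ∨ R ∈ w := by
      intro R hR hRP
      have : R ∈ block C P dir := mem_block.2 ⟨hR, hRP⟩
      simpa [hu] using this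
    obtain ⟨hcur, hcurP⟩ := mem_block.1 (by rw [hu]; simp : cur ∈ block C P dir)
    obtain ⟨hnxt, hnxtP⟩ := mem_block.1 (by rw [hu]; simp : nxt ∈ block C P dir)
    rw [hu] at hpw
    obtain ⟨-, hpw1, hpw2⟩ := List.pairwise_append.1 hpw
    obtain ⟨hpw3, hpw4⟩ := List.pairwise_cons.1 hpw1
    obtain ⟨hpw5, -⟩ := List.pairwise_cons.1 hpw4
    rw [List.cons_append]
    refine ⟨fun x => ?_, ihw (u ++ [cur]) nxt (vis' ++ [cur]) (by simpa using hu) fun R hR => ?_⟩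
    · refine isStep_iff_of_siblings (dir := dir) hnxt (fun R hR hRP => ?_)
        (hcurP.trans hnxtP.symm) (hpw3 nxt (by simp)) fun Q hQ hQP => ?_
      · have hRP' : parent R = P := hRP.trans hcurP
        rw [List.mem_append, hvis' R hR, hRP', List.mem_singleton]
        constructor
        · rintro ((h | h) | rfl)
          · exact (hPvis h).elim
          · exact (hpw2 R h cur (by simp)).asymm
          · exact Direction.Lt.irrefl
        · intro hlt
          rcases hmem R hR hRP' with h | h | h | h
          · exact Or.inl (Or.inr h)
          · exact Or.inr h
          · exact (hlt (hpw3 R (by simp [h]))).elim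
          · exact (hlt (hpw3 R (by simp [h]))).elim
      · rintro ⟨h1, h2⟩
        rcases hmem Q hQ (hQP.trans hcurP) with h | rfl | rfl | h
        · exact (hpw2 Q h cur (by simp)).asymm h1
        · exact h1.irrefl
        · exact h2.irrefl
        · exact (hpw5 Q h).asymm h2
    · rw [List.mem_append, hvis' R hR, List.mem_append]
      tauto

end GenRect

/-! ### The listing of a zigzag set -/

namespace GenRect

open Rectangulation

variable {n : ℕ}

theorem eq_square (R : GenRect 1) : R = square := by
  obtain ⟨D, rfl⟩ := exists_ofDrawing R
  refine ofDrawing_eq.2 ⟨1, fun i j => ?_⟩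
  obtain rfl := Subsingleton.elim i j
  simp [isLeftOf_irrefl, isBelow_irrefl]

/-- The rectangulation from which the first jumps of the last rectangle go in the given
direction. -/
def Direction.start (n : ℕ) : Direction → GenRect (n + 1)
  | .left => sideBySide (n + 1) (Nat.le_add_left 1 n)
  | .right => onTop (n + 1) (Nat.le_add_left 1 n)

theorem Direction.parent_start (dir : Direction) : parent (dir.start (n + 1)) = dir.start n := by
  rw [← isParent_iff]
  have h := isParent_sideBySide (Nat.le_add_left 1 n)
  cases dir
  · exact h
  · simp only [Direction.start, onTop_eq_reflect]
    exact h.reflect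

/-- The initial rectangulation is at the end of its block opposite to the first direction of travel:
right-based for leftward jumps, bottom-based for rightward ones. -/
theorem Direction.index_start (dir : Direction) :
    index (dir.start (n + 1)) = dir.flip.extreme (dir.start n) := by
  rw [← dir.parent_start (n := n)]
  cases dir
  · exact isRightBased_iff.1 (isRightBased_sideBySide _)
  · refine isBottomBased_iff.1 ?_
    simp only [Direction.start, onTop_eq_reflect]
    exact isBottomBased_reflect.2 (isRightBased_sideBySide _)

theorem Direction.flip_extreme_lt (dir : Direction) (P : GenRect (n + 1)) :
    dir.Lt (dir.flip.extreme P) (dir.extreme P) := by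
  have := two_le_count P
  cases dir <;> simp only [Direction.extreme, Direction.flip, Direction.Lt] <;> omega

theorem IsSymmetric.reflect_mem {C : Set (GenRect n)} (h : IsSymmetric C) {R : GenRect n}
    (hR : R ∈ C) : reflect R ∈ C :=
  h R hR _ (isReflection_iff.2 rfl)

theorem IsSymmetric.parents {C : Set (GenRect (n + 2))} (h : IsSymmetric C) :
    IsSymmetric (parents C) := by
  intro P hP P' hP'
  obtain rfl := isReflection_iff.1 hP'
  obtain ⟨R, hR, rfl⟩ := mem_parents.1 hP
  exact mem_parents.2 ⟨reflect R, h.reflect_mem hR, parent_reflect R⟩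

/-- Reflection pairs up the elements of `C` without fixed points; the count is taken modulo 2. -/
theorem IsSymmetric.even_length (hn : 1 ≤ n) {C : Set (GenRect (n + 1))} (h : IsSymmetric C)
    {L : List (GenRect (n + 1))} (hnd : L.Nodup) (hL : ∀ R, R ∈ L ↔ R ∈ C) :
    Even L.length := by
  classical
  rw [← List.toFinset_card_of_nodup hnd, ← ZMod.natCast_eq_zero_iff_even, Finset.card_eq_sum_ones,
    Nat.cast_sum]
  refine Finset.sum_involution (fun R _ => reflect R) ?_ ?_ ?_ ?_
  · intros
    decide
  · intro R _ _
    exact reflect_ne hn R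
  · intro R hR
    rw [List.mem_toFinset, hL] at *
    exact h.reflect_mem hR
  · intro R _
    exact reflect_reflect R

/-- Induction over the number of rectangles: the run for the parents is woven into the run for `C`.
Cyclicity is carried along, because it is lifted from one level to the next. -/
theorem IsZigzag.exists_run (dir : Direction) {C : Set (GenRect (n + 1))}
    (hC : IsZigzag (n + 1) C) :
    ∃ rest, (dir.start n :: rest).Nodup ∧ (∀ R, R ∈ dir.start n :: rest ↔ R ∈ C) ∧
      Run C [] (dir.start n) rest ∧
      (1 ≤ n → IsSymmetric C → ∃ last, (dir.start n :: rest).getLast? = some last ∧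
        DifferInMinJump C (dir.start n) last) := by
  induction n with
  | zero =>
    obtain rfl : C = {square} := hC
    have h := eq_square (dir.start 0)
    exact ⟨[], by simp, by simp [h], by simp [Run, h], by simp⟩
  | succ n ih =>
    obtain ⟨Ps, hnd, hmem, hrun, hcyc⟩ := ih hC.parents
    have hPs : ∀ P ∈ dir.start n :: Ps, P ∈ GenRect.parents C := fun P => (hmem P).1
    obtain ⟨R, t, hb, hR, hR'⟩ := exists_block_eq_cons hC (hPs _ List.mem_cons_self) dir
    obtain rfl : R = dir.start (n + 1) :=
      ext_child (hR.trans dir.parent_start.symm) (hR'.trans dir.index_start.symm)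
    have hw : weave C dir (dir.start n :: Ps) =
        dir.start (n + 1) :: (t ++ weave C dir.flip Ps) := by
      rw [weave, hb, List.cons_append]
    refine ⟨t ++ weave C dir.flip Ps, ?_, fun R => ?_, ?_, fun _ hsymm => ?_⟩
    · rw [← hw]
      exact nodup_weave hnd
    · rw [← hw, mem_weave, hmem, and_iff_left_iff_imp]
      exact fun h => mem_parents.2 ⟨R, h, rfl⟩
    · exact Run.weave hC hrun hnd hPs (by simp) hb
    · rw [← hw]
      -- Two rectangles form a separate case: the single parent is its own mirror image, so the
      -- parity argument fails, but there is only one block.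
      rcases Nat.eq_zero_or_pos n with rfl | hn
      · obtain rfl : Ps = [] := by
          cases Ps with
          | nil => rfl
          | cons P Ps =>
            exact (List.nodup_cons.1 hnd).1 (by simp [eq_square (dir.start 0), eq_square P]) |>.elim
        obtain ⟨last, h1, h2, h3⟩ := getLast?_weave hC (dir := dir) hPs (P := dir.start 0) rfl
        rw [if_neg (by simp)] at h3
        refine ⟨last, h1, ?_⟩
        obtain ⟨d, hd⟩ : ∃ d, IsMinJump C (dir.start 1) last 2 d dir := by
          refine exists_isMinJump_last_iff.2 ⟨hR.trans h2.symm, ?_, fun Q _ _ hlt => ?_⟩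
          · rw [hR', h3]
            exact dir.flip_extreme_lt _
          -- The square has exactly two children, so no position lies between them.
          · have h4 := two_le_count (dir.start 0)
            have h5 := count_le_two (dir.start 0)
            rw [hR', h3] at hlt
            cases dir <;> simp only [Direction.extreme, Direction.flip, Direction.Lt] at * <;> omega
        exact ⟨2, d, dir, hd⟩
      · obtain ⟨P, hP, j, d, dir', hj⟩ := hcyc hn hsymm.parents
        obtain ⟨last, h1, rfl, h3⟩ := getLast?_weave hC (dir := dir) hPs hP
        -- With an even number of blocks the last one ends at the extreme type at which the first
        -- one starts, so the cyclic jump of the parents lifts.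
        rw [if_pos (hsymm.parents.even_length hn hnd hmem)] at h3
        have := hj.bounds
        refine ⟨last, h1, j, d, dir', (isMinJump_iff_of_ne (by omega) (hR ▸ hR')).2 ⟨h3, ?_⟩⟩
        rwa [hR]

end GenRect

theorem theorem1 (n : ℕ) (hn : 1 ≤ n) (C : Set (GenRect n)) (hC : GenRect.IsZigzag n C)
    (R₀ : GenRect n) (hR₀ : R₀ = GenRect.sideBySide n hn ∨ R₀ = GenRect.onTop n hn) :
    ∃ L : List (GenRect n),
      (∀ L', GenRect.IsOutput C R₀ L' ↔ L' = L) ∧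
      L.Nodup ∧ (∀ R, R ∈ L ↔ R ∈ C) ∧
      (2 ≤ n → GenRect.IsSymmetric C →
        ∃ first last, L.head? = some first ∧ L.getLast? = some last ∧
          GenRect.DifferInMinJump C first last) := by
  obtain ⟨m, rfl⟩ : ∃ m, n = m + 1 := ⟨n - 1, by omega⟩
  obtain ⟨dir, rfl⟩ : ∃ dir : GenRect.Direction, R₀ = dir.start m := by
    rcases hR₀ with rfl | rfl
    · exact ⟨.left, rfl⟩
    · exact ⟨.right, rfl⟩
  obtain ⟨rest, h1, h2, h3, h4⟩ := hC.exists_run dir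
  refine ⟨dir.start m :: rest, fun L' => h3.isOutput_iff, h1, h2, fun hm hsymm => ?_⟩
  obtain ⟨last, h5, h6⟩ := h4 (by omega) hsymm
  exact ⟨_, last, rfl, h5, h6⟩
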